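/- **Setting.** Let $V_j(t)$, $t\ge 0$, $j\in\mathbb Z$, be independent continuous-time simple symmetric random walks on $\mathbb Z$ (independent increments, $\mathrm E[e^{iz(V_j(t)-V_j(s))}]=e^{(t-s)(\cos z-1)}$ for $s\le t$) with $V_j(0)=aj$, where $a\in\{2,3,\dots\}$. With the modified Bessel functions $I_n$ put $$\mathcal S[f(W)\mid(t,x)]=e^{t}\sum_{w\in\mathbb Z}I_{|w-x|}(-t)f(w),\qquad \hat\Phi^{ak}(z)=\frac{\sin(\pi(z/a-k))}{\pi(z/a-k)},\qquad \hat{\mathcal M}^{ak}(t,y)=\mathcal S[\hat\Phi^{ak}(W)\mid(t,y)],$$ and $\hat{\mathcal D}_J(t,x_J)=\det_{j,k\in J}[\hat{\mathcal M}^{ak}(t,x_j)]$ for finite $J\subset\mathbb Z$. Configurations are nonnegative integer-valued Radon measures on $\mathbb Z$, and the law of a process $(\Xi(t))_{t\ge0}$ of configurations is considered on the $\sigma$-algebra generated by all $\Xi(t)$. The noncolliding random walk $(\Xi(t),\mathbb P_{\xi_{a\mathbb Z}})$ started at $\xi_{a\mathbb Z}=\sum_{k\in\mathbb Z}\delta_{ak}$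 is defined by its determinantal martingale representation: for all $n$, all times $t_1,\dots,t_n\le T$ and all finitely supported $F:\mathbb Z^n\to\mathbb R$, $$\mathbb E_{\xi_{a\mathbb Z}}\Big[\int F(x_1,\dots,x_n)\,\Xi(t_1,dx_1)\cdots\Xi(t_n,dx_n)\Big]=\sum_{(j_1,\dots,j_n)\in\mathbb Z^n}\mathrm E\Big[F(V_{j_1}(t_1),\dots,V_{j_n}(t_n))\,\hat{\mathcal D}_{J}\big(T,V_J(T)\big)\Big],\quad J=\{j_1,\dots,j_n\},$$ where the integrand on the left is integrable and the series on the right converges unconditionally. A process is called determinantal with kernel $\mathbf K(s,x;t,y)$ if for all finite sets of times $t_m$ and finitely supported $f_{t_m}:\mathbb Z\to\mathbb R$, $$\mathbb E\Big[e^{\sum_m\int f_{t_m}d\Xi(t_m)}\Big]=\sum_{A}\ \prod_{(t,x)\in A}\big(e^{f_t(x)}-1\big)\ \det_{p,q\in A}[\mathbf K(p;q)],$$ the sum being over all finite sets $A$ of space-time points in the supports. Determinantal point processes on $\mathbb Z$ are defined in the same way. For $0<\rho<1$, $\mu^{\sin}_\rho$ is the determinantal point process on $\mathbb Z$ with kernel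 $\mathbf K^{\sin}_\rho(y-x)=\frac{\sin(\rho\pi(y-x))}{\pi(y-x)}$ (equal to $\rho$ if $x=y$). **Theorem.** Let $a\in\{2,3,\dots\}$ and $\rho=1/a$. 1. The process $(\Xi(t),\mathbb P_{\xi_{a\mathbb Z}})$ exists, is unique in law, and satisfies $\Xi(0)=\xi_{a\mathbb Z}$ almost surely. It is determinantal with the kernel $$\mathbb K_{\xi_{a\mathbb Z}}(s,x;t,y)=\sum_{j\in\mathbb Z}I_{|x-aj|}(s)\frac1{2\pi}\int_{-\pi}^{\pi}e^{i\lambda(y/a-j)-t\cos(\lambda/a)}\,d\lambda-\mathbf 1(s>t)\,I_{|x-y|}(s-t).$$ 2. There is a process $(\Xi(t),\mathbb P_\rho)$, unique in law, which is determinantal with kernel $\mathbf K_\rho(t-s,y-x)$, where $$\mathbf K_\rho(t-s,y-x)=\begin{cases}\int_0^\rho\cos(u\pi(y-x))\,e^{-(t-s)\cos u\pi}\,du,& s<t,\\[1mm] \frac{\sin(\rho\pi(y-x))}{\pi(y-x)},& s=t,\\[1mm] -\int_\rho^1\cos(u\pi(y-x))\,e^{-(t-s)\cos u\pi}\,du,&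 s>t.\end{cases}$$ The measure $\mu^{\sin}_\rho$ exists and is unique. 3. (Relaxation.) As $\tau\to\infty$, the process $(\Xi(t+\tau))_{t\ge0}$ under $\mathbb P_{\xi_{a\mathbb Z}}$ converges to $(\Xi(t))_{t\ge0}$ under $\mathbb P_\rho$ weakly in the sense of finite-dimensional distributions. For all $s,t\ge0$, $\mathbb K_{\xi_{a\mathbb Z}}(s+\tau,x;t+\tau,y)\to\mathbf K_\rho(t-s,y-x)$ uniformly in $(x,y)\in\mathbb Z^2$. 4. The process $(\Xi(t),\mathbb P_\rho)$ is stationary, has density $\rho$, i.e. $\mathbb E_\rho[\Xi(t,\{x\})]=\rho$ for all $t,x$, and is reversible with respect to $\mu^{\sin}_\rho$: each $\Xi(t)$ has law $\mu^{\sin}_\rho$, and for each $T\ge0$ the processes $(\Xi(t))_{0\le t\le T}$ and $(\Xi(T-t))_{0\le t\le T}$ have the same law. -/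

import Mathlib

open MeasureTheory ProbabilityTheory Filter Topology
open scoped NNReal BoundedContinuousFunction

noncomputable section

/-- Nonnegative integer-valued Radon measures on `ℤ`, given by their masses `ξ {x}`.  The product
topology (vague topology) and product σ-algebra are used. -/
abbrev Config : Type := ℤ → ℕ

/-- Configuration-valued paths `Ξ(t)`, `t ∈ [0, ∞)`; a process is a measure on this space
with the σ-algebra generated by all `Ξ(t)`. -/
abbrev ConfigPath : Type := ℝ≥0 → Config

/-- The configuration `∑_{k ∈ ℤ} δ_{a k}`. -/
def equidistantConfig (a : ℕ) : Config := fun x => if (a : ℤ) ∣ x then 1 else 0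

/-! ### Random walks -/

/-- Independent continuous-time simple symmetric random walks `V j`, `j ∈ ℤ`, with `V j 0 = u j`:
independent processes with independent increments, `V j t - V j s` being compound Poisson,
i.e. having characteristic function `exp ((t - s) (cos z - 1))`. (Only the joint laws of the walks
at finitely many times are used below, so no path regularity is imposed.) -/
structure IsIndepRandomWalks {Ω : Type*} [MeasurableSpace Ω] (Pr : Measure Ω)
    (V : ℤ → ℝ≥0 → Ω → ℤ) (u : ℤ → ℤ) : Prop where
  measurable : ∀ j t, Measurable (V j t)
  start : ∀ j, ∀ᵐ v ∂Pr, V j 0 v = u j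
  indep : iIndepFun (fun (j : ℤ) (v : Ω) (t : ℝ≥0) => V j t v) Pr
  indepIncrements : ∀ j, HasIndepIncrements (V j) Pr
  charFun : ∀ (j : ℤ) (s t : ℝ≥0), s ≤ t → ∀ z : ℝ,
    ∫ v, Complex.exp (Complex.I * (z * ((V j t v - V j s v : ℤ) : ℝ) : ℝ)) ∂Pr
      = (Real.exp (((t : ℝ) - s) * (Real.cos z - 1)) : ℂ)

/-! ### Bessel functions, the transformation `S`, and the martingale functions -/

/-- The modified Bessel function of the first kind `I_n(z)` of order `n = 0, 1, 2, …`. -/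
def besselI (n : ℕ) (z : ℝ) : ℝ :=
  (z / 2) ^ n * ∑' l : ℕ, (z / 2) ^ (2 * l) / ((l.factorial : ℝ) * ((n + l).factorial : ℝ))

/-- `S[f(W) | (t, x)] = e^t ∑_{w ∈ ℤ} I_{|w - x|}(-t) f(w)`. -/
def transformS (f : ℤ → ℝ) (t : ℝ) (x : ℤ) : ℝ :=
  Real.exp t * ∑' w : ℤ, besselI (w - x).natAbs (-t) * f w

/-- `Φ^{ak}(z) = sin (π (z/a - k)) / (π (z/a - k))`, the function `∏_{j ≠ k} (z - a j) / (a k - a j)`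
interpolating at the points of `aℤ`. -/
def interpPhi (a : ℕ) (k : ℤ) (z : ℝ) : ℝ := Real.sinc (Real.pi * (z / a - k))

/-- `M^{ak}(t, y) = S[Φ^{ak}(W) | (t, y)]`. -/
def martM (a : ℕ) (k : ℤ) (t : ℝ) (y : ℤ) : ℝ := transformS (fun w => interpPhi a k w) t y

open Classical in
/-- `D_J(t, x_J) = det_{j, k ∈ J} [M^{ak}(t, x_j)]` for a finite set `J` of labels. -/
def detMart (a : ℕ) (J : Finset ℤ) (t : ℝ) (x : ℤ → ℤ) : ℝ :=
  (Matrix.of fun j k : J => martM a k t (x j)).det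

/-! ### The noncolliding random walk with infinitely many particles -/

/-- `P` is the law of the noncolliding random walk started at `∑_k δ_{a k}`, i.e. it has the
determinantal martingale representation
`E[F(Ξ)] = E_{aℤ}[F(∑_j δ_{V_j}) D(T, V(T))]`
in terms of independent walks `V j` started at `a j`, for all functionals `F` depending on at most
`n` particles at times `t i ≤ T`.  Such a functional is
`F(Ξ) = ∫ F(x_1, …, x_n) Ξ(t_1, dx_1) ⋯ Ξ(t_n, dx_n)`;
for `Ξ = ∑_j δ_{V_j}` it is the sum over labels `j_1, …, j_n` of `F(V_{j_1}(t_1), …, V_{j_n}(t_n))`,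
and each term is weighted with the determinantal martingale of the walks which it involves. -/
structure IsNoncollidingRW {Ω : Type*} [MeasurableSpace Ω] (a : ℕ) (Pr : Measure Ω)
    (V : ℤ → ℝ≥0 → Ω → ℤ) (P : Measure ConfigPath) : Prop where
  isProbabilityMeasure : IsProbabilityMeasure P
  integrable : ∀ (n : ℕ) (t : Fin n → ℝ≥0) (F : (Fin n → ℤ) →₀ ℝ),
    Integrable (fun ω : ConfigPath => F.sum fun x c => c * ∏ i, (ω (t i) (x i) : ℝ)) P
  representation : ∀ (n : ℕ) (t : Fin n → ℝ≥0) (F : (Fin n → ℤ) →₀ ℝ) (T : ℝ≥0),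
    (∀ i, t i ≤ T) →
    HasSum
      (fun j : Fin n → ℤ =>
        ∫ v, F (fun i => V (j i) (t i) v)
          * detMart a (Finset.univ.image j) T (fun k => V k T v) ∂Pr)
      (∫ ω : ConfigPath, F.sum (fun x c => c * ∏ i, (ω (t i) (x i) : ℝ)) ∂P)

/-! ### Determinantal processes -/

open Classical in
/-- The Fredholm determinant `Det [δ_x(y) + K(x, y) χ(y)]` for `χ` supported in the finite set `S`:
the sum over all finite subsets `A` of `∏_{x ∈ A} χ(x) · det_{x, y ∈ A} [K(x, y)]`. -/
def fredholmDet {X : Type*} (K : X → X → ℝ) (χ : X → ℝ) (S : Finset X) : ℝ :=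
  ∑ A ∈ S.powerset, (∏ x ∈ A, χ x) * (Matrix.of fun x y : A => K x y).det

/-- `μ` is a determinantal point process on the discrete space `X` with correlation kernel `K`:
`E[exp ∫ f dξ] = Det [1 + K χ]` with `χ = e^f - 1`, for all finitely supported `f`. -/
structure IsDeterminantal {X : Type*} (μ : Measure (X → ℕ)) (K : X → X → ℝ) : Prop where
  isProbabilityMeasure : IsProbabilityMeasure μ
  integrable : ∀ f : X →₀ ℝ,
    Integrable (fun ξ : X → ℕ => Real.exp (f.sum fun x c => c * (ξ x : ℝ))) μ
  generatingFunction : ∀ f : X →₀ ℝ,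
    ∫ ξ : X → ℕ, Real.exp (f.sum fun x c => c * (ξ x : ℝ)) ∂μ
      = fredholmDet K (fun x => Real.exp (f x) - 1) f.support

/-- The process with law `P` is determinantal with spatio-temporal correlation kernel `K`: the same
for the moment generating functions of all multitime distributions,
`E[exp ∑_m ∫ f_{t_m}(x) Ξ(t_m, dx)] = Det [δ_{st} δ_x(y) + K(s, x; t, y) χ_t(y)]`.
The family `(f_{t_m})_m` is encoded as a finitely supported function on `[0, ∞) × ℤ`. -/
structure IsDeterminantalProcess (P : Measure ConfigPath) (K : ℝ≥0 × ℤ → ℝ≥0 × ℤ → ℝ) : Prop where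
  isProbabilityMeasure : IsProbabilityMeasure P
  integrable : ∀ f : ℝ≥0 × ℤ →₀ ℝ,
    Integrable (fun ω : ConfigPath => Real.exp (f.sum fun p c => c * (ω p.1 p.2 : ℝ))) P
  generatingFunction : ∀ f : ℝ≥0 × ℤ →₀ ℝ,
    ∫ ω : ConfigPath, Real.exp (f.sum fun p c => c * (ω p.1 p.2 : ℝ)) ∂P
      = fredholmDet K (fun p => Real.exp (f p) - 1) f.support

/-! ### Kernels -/

/-- The correlation kernel of the noncolliding random walk started at `∑_k δ_{a k}`:
`∑_j I_{|x - aj|}(s) (2π)⁻¹ ∫_{-π}^{π} e^{iλ(y/a - j) - t cos(λ/a)} dλ - 1(s > t) I_{|x-y|}(s - t)`.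
The imaginary part of the integral vanishes by symmetry. -/
def equidistantKernel (a : ℕ) (p q : ℝ≥0 × ℤ) : ℝ :=
  (∑' j : ℤ, besselI (p.2 - a * j).natAbs p.1 *
    (1 / (2 * Real.pi) * ∫ l in (-Real.pi)..Real.pi,
      Real.cos (l * ((q.2 : ℝ) / a - j)) * Real.exp (-(q.1 : ℝ) * Real.cos (l / a))))
  - if q.1 < p.1 then besselI (p.2 - q.2).natAbs ((p.1 : ℝ) - q.1) else 0

/-- The discrete sine kernel `sin (ρ π n) / (π n)`, with its limit value `ρ` at `n = 0`. -/
def sineKernel (ρ : ℝ) (n : ℤ) : ℝ :=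
  if n = 0 then ρ else Real.sin (ρ * Real.pi * n) / (Real.pi * n)

/-- The extended sine kernel `K_ρ(τ, n)`, where `τ = t - s` and `n = y - x`. -/
def extSineKernel (ρ : ℝ) (τ : ℝ) (n : ℤ) : ℝ :=
  if 0 < τ then
    ∫ u in (0 : ℝ)..ρ, Real.cos (u * Real.pi * n) * Real.exp (-τ * Real.cos (u * Real.pi))
  else if τ = 0 then sineKernel ρ n
  else -∫ u in ρ..1, Real.cos (u * Real.pi * n) * Real.exp (-τ * Real.cos (u * Real.pi))

/-! ### Relaxation, stationarity, reversibility -/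

/-- Relaxation: the time-shifted process `Ξ(· + τ)` under `P` converges, as `τ → ∞`, to the process
`Ξ` under `Q` weakly in the sense of finite-dimensional distributions. -/
def RelaxesTo (P Q : Measure ConfigPath) : Prop :=
  ∀ (m : ℕ) (t : Fin m → ℝ≥0) (F : (Fin m → Config) →ᵇ ℝ),
    Tendsto (fun τ : ℝ≥0 => ∫ ω, F (fun i => ω (t i + τ)) ∂P) atTop
      (𝓝 (∫ ω, F (fun i => ω (t i)) ∂Q))

/-- The law of the process is invariant under time shifts. -/
def IsStationaryProcess (Q : Measure ConfigPath) : Prop :=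
  ∀ τ : ℝ≥0, Q.map (fun ω t => ω (t + τ)) = Q

/-- Reversibility with respect to `μ`: every `Ξ(t)` has law `μ`, and for every `T` the
processes `(Ξ(t))_{0 ≤ t ≤ T}` and `(Ξ(T - t))_{0 ≤ t ≤ T}` have the same law. -/
def IsReversibleWith (Q : Measure ConfigPath) (μ : Measure Config) : Prop :=
  (∀ t : ℝ≥0, Q.map (fun ω => ω t) = μ) ∧
  ∀ T : ℝ≥0, Q.map (fun ω (t : Set.Iic T) => ω (T - t)) = Q.map (fun ω (t : Set.Iic T) => ω t)

end

/-! Everything is reduced to correlation functions. If the occupation numbers are 0 or 1, then the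
numbers c(A) = P(all points of A occupied) determine the law, and a law with given c exists as soon
as all inclusion-exclusion weights `occupationWeight c S A` are nonnegative. This is Kolmogorov
extension, and on {0,1}^X compactness of cylinders replaces any topological hypothesis
(`exists_hasCorrelations`, `HasCorrelations.measure_eq`). Being determinantal in the sense of
generating functions is the same as having the principal minors of the kernel as correlation
functions (`isDeterminantal_iff`, `isDeterminantalProcess_iff`). So existence of a process is a
positivity statement about a kernel, uniqueness is automatic, and positivity and convergence in law
follow from entrywise convergence of kernels.

The algebraic core is `IsIndepRandomWalks.generatingFunction_det`. For finitely many independent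
walks weighted by a determinant of one-walk functions, independence turns the expectation into a
determinant of one-walk expectations. The Markov property gives a renewal equation for those, and
solving it inside the determinant produces det(1 + χK) with an explicit kernel K, `walkKernel`.

Positivity comes from 2m+1 walks on the discrete circle with a(2m+1) points. There the determinant
of the martingale functions is a positive multiple of ∏ sin(π(x_j - x_i)/L), normalised by its value
at the start (`det_circleM_mul`). Unit jumps cannot change the sign of this product without hitting
a zero, and up to a positive scalar the semigroup is a power series with nonnegative coefficients in
the sum over unit jumps (`hasSum_hop_iterate`). Hence antisymmetric functions with the sign of the
product form an invariant cone, and every event has nonnegative weight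
(`IsIndepRandomWalks.integral_prod_mul_nonneg`). As m → ∞ the circle kernels converge to a
transposed and gauge-transformed `equidistantKernel`, so its weights are nonnegative too and P
exists.

The determinantal martingale representation is the same computation on ℤ with labels in [-m, m].
Labels outside J integrate to identity rows, because E[M^k(T, V_j(T))] = M^k(0, aj) = δ_jk; uniform
bounds give unconditional convergence in the labels (`IsIndepRandomWalks.hasSum_integral_visitInd`).
Conversely, the representation yields equal first and second moments of each occupation number,
hence values in {0,1}, and then the correlation functions.

For relaxation, a roots-of-unity filter splits the kernel into a Fourier modes
(`equidistantKernel_eq_sum`). Mode 0 together with the subtracted Bessel term is exactly the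
extended sine kernel and depends on times only through t - s. The other modes carry a factor
exp(τ(cos((l + 2πr)/a) - cos(l/a))) with negative exponent and vanish uniformly in space. The limit
kernel inherits nonnegative weights, which gives Q. Stationarity is read off from its dependence on
differences, and reversibility from evenness in space and invariance of minors under transposition.
-/

/-! ### Point processes with prescribed correlation functions -/

section Correlations

/-- The occupation numbers `n p` take values in `{0, 1}` almost surely, and
`c A` is the probability that all points of `A` are occupied. -/
structure HasCorrelations {Ω X : Type*} [MeasurableSpace Ω] (μ : Measure Ω) (n : X → Ω → ℕ)
    (c : Finset X → ℝ) : Prop where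
  isProbabilityMeasure : IsProbabilityMeasure μ
  measurable : ∀ p, Measurable (n p)
  le_one : ∀ p, ∀ᵐ ω ∂μ, n p ω ≤ 1
  integral_prod : ∀ A : Finset X, ∫ ω, ∏ p ∈ A, (n p ω : ℝ) ∂μ = c A

open Classical in
/-- The probability that exactly the points of `A` among those of `S` are occupied, by
inclusion-exclusion from the correlation functions. -/
noncomputable def occupationWeight {X : Type*} (c : Finset X → ℝ) (S A : Finset X) : ℝ :=
  ∑ D ∈ (S \ A).powerset, (-1) ^ D.card * c (A ∪ D)

open Classical in
/-- The configuration with one particle at each point of `A`. -/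
noncomputable def finsetConfig {X : Type*} (A : Finset X) : X → ℕ := fun p => if p ∈ A then 1 else 0

open Classical in
/-- The restriction of a configuration to a finite set. -/
noncomputable def truncConfig {X : Type*} (S : Finset X) (ω : X → ℕ) : X → ℕ :=
  fun p => if p ∈ S then ω p else 0

variable {Ω X : Type*} [MeasurableSpace Ω]

theorem HasCorrelations.ae_le_one {μ : Measure Ω} {n : X → Ω → ℕ} {c : Finset X → ℝ}
    (h : HasCorrelations μ n c) (S : Finset X) : ∀ᵐ ω ∂μ, ∀ p ∈ S, n p ω ≤ 1 :=
  (Finset.eventually_all S).2 fun p _ => h.le_one p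

theorem HasCorrelations.integrable_of_bound {μ : Measure Ω} {n : X → Ω → ℕ} {c : Finset X → ℝ}
    (h : HasCorrelations μ n c) (S : Finset X) {g : Ω → ℝ} (hg : Measurable g) (C : ℝ)
    (hC : ∀ ω, (∀ p ∈ S, n p ω ≤ 1) → |g ω| ≤ C) : Integrable g μ := by
  have := h.isProbabilityMeasure
  refine Integrable.of_bound hg.aestronglyMeasurable C ?_
  filter_upwards [h.ae_le_one S] with ω hω
  simpa using hC ω hω

theorem HasCorrelations.integrable_prod {μ : Measure Ω} {n : X → Ω → ℕ} {c : Finset X → ℝ}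
    (h : HasCorrelations μ n c) (A : Finset X) :
    Integrable (fun ω => ∏ p ∈ A, (n p ω : ℝ)) μ := by
  refine h.integrable_of_bound A ?_ 1 fun ω hω => ?_
  · exact Finset.measurable_fun_prod _ fun p _ => (measurable_from_top.comp (h.measurable p))
  · rw [Finset.abs_prod]
    exact Finset.prod_le_one (fun _ _ => abs_nonneg _) fun p hp => by
      simpa using hω p hp

theorem prod_mul_prod_one_sub [DecidableEq X] (x : X → ℝ) (S A : Finset X) :
    (∏ p ∈ A, x p) * ∏ p ∈ S \ A, (1 - x p)
      = ∑ D ∈ (S \ A).powerset, (-1) ^ D.card * ∏ p ∈ A ∪ D, x p := by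
  have h1 : ∏ p ∈ S \ A, (1 - x p) = ∑ D ∈ (S \ A).powerset, (-1) ^ D.card * ∏ p ∈ D, x p := by
    simp_rw [sub_eq_add_neg]
    rw [Finset.prod_one_add]
    refine Finset.sum_congr rfl fun D _ => ?_
    rw [Finset.prod_neg]
  rw [h1, Finset.mul_sum]
  refine Finset.sum_congr rfl fun D hD => ?_
  have hd : Disjoint A D := by
    rw [Finset.mem_powerset] at hD
    exact Finset.disjoint_of_subset_right hD Finset.disjoint_sdiff
  rw [Finset.prod_union hd]; ring

theorem HasCorrelations.integral_occupation [DecidableEq X] {μ : Measure Ω} {n : X → Ω → ℕ}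
    {c : Finset X → ℝ} (h : HasCorrelations μ n c) (S A : Finset X) :
    Integrable (fun ω => (∏ p ∈ A, (n p ω : ℝ)) * ∏ p ∈ S \ A, (1 - (n p ω : ℝ))) μ ∧
    ∫ ω, (∏ p ∈ A, (n p ω : ℝ)) * ∏ p ∈ S \ A, (1 - (n p ω : ℝ)) ∂μ = occupationWeight c S A := by
  simp_rw [prod_mul_prod_one_sub _ S A]
  constructor
  · exact integrable_finsetSum _ fun D _ => (h.integrable_prod _).const_mul _
  rw [integral_finsetSum _ fun D _ => (h.integrable_prod _).const_mul _]
  unfold occupationWeight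
  simp_rw [integral_const_mul, h.integral_prod]
  congr!

theorem HasCorrelations.occupationWeight_nonneg {μ : Measure Ω} {n : X → Ω → ℕ}
    {c : Finset X → ℝ} (h : HasCorrelations μ n c) (S A : Finset X) :
    0 ≤ occupationWeight c S A := by
  classical
  rw [← (h.integral_occupation S A).2]
  refine integral_nonneg_of_ae ?_
  filter_upwards [h.ae_le_one S] with ω hω
  refine mul_nonneg (Finset.prod_nonneg fun _ _ => by positivity) (Finset.prod_nonneg fun p hp => ?_)
  have := hω p (Finset.mem_sdiff.1 hp).1
  simpa using this

theorem apply_truncConfig_eq_sum [DecidableEq X] (S : Finset X) (g : (X → ℕ) → ℝ) (ω : X → ℕ)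
    (hω : ∀ p ∈ S, ω p ≤ 1) :
    g (truncConfig S ω) = ∑ A ∈ S.powerset,
      ((∏ p ∈ A, (ω p : ℝ)) * ∏ p ∈ S \ A, (1 - (ω p : ℝ))) * g (finsetConfig A) := by
  have h01 : ∀ p ∈ S, ω p = 0 ∨ ω p = 1 := fun p hp => by have := hω p hp; omega
  -- The only indicator product that does not vanish belongs to the set of points of S occupied in
  -- `ω`.
  rw [Finset.sum_eq_single (S.filter fun p => ω p = 1)]
  · have h1 : ∏ p ∈ S.filter (fun p => ω p = 1), (ω p : ℝ) = 1 :=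
      Finset.prod_eq_one fun p hp => by simp [(Finset.mem_filter.1 hp).2]
    have h2 : ∏ p ∈ S \ S.filter (fun p => ω p = 1), (1 - (ω p : ℝ)) = 1 := by
      refine Finset.prod_eq_one fun p hp => ?_
      simp only [Finset.mem_sdiff, Finset.mem_filter, not_and] at hp
      rcases h01 p hp.1 with h | h
      · simp [h]
      · exact absurd h (hp.2 hp.1)
    rw [h1, h2, one_mul, one_mul]
    congr 1
    funext p
    simp only [truncConfig, finsetConfig, Finset.mem_filter]
    by_cases hp : p ∈ S
    · rcases h01 p hp with h | h <;> simp [hp, h]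
    · simp [hp]
  · intro A hA hne
    rw [Finset.mem_powerset] at hA
    have : ∃ p ∈ S, ¬ (p ∈ A ↔ ω p = 1) := by
      by_contra! hcon
      refine hne ?_
      ext p
      rw [Finset.mem_filter]
      exact ⟨fun hp => ⟨hA hp, (hcon p (hA hp)).1 hp⟩, fun hp => (hcon p hp.1).2 hp.2⟩
    obtain ⟨p, hpS, hp⟩ := this
    by_cases hpA : p ∈ A
    · have : ω p = 0 := by
        rcases h01 p hpS with h | h
        · exact h
        · exact absurd (iff_of_true hpA h) hp
      rw [Finset.prod_eq_zero hpA (by simp [this])]; simp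
    · have : ω p = 1 := by
        rcases h01 p hpS with h | h
        · exact absurd (iff_of_false hpA (by simp [h])) hp
        · exact h
      rw [Finset.prod_eq_zero (s := S \ A) (Finset.mem_sdiff.2 ⟨hpS, hpA⟩) (by simp [this])]; simp
  · intro hmem
    exact absurd (Finset.mem_powerset.2 (Finset.filter_subset _ _)) hmem

theorem HasCorrelations.integral_truncConfig {μ : Measure Ω} {n : X → Ω → ℕ}
    {c : Finset X → ℝ} (h : HasCorrelations μ n c) (S : Finset X) (g : (X → ℕ) → ℝ) :
    Integrable (fun ω => g (truncConfig S fun p => n p ω)) μ ∧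
    ∫ ω, g (truncConfig S fun p => n p ω) ∂μ
      = ∑ A ∈ S.powerset, occupationWeight c S A * g (finsetConfig A) := by
  classical
  have hae : (fun ω => g (truncConfig S fun p => n p ω)) =ᵐ[μ] fun ω => ∑ A ∈ S.powerset,
      ((∏ p ∈ A, (n p ω : ℝ)) * ∏ p ∈ S \ A, (1 - (n p ω : ℝ))) * g (finsetConfig A) := by
    filter_upwards [h.ae_le_one S] with ω hω
    exact apply_truncConfig_eq_sum S g (fun p => n p ω) hω
  have hint : ∀ A ∈ S.powerset, Integrable (fun ω => ((∏ p ∈ A, (n p ω : ℝ)) *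
      ∏ p ∈ S \ A, (1 - (n p ω : ℝ))) * g (finsetConfig A)) μ := fun A _ =>
    (h.integral_occupation S A).1.mul_const _
  refine ⟨(integrable_congr hae).2 (integrable_finsetSum _ hint), ?_⟩
  rw [integral_congr_ae hae, integral_finsetSum _ hint]
  refine Finset.sum_congr rfl fun A _ => ?_
  rw [integral_mul_const, (h.integral_occupation S A).2]

/-- Correlation functions determine the law of a point process. -/
theorem HasCorrelations.measure_eq {μ ν : Measure (X → ℕ)} {c : Finset X → ℝ}
    (hμ : HasCorrelations μ (fun p ω => ω p) c) (hν : HasCorrelations ν (fun p ω => ω p) c) :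
    μ = ν := by
  classical
  have := hμ.isProbabilityMeasure
  have := hν.isProbabilityMeasure
  refine ext_of_generate_finite (measurableCylinders fun _ : X => ℕ)
    generateFrom_measurableCylinders.symm isPiSystem_measurableCylinders (fun s hs => ?_) (by simp)
  obtain ⟨S, B, hB, rfl⟩ := (mem_measurableCylinders _).mp hs
  have hm : MeasurableSet (cylinder S B : Set (X → ℕ)) := MeasurableSet.cylinder S hB
  -- A cylinder over `S` sees only the truncation to `S`, so its probability is a finite combination
  -- of occupation weights; cylinders form a generating π-system.
  have key : ∀ ω : X → ℕ, (cylinder S B : Set (X → ℕ)).indicator (fun _ => (1 : ℝ)) (truncConfig S ω)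
      = (cylinder S B : Set (X → ℕ)).indicator (fun _ => (1 : ℝ)) ω := fun ω => by
    have : S.restrict (truncConfig S ω) = S.restrict ω := by
      funext p; simp [truncConfig]
    simp only [Set.indicator, mem_cylinder, this]
  have e : ∀ ρ : Measure (X → ℕ), HasCorrelations ρ (fun p ω => ω p) c →
      ρ.real (cylinder S B : Set (X → ℕ)) = ∑ A ∈ S.powerset, occupationWeight c S A *
        (cylinder S B : Set (X → ℕ)).indicator (fun _ => (1 : ℝ)) (finsetConfig A) := by
    intro ρ hρ
    rw [← (hρ.integral_truncConfig S _).2]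
    simp_rw [key]
    rw [integral_indicator_const _ hm]; simp
  have := (e μ hμ).trans (e ν hν).symm
  rwa [measureReal_def, measureReal_def, ENNReal.toReal_eq_toReal_iff' (by simp) (by simp)] at this

theorem HasCorrelations.map {Ω' : Type*} [MeasurableSpace Ω'] {μ : Measure Ω} {n : X → Ω' → ℕ}
    {c : Finset X → ℝ} {φ : Ω → Ω'} (hφ : Measurable φ) (hn : ∀ p, Measurable (n p)) :
    HasCorrelations (μ.map φ) n c ↔ HasCorrelations μ (fun p ω => n p (φ ω)) c := by
  have hi : ∀ A : Finset X, ∫ ω, ∏ p ∈ A, (n p ω : ℝ) ∂(μ.map φ)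
      = ∫ ω, ∏ p ∈ A, (n p (φ ω) : ℝ) ∂μ := fun A =>
    integral_map hφ.aemeasurable (Finset.measurable_fun_prod _ fun p _ =>
      (measurable_from_top.comp (hn p))).aestronglyMeasurable
  have hl : ∀ p, (∀ᵐ ω ∂(μ.map φ), n p ω ≤ 1) ↔ ∀ᵐ ω ∂μ, n p (φ ω) ≤ 1 := fun p =>
    ae_map_iff hφ.aemeasurable ((hn p) measurableSet_Iic)
  constructor
  · intro h
    refine ⟨?_, fun p => (hn p).comp hφ, fun p => (hl p).1 (h.le_one p), fun A => ?_⟩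
    · have := h.isProbabilityMeasure
      exact Measure.isProbabilityMeasure_of_map φ
    · rw [← hi, h.integral_prod]
  · intro h
    refine ⟨?_, hn, fun p => (hl p).2 (h.le_one p), fun A => ?_⟩
    · have := h.isProbabilityMeasure
      exact Measure.isProbabilityMeasure_map hφ.aemeasurable
    · rw [hi, h.integral_prod]

/-- Uniqueness in law of configuration-valued processes with given correlations. -/
theorem HasCorrelations.process_eq {S T : Type*} {μ ν : Measure (S → T → ℕ)}
    {c : Finset (S × T) → ℝ}
    (hμ : HasCorrelations μ (fun p ω => ω p.1 p.2) c)
    (hν : HasCorrelations ν (fun p ω => ω p.1 p.2) c) : μ = ν := by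
  have hu : Measurable (Function.uncurry : (S → T → ℕ) → S × T → ℕ) := measurable_uncurry
  have hc : Measurable (Function.curry : (S × T → ℕ) → S → T → ℕ) := measurable_curry
  have h : μ.map Function.uncurry = ν.map Function.uncurry :=
    HasCorrelations.measure_eq
      ((HasCorrelations.map hu fun p => measurable_pi_apply p).2 hμ)
      ((HasCorrelations.map hu fun p => measurable_pi_apply p).2 hν)
  have h2 := congrArg (Measure.map Function.curry) h
  rw [Measure.map_map hc hu, Measure.map_map hc hu] at h2
  simpa [Function.curry_uncurry, Function.comp_def] using h2

end Correlations

/-! ### Existence from nonnegative occupation weights -/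

section Existence

variable {X : Type*}

/-- Forgetting the state of `p`: in the alternating sum for "`p` empty", the terms with `p ∈ D`
cancel the whole sum for "`p` occupied". This is the one-point case of the consistency of the
finite-dimensional laws. -/
theorem occupationWeight_insert [DecidableEq X] (c : Finset X → ℝ) {S A : Finset X} {p : X}
    (hp : p ∉ S) (hA : A ⊆ S) :
    occupationWeight c (insert p S) A + occupationWeight c (insert p S) (insert p A)
      = occupationWeight c S A := by
  have hpA : p ∉ A := fun h => hp (hA h)
  have e1 : insert p S \ A = insert p (S \ A) := Finset.insert_sdiff_of_notMem _ hpA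
  have e2 : insert p S \ insert p A = S \ A := by
    rw [Finset.insert_sdiff_insert, Finset.sdiff_insert_of_notMem hp]
  have hp' : p ∉ S \ A := fun h => hp (Finset.mem_sdiff.1 h).1
  have key : ∀ S' A' : Finset X, occupationWeight c S' A'
      = ∑ D ∈ (S' \ A').powerset, (-1) ^ D.card * c (A' ∪ D) := fun S' A' => by
    unfold occupationWeight; congr!
  rw [key, key, key, e1, e2, Finset.sum_powerset_insert hp', add_assoc, ← Finset.sum_add_distrib]
  refine add_eq_left.2 (Finset.sum_eq_zero fun D hD => ?_)
  have hpD : p ∉ D := fun h => hp' (Finset.mem_powerset.1 hD h)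
  rw [Finset.card_insert_of_notMem hpD, Finset.union_insert, Finset.insert_union]
  ring

theorem sum_ofReal_occupationWeight [DecidableEq X] (c : Finset X → ℝ)
    (hc : ∀ S A : Finset X, A ⊆ S → 0 ≤ occupationWeight c S A) (S E : Finset X)
    (hSE : Disjoint S E) (g : Finset X → ENNReal) :
    ∑ A ∈ (S ∪ E).powerset, ENNReal.ofReal (occupationWeight c (S ∪ E) A) * g (A ∩ S)
      = ∑ A ∈ S.powerset, ENNReal.ofReal (occupationWeight c S A) * g A := by
  induction E using Finset.induction_on with
  | empty =>
    rw [Finset.union_empty]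
    refine Finset.sum_congr rfl fun A hA => ?_
    rw [Finset.inter_eq_left.2 (Finset.mem_powerset.1 hA)]
  | insert p E hp ih =>
    rw [Finset.disjoint_insert_right] at hSE
    have hpSE : p ∉ S ∪ E := by simp [hp, hSE.1]
    rw [Finset.union_insert, Finset.sum_powerset_insert hpSE, ← Finset.sum_add_distrib,
      ← ih hSE.2]
    refine Finset.sum_congr rfl fun A hA => ?_
    rw [Finset.mem_powerset] at hA
    rw [Finset.insert_inter_of_notMem hSE.1, ← add_mul, ← ENNReal.ofReal_add,
      occupationWeight_insert c hpSE hA]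
    · exact hc _ _ (hA.trans (Finset.subset_insert _ _))
    · exact hc _ _ (Finset.insert_subset_insert _ hA)

open Classical in
/-- The law of the occupied points of `S`. -/
noncomputable def occupationLaw (c : Finset X → ℝ) (S : Finset X) : Measure (S → Bool) :=
  ∑ A ∈ S.powerset, ENNReal.ofReal (occupationWeight c S A) •
    Measure.dirac fun p : S => decide (p.1 ∈ A)

theorem occupationLaw_apply [DecidableEq X] (c : Finset X → ℝ) (S : Finset X) (B : Set (S → Bool))
    (hB : MeasurableSet B) :
    occupationLaw c S B = ∑ A ∈ S.powerset, ENNReal.ofReal (occupationWeight c S A) *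
      B.indicator (fun _ => 1) (fun p : S => decide (p.1 ∈ A)) := by
  unfold occupationLaw
  rw [Measure.finsetSum_apply]
  refine Finset.sum_congr rfl fun A _ => ?_
  rw [Measure.smul_apply, Measure.dirac_apply' _ hB, smul_eq_mul]
  congr!

theorem isProjectiveMeasureFamily_occupationLaw (c : Finset X → ℝ)
    (hc : ∀ S A : Finset X, A ⊆ S → 0 ≤ occupationWeight c S A) :
    IsProjectiveMeasureFamily (α := fun _ : X => Bool) (occupationLaw c) := by
  classical
  intro I J hJI
  ext B hB
  have hm : Measurable (Finset.restrict₂ (π := fun _ : X => Bool) hJI) :=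
    Finset.measurable_restrict₂ hJI
  rw [Measure.map_apply hm hB, occupationLaw_apply _ _ _ hB, occupationLaw_apply _ _ _ (hm hB)]
  obtain ⟨E, hd, rfl⟩ : ∃ E, Disjoint J E ∧ I = J ∪ E :=
    ⟨I \ J, Finset.disjoint_sdiff, (Finset.union_sdiff_of_subset hJI).symm⟩
  rw [← sum_ofReal_occupationWeight c hc J E hd]
  refine Finset.sum_congr rfl fun A _ => ?_
  congr 1
  have : (fun p : J => decide (p.1 ∈ A ∩ J)) = Finset.restrict₂ (π := fun _ : X => Bool) hJI
      (fun p : ↥(J ∪ E) => decide (p.1 ∈ A)) := by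
    funext p
    simp [Finset.restrict₂]
  rw [this]
  rfl

theorem isProbabilityMeasure_occupationLaw (c : Finset X → ℝ) (h1 : c ∅ = 1)
    (hc : ∀ S A : Finset X, A ⊆ S → 0 ≤ occupationWeight c S A) (S : Finset X) :
    IsProbabilityMeasure (occupationLaw c S) := by
  classical
  constructor
  rw [occupationLaw_apply _ _ _ MeasurableSet.univ]
  have := sum_ofReal_occupationWeight c hc ∅ S (Finset.disjoint_empty_left _) (fun _ => 1)
  simp only [Finset.empty_union, mul_one] at this
  simp only [Set.indicator_univ, mul_one, this]
  simp [occupationWeight, h1]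

/-- Cylinders in {0,1}^X are closed in a compact space, so a decreasing sequence of them with empty
intersection is eventually empty. The additive content is therefore continuous at the empty set and
extends to a measure, for index sets of any cardinality; space-time is uncountable. -/
theorem exists_isProjectiveLimit_bool (P : ∀ J : Finset X, Measure (J → Bool))
    [∀ J, IsProbabilityMeasure (P J)]
    (hP : IsProjectiveMeasureFamily (α := fun _ : X => Bool) P) :
    ∃ μ : Measure (X → Bool), IsProjectiveLimit (α := fun _ : X => Bool) μ P := by
  classical
  set m := projectiveFamilyContent hP
  have hclosed : ∀ s ∈ measurableCylinders (fun _ : X => Bool), IsClosed s := by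
    intro s hs
    obtain ⟨S, B, hB, rfl⟩ := (mem_measurableCylinders _).mp hs
    exact (isClosed_discrete B).preimage (by fun_prop)
  have hsub : m.IsSigmaSubadditive := by
    refine isSigmaSubadditive_of_addContent_iUnion_eq_tsum
      isSetRing_measurableCylinders fun f hf hf_Union hf' => ?_
    refine addContent_iUnion_eq_sum_of_tendsto_zero isSetRing_measurableCylinders
      m (fun s hs => projectiveFamilyContent_ne_top _) ?_ hf hf_Union hf'
    intro s hs hanti hinter
    have : ∃ k, s k = ∅ := by
      by_contra! hne
      have := IsCompact.nonempty_iInter_of_sequence_nonempty_isCompact_isClosed s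
        (fun i => hanti (Nat.le_succ i)) hne (hclosed _ (hs 0)).isCompact
        (fun i => hclosed _ (hs i))
      rw [hinter] at this
      exact Set.not_nonempty_empty this
    obtain ⟨k, hk⟩ := this
    refine tendsto_const_nhds.congr' ?_
    filter_upwards [eventually_ge_atTop k] with l hl
    have : s l = ∅ := Set.subset_eq_empty (hanti hl) hk
    rw [this, addContent_empty]
  refine ⟨m.measure isSetSemiring_measurableCylinders generateFrom_measurableCylinders.ge hsub, ?_⟩
  intro I
  ext s hs
  rw [Measure.map_apply (Finset.measurable_restrict I) hs, AddContent.measure_eq, ← cylinder,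
    projectiveFamilyContent_cylinder hP hs]
  · exact generateFrom_measurableCylinders.symm
  · exact cylinder_mem_measurableCylinders _ _ hs

/-- A point process with given correlation functions exists if all the weights computed from them
are nonnegative. -/
theorem exists_hasCorrelations (c : Finset X → ℝ) (h1 : c ∅ = 1)
    (hc : ∀ S A : Finset X, A ⊆ S → 0 ≤ occupationWeight c S A) :
    ∃ μ : Measure (X → ℕ), HasCorrelations μ (fun p ω => ω p) c := by
  classical
  have hprob := isProbabilityMeasure_occupationLaw c h1 hc
  obtain ⟨μ, hμ⟩ := exists_isProjectiveLimit_bool _ (isProjectiveMeasureFamily_occupationLaw c hc)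
  have hμp : IsProbabilityMeasure μ := hμ.isProbabilityMeasure
  let φ : (X → Bool) → X → ℕ := fun ω p => if ω p then 1 else 0
  have hφ : Measurable φ := measurable_pi_lambda _ fun p =>
    (measurable_from_top (f := fun b : Bool => if b then (1 : ℕ) else 0)).comp (measurable_pi_apply p)
  refine ⟨μ.map φ, (HasCorrelations.map hφ fun p => measurable_pi_apply p).2 ?_⟩
  refine ⟨hμp, fun p => (measurable_pi_apply p).comp hφ, fun p => ?_, fun A => ?_⟩
  · exact Eventually.of_forall fun ω => by simp only [φ]; split_ifs <;> simp
  have hB : MeasurableSet ({fun _ => true} : Set (A → Bool)) := MeasurableSet.of_discrete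
  have e : ∀ ω : X → Bool, ∏ p ∈ A, ((φ ω p : ℕ) : ℝ)
      = (cylinder A {fun _ => true} : Set (X → Bool)).indicator (fun _ => (1 : ℝ)) ω := by
    intro ω
    by_cases h : ∀ p ∈ A, ω p = true
    · rw [Set.indicator_of_mem, Finset.prod_eq_one]
      · intro p hp; simp [φ, h p hp]
      · simp only [mem_cylinder, Set.mem_singleton_iff]
        funext p; exact h p p.2
    · rw [Set.indicator_of_notMem]
      · push Not at h
        obtain ⟨p, hp, hpω⟩ := h
        exact Finset.prod_eq_zero hp (by simp [φ, hpω])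
      · simp only [mem_cylinder, Set.mem_singleton_iff]
        intro h'; exact h fun p hp => congrFun h' ⟨p, hp⟩
  simp_rw [e]
  rw [integral_indicator_const _ (MeasurableSet.cylinder A hB), smul_eq_mul, mul_one,
    measureReal_def, hμ.measure_cylinder A hB, occupationLaw_apply _ _ _ hB,
    -- Among the subsets of `A`, only `A` itself has all points of `A` occupied, and its weight
    -- within `A` is `c A`.
    Finset.sum_eq_single A]
  · simp only [Finset.coe_mem, decide_true, Set.indicator_of_mem, Set.mem_singleton_iff, mul_one]
    rw [ENNReal.toReal_ofReal (hc A A subset_rfl)]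
    simp [occupationWeight]
  · intro A' hA' hne
    rw [Set.indicator_of_notMem, mul_zero]
    intro h
    refine hne (Finset.Subset.antisymm (Finset.mem_powerset.1 hA') fun p hp => ?_)
    simpa using congrFun h ⟨p, hp⟩
  · intro h; exact absurd (Finset.mem_powerset_self A) h

end Existence

/-! ### Determinantal processes and their correlation functions -/

section Determinantal

open Classical in
/-- The correlation function `det_{x, y ∈ A} [K(x, y)]`. -/
noncomputable def principalMinor {X : Type*} (K : X → X → ℝ) (A : Finset X) : ℝ :=
  (Matrix.of fun x y : A => K x y).det

theorem fredholmDet_eq {X : Type*} (K : X → X → ℝ) (χ : X → ℝ) (S : Finset X) :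
    fredholmDet K χ S = ∑ A ∈ S.powerset, (∏ x ∈ A, χ x) * principalMinor K A := rfl

theorem principalMinor_empty {X : Type*} (K : X → X → ℝ) : principalMinor K ∅ = 1 := by
  simp [principalMinor]

theorem principalMinor_singleton {X : Type*} (K : X → X → ℝ) (p : X) :
    principalMinor K {p} = K p p := by
  unfold principalMinor
  convert Matrix.det_eq_elem_of_card_eq_one (A := Matrix.of fun x y : ({p} : Finset X) => K x y)
    (by simp) ⟨p, Finset.mem_singleton_self p⟩
  rfl

theorem principalMinor_swap {X : Type*} (K : X → X → ℝ) (A : Finset X) :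
    principalMinor (fun p q => K q p) A = principalMinor K A := by
  classical
  unfold principalMinor
  rw [← Matrix.det_transpose]; rfl

/-- Gauge transformations of the kernel do not change the correlation functions. -/
theorem principalMinor_gauge {X : Type*} (K : X → X → ℝ) (g : X → ℝ) (hg : ∀ x, g x ≠ 0)
    (A : Finset X) : principalMinor (fun p q => g p * K p q * (g q)⁻¹) A = principalMinor K A := by
  classical
  unfold principalMinor
  have : (Matrix.of fun x y : A => g x * K x y * (g y)⁻¹)
      = Matrix.diagonal (fun x : A => g x) * (Matrix.of fun x y : A => K x y) *
        Matrix.diagonal (fun x : A => (g x)⁻¹) := by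
    ext x y; simp [Matrix.diagonal_mul, Matrix.mul_diagonal]
  rw [this, Matrix.det_mul, Matrix.det_mul, Matrix.det_diagonal, Matrix.det_diagonal]
  rw [mul_comm, ← mul_assoc, ← Finset.prod_mul_distrib]
  simp [hg]

theorem principalMinor_map {X Y : Type*} (K : Y → Y → ℝ) (f : X ↪ Y) (A : Finset X) :
    principalMinor K (A.map f) = principalMinor (fun p q => K (f p) (f q)) A := by
  classical
  unfold principalMinor
  let e : A ≃ A.map f := Equiv.ofBijective
    (fun x => ⟨f x, Finset.mem_map_of_mem f x.2⟩)
    ⟨fun x y h => Subtype.ext (f.injective (congrArg Subtype.val h)), fun y => by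
      obtain ⟨x, hx, hxy⟩ := Finset.mem_map.1 y.2
      exact ⟨⟨x, hx⟩, Subtype.ext hxy⟩⟩
  rw [← Matrix.det_submatrix_equiv_self e]
  rfl

theorem tendsto_principalMinor {X ι : Type*} {l : Filter ι} {K : ι → X → X → ℝ} {K' : X → X → ℝ}
    (h : ∀ p q, Tendsto (fun i => K i p q) l (𝓝 (K' p q))) (A : Finset X) :
    Tendsto (fun i => principalMinor (K i) A) l (𝓝 (principalMinor K' A)) := by
  classical
  unfold principalMinor
  simp_rw [Matrix.det_apply]
  refine tendsto_finsetSum _ fun σ _ => ?_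
  exact (tendsto_finsetProd _ fun p _ => h _ _).const_smul _

theorem tendsto_occupationWeight {X ι : Type*} {l : Filter ι} {c : ι → Finset X → ℝ}
    {c' : Finset X → ℝ} (h : ∀ A, Tendsto (fun i => c i A) l (𝓝 (c' A))) (S A : Finset X) :
    Tendsto (fun i => occupationWeight (c i) S A) l (𝓝 (occupationWeight c' S A)) :=
  tendsto_finsetSum _ fun _ _ => (h _).const_mul _

variable {Ω X : Type*} [MeasurableSpace Ω]

theorem exp_finsuppSum (f : X →₀ ℝ) (m : X → ℕ) :
    Real.exp (f.sum fun x c => c * (m x : ℝ)) = ∏ p ∈ f.support, Real.exp (f p) ^ m p := by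
  rw [Finsupp.sum, Real.exp_sum]
  exact Finset.prod_congr rfl fun p _ => by rw [mul_comm, Real.exp_nat_mul]

theorem HasCorrelations.generatingFunction {μ : Measure Ω} {n : X → Ω → ℕ} {K : X → X → ℝ}
    (h : HasCorrelations μ n (principalMinor K)) (f : X →₀ ℝ) :
    Integrable (fun ω => Real.exp (f.sum fun x c => c * (n x ω : ℝ))) μ ∧
    ∫ ω, Real.exp (f.sum fun x c => c * (n x ω : ℝ)) ∂μ
      = fredholmDet K (fun p => Real.exp (f p) - 1) f.support := by
  have hae : (fun ω => Real.exp (f.sum fun x c => c * (n x ω : ℝ))) =ᵐ[μ]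
      fun ω => ∑ A ∈ f.support.powerset,
        (∏ p ∈ A, (Real.exp (f p) - 1)) * ∏ p ∈ A, (n p ω : ℝ) := by
    filter_upwards [h.ae_le_one f.support] with ω hω
    rw [exp_finsuppSum f fun p => n p ω]
    simp_rw [← Finset.prod_mul_distrib]
    rw [← Finset.prod_one_add]
    refine Finset.prod_congr rfl fun p hp => ?_
    have := hω p hp
    interval_cases n p ω <;> simp
  have hint : ∀ A ∈ f.support.powerset, Integrable (fun ω =>
      (∏ p ∈ A, (Real.exp (f p) - 1)) * ∏ p ∈ A, (n p ω : ℝ)) μ := fun A _ =>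
    (h.integrable_prod A).const_mul _
  refine ⟨(integrable_congr hae).2 (integrable_finsetSum _ hint), ?_⟩
  rw [integral_congr_ae hae, integral_finsetSum _ hint, fredholmDet_eq]
  exact Finset.sum_congr rfl fun A _ => by rw [integral_const_mul, h.integral_prod]

/-- With z = e^c ≥ 1, the Chebyshev bound gives P(n ≥ 2) z² ≤ 1 + (z - 1)k. A quadratic cannot stay
below a linear function unless its coefficient vanishes. -/
theorem ae_le_one_of_exp_moments {μ : Measure Ω} [IsProbabilityMeasure μ] {n : Ω → ℕ}
    (hn : Measurable n) (k : ℝ) (hi : ∀ c : ℝ, Integrable (fun ω => Real.exp (c * (n ω : ℝ))) μ)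
    (h : ∀ c : ℝ, ∫ ω, Real.exp (c * (n ω : ℝ)) ∂μ = 1 + (Real.exp c - 1) * k) :
    ∀ᵐ ω ∂μ, n ω ≤ 1 := by
  have hs : MeasurableSet {ω | 2 ≤ n ω} := hn measurableSet_Ici
  have hbound : ∀ c : ℝ, 0 ≤ c →
      μ.real {ω | 2 ≤ n ω} * Real.exp c ^ 2 ≤ 1 + (Real.exp c - 1) * k := by
    intro c hc
    rw [← h c]
    have : ∫ ω, {ω | 2 ≤ n ω}.indicator (fun _ => Real.exp c ^ 2) ω ∂μ
        = μ.real {ω | 2 ≤ n ω} * Real.exp c ^ 2 := by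
      rw [integral_indicator_const _ hs, smul_eq_mul]
    rw [← this]
    refine integral_mono ((integrable_const _).indicator hs) (hi c) fun ω => ?_
    by_cases hω : 2 ≤ n ω
    · simp only [Set.indicator, Set.mem_ofPred_eq, hω, if_true]
      rw [← Real.exp_nat_mul]
      refine Real.exp_le_exp.2 ?_
      rw [mul_comm c]
      exact mul_le_mul_of_nonneg_right (by exact_mod_cast hω) hc
    · simp only [Set.indicator, Set.mem_ofPred_eq, hω, if_false]
      positivity
  have hzero : μ.real {ω | 2 ≤ n ω} = 0 := by
    by_contra hne
    have hpos : 0 < μ.real {ω | 2 ≤ n ω} := lt_of_le_of_ne measureReal_nonneg (Ne.symm hne)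
    set m := μ.real {ω | 2 ≤ n ω}
    -- Chosen so that m z = 1 + |k| + m; then m z² exceeds 1 + (z - 1)|k|.
    set z := (1 + |k|) / m + 1 with hz
    have hz1 : 1 ≤ z := by rw [hz]; have : 0 ≤ (1 + |k|) / m := by positivity
                           linarith
    have hb := hbound (Real.log z) (Real.log_nonneg hz1)
    rw [Real.exp_log (by linarith)] at hb
    have h1 : m * z = 1 + |k| + m := by rw [hz]; field_simp
    have h2 : (z - 1) * k ≤ (z - 1) * |k| := mul_le_mul_of_nonneg_left (le_abs_self k) (by linarith)
    nlinarith [abs_nonneg k]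
  rw [measureReal_eq_zero_iff] at hzero
  rw [ae_iff]
  convert hzero using 3
  ext ω; simp only [not_le]; omega

/-- Möbius inversion over finite sets: all proper subsets agree by induction, so the top terms
agree. -/
theorem Finset.eq_of_sum_powerset_eq {u v : Finset X → ℝ}
    (h : ∀ S : Finset X, ∑ A ∈ S.powerset, u A = ∑ A ∈ S.powerset, v A) (S : Finset X) :
    u S = v S := by
  classical
  induction S using Finset.strongInduction with
  | H S ih =>
    have := h S
    rw [← Finset.sum_erase_add _ _ (Finset.mem_powerset_self S),
      ← Finset.sum_erase_add _ v (Finset.mem_powerset_self S)] at this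
    rw [Finset.sum_congr rfl fun A hA => ih A ?_] at this
    · exact add_left_cancel this
    · rw [Finset.mem_erase, Finset.mem_powerset] at hA
      exact hA.2.ssubset_of_ne hA.1

/-- One-point test functions show that there are no multiple points. After that the generating
function is multi-affine, and the value χ = 1 on `S` gives the sum of the correlations over all
subsets of `S`, which is inverted. -/
theorem hasCorrelations_of_generatingFunction {μ : Measure Ω} [IsProbabilityMeasure μ]
    {n : X → Ω → ℕ} {K : X → X → ℝ} (hn : ∀ p, Measurable (n p))
    (hi : ∀ f : X →₀ ℝ, Integrable (fun ω => Real.exp (f.sum fun x c => c * (n x ω : ℝ))) μ)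
    (h : ∀ f : X →₀ ℝ, ∫ ω, Real.exp (f.sum fun x c => c * (n x ω : ℝ)) ∂μ
      = fredholmDet K (fun p => Real.exp (f p) - 1) f.support) :
    HasCorrelations μ n (principalMinor K) := by
  classical
  have hle : ∀ p, ∀ᵐ ω ∂μ, n p ω ≤ 1 := by
    intro p
    have hs : ∀ (c : ℝ) ω, ((Finsupp.single p c).sum fun x c => c * (n x ω : ℝ)) = c * n p ω :=
      fun c ω => by simp
    refine ae_le_one_of_exp_moments (hn p) (K p p) (fun c => ?_) (fun c => ?_)
    · simpa only [hs] using hi (Finsupp.single p c)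
    · have := h (Finsupp.single p c)
      simp only [hs] at this
      rw [this]
      by_cases hc : c = 0
      · simp [hc, fredholmDet_eq, principalMinor_empty]
      · rw [Finsupp.support_single p hc, fredholmDet_eq, ← insert_empty_eq,
          Finset.sum_powerset_insert (Finset.notMem_empty p)]
        simp [principalMinor_empty, principalMinor_singleton]
  have hint : ∀ A : Finset X, Integrable (fun ω => ∏ p ∈ A, (n p ω : ℝ)) μ := by
    intro A
    refine Integrable.of_bound (Finset.measurable_fun_prod _ fun p _ =>
      (measurable_from_top.comp (hn p))).aestronglyMeasurable 1 ?_
    filter_upwards [(Finset.eventually_all A).2 fun p _ => hle p] with ω hω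
    rw [Real.norm_eq_abs, Finset.abs_prod]
    exact Finset.prod_le_one (fun _ _ => abs_nonneg _) fun p hp => by simpa using hω p hp
  refine ⟨inferInstance, hn, hle, Finset.eq_of_sum_powerset_eq fun S => ?_⟩
  rw [← integral_finsetSum _ fun A _ => hint A]
  -- The value log 2 makes e^f - 1 equal to 1 on `S`, so all weights in the Fredholm expansion are
  -- 1.
  set f : X →₀ ℝ := Finsupp.indicator S fun _ _ => Real.log 2 with hf
  have hlog : Real.log 2 ≠ 0 := (Real.log_pos (by norm_num)).ne'
  have hfs : f.support = S := by
    ext p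
    by_cases hp : p ∈ S <;> simp [hf, Finsupp.indicator_apply, hp, hlog]
  have hfp : ∀ p ∈ S, Real.exp (f p) = 2 := fun p hp => by
    simp [hf, Finsupp.indicator_apply, hp, Real.exp_log]
  have := h f
  rw [fredholmDet_eq, hfs] at this
  rw [Finset.sum_congr rfl fun A hA => by
    rw [Finset.prod_eq_one fun p hp => by
      rw [hfp p (Finset.mem_powerset.1 hA hp)]; norm_num, one_mul]] at this
  rw [← this]
  refine integral_congr_ae ?_
  filter_upwards [(Finset.eventually_all S).2 fun p _ => hle p] with ω hω
  rw [exp_finsuppSum f fun p => n p ω, hfs, ← Finset.prod_one_add]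
  refine Finset.prod_congr rfl fun p hp => ?_
  have := hω p hp
  rw [hfp p hp]
  interval_cases n p ω <;> norm_num

theorem isDeterminantal_iff {μ : Measure (X → ℕ)} {K : X → X → ℝ} :
    IsDeterminantal μ K ↔ HasCorrelations μ (fun p ω => ω p) (principalMinor K) := by
  constructor
  · intro h
    have := h.isProbabilityMeasure
    exact hasCorrelations_of_generatingFunction (fun p => measurable_pi_apply p) h.integrable
      h.generatingFunction
  · intro h
    exact ⟨h.isProbabilityMeasure, fun f => (h.generatingFunction f).1,
      fun f => (h.generatingFunction f).2⟩

theorem isDeterminantalProcess_iff {P : Measure ConfigPath} {K : ℝ≥0 × ℤ → ℝ≥0 × ℤ → ℝ} :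
    IsDeterminantalProcess P K ↔ HasCorrelations P (fun p ω => ω p.1 p.2) (principalMinor K) := by
  constructor
  · intro h
    have := h.isProbabilityMeasure
    exact hasCorrelations_of_generatingFunction (n := fun (p : ℝ≥0 × ℤ) (ω : ConfigPath) => ω p.1 p.2)
      (fun p => (measurable_pi_apply p.2).comp (measurable_pi_apply p.1)) h.integrable
      h.generatingFunction
  · intro h
    exact ⟨h.isProbabilityMeasure, fun f => (h.generatingFunction f).1,
      fun f => (h.generatingFunction f).2⟩

/-- Existence of configuration-valued processes with given correlations. -/
theorem exists_process_hasCorrelations {S T : Type*} (c : Finset (S × T) → ℝ) (h1 : c ∅ = 1)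
    (hc : ∀ S A, A ⊆ S → 0 ≤ occupationWeight c S A) :
    ∃ μ : Measure (S → T → ℕ), HasCorrelations μ (fun p ω => ω p.1 p.2) c := by
  obtain ⟨μ, hμ⟩ := exists_hasCorrelations c h1 hc
  refine ⟨μ.map Function.curry, ?_⟩
  exact (HasCorrelations.map measurable_curry fun p =>
    (measurable_pi_apply p.2).comp (measurable_pi_apply p.1)).2 hμ

/-- Convergence of correlation functions implies weak convergence. -/
theorem HasCorrelations.tendsto_integral {ι : Type*} {l : Filter ι} {μ : ι → Measure Ω}
    {n : ι → X → Ω → ℕ} {c : ι → Finset X → ℝ} {ν : Measure Ω} {m : X → Ω → ℕ} {c' : Finset X → ℝ}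
    (hμ : ∀ i, HasCorrelations (μ i) (n i) (c i)) (hν : HasCorrelations ν m c')
    (hc : ∀ A, Tendsto (fun i => c i A) l (𝓝 (c' A))) {G : (X → ℕ) → ℝ} (hG : Continuous G)
    {C : ℝ} (hGC : ∀ ω, |G ω| ≤ C)
    (hGμ : ∀ i, AEStronglyMeasurable (fun ω => G fun p => n i p ω) (μ i))
    (hGν : AEStronglyMeasurable (fun ω => G fun p => m p ω) ν)
    (hcount : Countable X) :
    Tendsto (fun i => ∫ ω, G (fun p => n i p ω) ∂(μ i)) l (𝓝 (∫ ω, G (fun p => m p ω) ∂ν)) := by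
  classical
  have hν1 := hν.isProbabilityMeasure
  have hcomp : IsCompact (Set.univ.pi fun _ : X => Set.Iic (1 : ℕ)) :=
    isCompact_univ_pi fun _ => (Set.finite_Iic 1).isCompact
  -- On the compact set {0,1}^X a continuous function is uniformly close to one that depends on
  -- finitely many coordinates. Thus weak convergence needs only the finite sums of occupation
  -- weights and no tightness argument.
  have happrox : ∀ ε > 0, ∃ S : Finset X, ∀ ω : X → ℕ, (∀ p, ω p ≤ 1) →
      |G ω - G (truncConfig S ω)| ≤ ε := by
    intro ε hε
    have hloc : ∀ ω : X → ℕ, ∃ S : Finset X, ∀ ω' : X → ℕ, (∀ p ∈ S, ω' p = ω p) →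
        |G ω' - G ω| < ε / 2 := by
      intro ω
      have hnhds : {ω' | |G ω' - G ω| < ε / 2} ∈ 𝓝 ω := by
        have := (hG.tendsto ω).eventually (Metric.ball_mem_nhds (G ω) (half_pos hε))
        filter_upwards [this] with ω' h
        simpa [Real.dist_eq] using h
      rw [nhds_pi, Filter.mem_pi] at hnhds
      obtain ⟨I, hI, t, ht, hsub⟩ := hnhds
      refine ⟨hI.toFinset, fun ω' h => hsub fun p hp => ?_⟩
      rw [h p (hI.mem_toFinset.2 hp)]
      exact mem_of_mem_nhds (ht p)
    choose S hS using hloc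
    have hopen : ∀ ω : X → ℕ, {ω' : X → ℕ | ∀ p ∈ S ω, ω' p = ω p} ∈ 𝓝 ω := by
      intro ω
      refine (IsOpen.mem_nhds ?_ fun p _ => rfl)
      have : {ω' : X → ℕ | ∀ p ∈ S ω, ω' p = ω p} = ⋂ p ∈ S ω, (fun ω' => ω' p) ⁻¹' {ω p} := by
        ext; simp
      rw [this]
      exact isOpen_biInter_finset fun p _ => (isOpen_discrete _).preimage (continuous_apply p)
    obtain ⟨t, -, ht⟩ := hcomp.elim_nhds_subcover (fun ω => {ω' | ∀ p ∈ S ω, ω' p = ω p})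
      fun ω _ => hopen ω
    refine ⟨t.biUnion S, fun ω hω => ?_⟩
    have hmem : ω ∈ Set.univ.pi fun _ : X => Set.Iic (1 : ℕ) := fun p _ => hω p
    obtain ⟨ω₀, hω₀, h⟩ := Set.mem_iUnion₂.1 (ht hmem)
    have h1 := hS ω₀ ω h
    have h2 := hS ω₀ (truncConfig (t.biUnion S) ω) fun p hp => by
      have : p ∈ t.biUnion S := Finset.mem_biUnion.2 ⟨ω₀, hω₀, hp⟩
      simp only [truncConfig, this, if_true]
      exact h p hp
    rw [abs_lt] at h1 h2
    rw [abs_le]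
    constructor <;> linarith [h1.1, h1.2, h2.1, h2.2]
  have herr : ∀ (ρ : Measure Ω) (k : X → Ω → ℕ) (d : Finset X → ℝ), HasCorrelations ρ k d →
      AEStronglyMeasurable (fun ω => G fun p => k p ω) ρ → ∀ (ε : ℝ) (S : Finset X),
      (∀ ω : X → ℕ, (∀ p, ω p ≤ 1) → |G ω - G (truncConfig S ω)| ≤ ε) →
      |(∫ ω, G (fun p => k p ω) ∂ρ) -
        ∑ A ∈ S.powerset, occupationWeight d S A * G (finsetConfig A)| ≤ ε := by
    intro ρ k d hρ hGρ ε S hS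
    have hρ1 := hρ.isProbabilityMeasure
    obtain ⟨hi, he⟩ := hρ.integral_truncConfig S G
    have hGi : Integrable (fun ω => G fun p => k p ω) ρ :=
      Integrable.of_bound hGρ C (Eventually.of_forall fun ω => hGC _)
    rw [← he, ← integral_sub hGi hi, ← Real.norm_eq_abs]
    refine (norm_integral_le_of_norm_le_const (C := ε) ?_).trans (by simp)
    filter_upwards [ae_all_iff.2 hρ.le_one] with ω hω
    exact hS _ hω
  rw [Metric.tendsto_nhds]
  intro ε hε
  obtain ⟨S, hS⟩ := happrox (ε / 3) (by positivity)
  have hfin : Tendsto (fun i => ∑ A ∈ S.powerset, occupationWeight (c i) S A * G (finsetConfig A)) l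
      (𝓝 (∑ A ∈ S.powerset, occupationWeight c' S A * G (finsetConfig A))) :=
    tendsto_finsetSum _ fun A _ => (tendsto_occupationWeight hc S A).mul_const _
  filter_upwards [(Metric.tendsto_nhds.1 hfin) (ε / 3) (by positivity)] with i hi
  have h1 := herr _ _ _ (hμ i) (hGμ i) _ S hS
  have h2 := herr _ _ _ hν hGν _ S hS
  rw [Real.dist_eq, abs_lt] at hi ⊢
  rw [abs_le] at h1 h2
  constructor <;> linarith [h1.1, h1.2, h2.1, h2.2, hi.1, hi.2]

end Determinantal

/-! ### Determinant identities -/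

section LinearAlgebra

/-- Multilinearity in the rows: `A` is the set of rows where the term χ_i K_i is taken, the others
being rows of the identity. -/
theorem det_one_add_diagonal_mul {ι : Type*} [Fintype ι] [DecidableEq ι] (χ : ι → ℝ)
    (K : ι → ι → ℝ) :
    (1 + Matrix.diagonal χ * Matrix.of K).det
      = ∑ A : Finset ι, (∏ i ∈ A, χ i) * principalMinor K A := by
  have h1 : (1 + Matrix.diagonal χ * Matrix.of K).det
      = Matrix.detRowAlternating ((fun i => χ i • (Matrix.of K).row i) +
        fun i => (1 : Matrix ι ι ℝ).row i) := by
    rw [add_comm]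
    change Matrix.detRowAlternating _ = _
    congr 1
    ext i j
    simp [Matrix.add_apply, Matrix.diagonal_mul]
  rw [h1, AlternatingMap.map_add_univ]
  refine Finset.sum_congr rfl fun A _ => ?_
  have h2 : A.piecewise (fun i => χ i • (Matrix.of K).row i) (fun i => (1 : Matrix ι ι ℝ).row i)
      = fun i => (if i ∈ A then χ i else 1) •
        A.piecewise (Matrix.of K).row (1 : Matrix ι ι ℝ).row i := by
    funext i
    by_cases hi : i ∈ A <;> simp [hi]
  rw [h2, AlternatingMap.map_smul_univ, Finset.prod_ite_mem, Finset.univ_inter, smul_eq_mul]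
  congr 1
  have := Matrix.det_piecewise_one_eq_submatrix_det (Matrix.of K) A
  unfold principalMinor
  convert this <;> rfl

/-- The determinantal resummation of chains: `c` solves the renewal equation `c = U + c χ P` with
`P` strictly upper triangular. -/
theorem det_one_add_mul_of_renewal {ι Λ : Type*} [Fintype ι] [LinearOrder ι] [Fintype Λ]
    [DecidableEq Λ] (χ : ι → ℝ) (U c : Matrix Λ ι ℝ) (W : Matrix ι Λ ℝ) (P : Matrix ι ι ℝ)
    (hP : ∀ i j, ¬ i < j → P i j = 0) (hc : c = U + c * (Matrix.diagonal χ * P)) :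
    (1 + c * (Matrix.diagonal χ * W)).det = (1 + Matrix.diagonal χ * (W * U - P)).det := by
  have hU : c * (1 - Matrix.diagonal χ * P) = U := by
    rw [Matrix.mul_sub, Matrix.mul_one, sub_eq_iff_eq_add]; exact hc
  -- Unitriangularity: multiplying by this determinant is free, and it turns `c` into `U`.
  have hdet : (1 - Matrix.diagonal χ * P).det = 1 := by
    rw [Matrix.det_of_isUpperTriangular]
    · refine Finset.prod_eq_one fun i _ => ?_
      simp [Matrix.diagonal_mul, hP i i (lt_irrefl i)]
    · intro i j hij
      have hij' : j < i := hij
      simp [Matrix.diagonal_mul, hP i j hij'.le.not_gt, Matrix.one_apply_ne hij'.ne']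
  rw [Matrix.det_one_add_mul_comm]
  calc _ = (1 + Matrix.diagonal χ * W * c).det * (1 - Matrix.diagonal χ * P).det := by
        rw [hdet, mul_one]
    _ = _ := by
        rw [← Matrix.det_mul]
        congr 1
        rw [Matrix.add_mul, Matrix.mul_assoc, hU, Matrix.one_mul, Matrix.mul_sub]
        rw [Matrix.mul_assoc]; abel

/-- Expanding every factor z - 1 changes the basis from monomials in z - 1 to monomials in z; the
coefficients become the inclusion-exclusion sums. -/
theorem sum_prod_sub_one_mul {ι : Type*} [Fintype ι] [DecidableEq ι] (z : ι → ℝ)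
    (c : Finset ι → ℝ) :
    ∑ B : Finset ι, (∏ i ∈ B, (z i - 1)) * c B
      = ∑ A : Finset ι, occupationWeight c Finset.univ A * ∏ i ∈ A, z i := by
  have e : ∀ A : Finset ι, occupationWeight c Finset.univ A
      = ∑ D ∈ Aᶜ.powerset, (-1) ^ D.card * c (A ∪ D) := fun A => by
    unfold occupationWeight; rw [Finset.compl_eq_univ_sdiff]; congr!
  simp_rw [e, Finset.sum_mul, sub_eq_add_neg, Finset.prod_add, Finset.sum_mul]
  rw [Finset.sum_sigma', Finset.sum_sigma']
  refine Finset.sum_bij' (fun x _ => ⟨x.2, x.1 \ x.2⟩) (fun x _ => ⟨x.1 ∪ x.2, x.1⟩) ?_ ?_ ?_ ?_ ?_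
  · rintro ⟨B, A⟩ h
    simp only [Finset.mem_sigma, Finset.mem_univ, true_and, Finset.mem_powerset] at h ⊢
    rw [Finset.compl_eq_univ_sdiff]
    exact Finset.sdiff_subset_sdiff (Finset.subset_univ _) subset_rfl
  · rintro ⟨A, D⟩ h
    exact Finset.mem_sigma.2 ⟨Finset.mem_univ _, Finset.mem_powerset.2 Finset.subset_union_left⟩
  · rintro ⟨B, A⟩ h
    simp only [Finset.mem_sigma, Finset.mem_univ, true_and, Finset.mem_powerset] at h
    simp [Finset.union_sdiff_of_subset h]
  · rintro ⟨A, D⟩ h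
    simp only [Finset.mem_sigma, Finset.mem_univ, true_and, Finset.mem_powerset] at h
    have hd : Disjoint A D := Finset.disjoint_of_subset_right h disjoint_compl_right
    simp [Finset.union_sdiff_cancel_left hd]
  · rintro ⟨B, A⟩ h
    simp only [Finset.mem_sigma, Finset.mem_univ, true_and, Finset.mem_powerset] at h
    simp only [Finset.prod_const, Finset.union_sdiff_of_subset h]
    ring

/-- A multi-affine generating function is concentrated on configurations without multiple points. -/
theorem integral_comp_mul_of_generatingFunction {Ω ι : Type*} [MeasurableSpace Ω] [Fintype ι]
    {μ : Measure Ω} {n : ι → Ω → ℕ} (hn : ∀ i, Measurable (n i)) {M : ℕ} (hM : ∀ i ω, n i ω ≤ M)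
    {D : Ω → ℝ} (hD : Integrable D μ) {c : Finset ι → ℝ}
    (h : ∀ z : ι → ℝ, ∫ ω, (∏ i, z i ^ n i ω) * D ω ∂μ
      = ∑ A : Finset ι, (∏ i ∈ A, (z i - 1)) * c A) (g : (ι → ℕ) → ℝ) :
    ∫ ω, g (fun i => n i ω) * D ω ∂μ
      = ∑ A : Finset ι, occupationWeight c Finset.univ A * g (finsetConfig A) := by
  classical
  set box : Finset (ι → ℕ) := Fintype.piFinset fun _ => Finset.range (M + 1)
  have hmem : ∀ ω, (fun i => n i ω) ∈ box := fun ω =>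
    Fintype.mem_piFinset.2 fun i => Finset.mem_range.2 (Nat.lt_succ_of_le (hM i ω))
  set a : (ι → ℕ) → ℝ := fun m => ∫ ω, {ω | (fun i => n i ω) = m}.indicator D ω ∂μ
  have hms : ∀ m : ι → ℕ, MeasurableSet {ω | (fun i => n i ω) = m} := fun m =>
    (measurable_pi_lambda _ hn) (measurableSet_singleton m)
  have hexp : ∀ f : (ι → ℕ) → ℝ, ∫ ω, f (fun i => n i ω) * D ω ∂μ = ∑ m ∈ box, f m * a m := by
    intro f
    have : ∀ ω, f (fun i => n i ω) * D ω
        = ∑ m ∈ box, f m * {ω | (fun i => n i ω) = m}.indicator D ω := by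
      intro ω
      rw [Finset.sum_eq_single (fun i => n i ω)]
      · simp [Set.indicator]
      · intro m _ hm
        simp [Set.indicator, hm.symm]
      · intro hc; exact absurd (hmem ω) hc
    simp_rw [this]
    rw [integral_finsetSum _ fun m _ => (hD.indicator (hms m)).const_mul _]
    simp_rw [integral_const_mul]
    rfl
  -- The density `D` may be signed, so multiple points are excluded by comparing coefficients: both
  -- expressions of the generating function are polynomials in z that agree everywhere.
  set p₁ : MvPolynomial ι ℝ :=
    ∑ m ∈ box, MvPolynomial.monomial (Finsupp.equivFunOnFinite.symm m) (a m)
  set p₂ : MvPolynomial ι ℝ := ∑ A : Finset ι,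
    MvPolynomial.monomial (Finsupp.equivFunOnFinite.symm (finsetConfig A))
      (occupationWeight c Finset.univ A)
  have hp : p₁ = p₂ := by
    refine MvPolynomial.funext fun z => ?_
    simp only [p₁, p₂, map_sum, MvPolynomial.eval_monomial]
    have e1 : ∀ m : ι → ℕ, ((Finsupp.equivFunOnFinite.symm m).prod fun i e => z i ^ e)
        = ∏ i, z i ^ m i := fun m => by
      rw [Finsupp.prod_fintype _ _ fun i => pow_zero _]; rfl
    simp_rw [e1]
    have e2 := h z
    rw [sum_prod_sub_one_mul, hexp fun m => ∏ i, z i ^ m i] at e2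
    rw [Finset.sum_congr rfl fun m _ => mul_comm (a m) _, e2]
    refine Finset.sum_congr rfl fun A _ => ?_
    congr 1
    simp [finsetConfig, pow_ite, Finset.prod_ite_mem]
  -- Apply the linear functional that replaces the monomial z^m by g(m).
  have hL := congrArg ((MvPolynomial.basisMonomials ι ℝ).constr ℝ fun m => g m) hp
  have e3 : ∀ (m : ι → ℕ) (b : ℝ), (MvPolynomial.basisMonomials ι ℝ).constr ℝ (fun m => g m)
      (MvPolynomial.monomial (Finsupp.equivFunOnFinite.symm m) b) = b * g m := by
    intro m b
    have : MvPolynomial.monomial (Finsupp.equivFunOnFinite.symm m) b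
        = b • MvPolynomial.basisMonomials ι ℝ (Finsupp.equivFunOnFinite.symm m) := by
      simp [MvPolynomial.smul_monomial]
    rw [this, map_smul, Module.Basis.constr_basis]
    simp
  simp only [p₁, p₂, map_sum, e3] at hL
  rw [hexp g, ← hL]
  exact Finset.sum_congr rfl fun m _ => mul_comm _ _

end LinearAlgebra

/-! ### Modified Bessel functions -/

section Bessel

/-- Pairs of natural numbers, parametrized by their difference and their minimum. -/
def intProdNatEquiv : ℤ × ℕ ≃ ℕ × ℕ where
  toFun p := (p.2 + p.1.toNat, p.2 + (-p.1).toNat)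
  invFun q := ((q.1 : ℤ) - q.2, min q.1 q.2)
  left_inv := by
    rintro ⟨n, m⟩
    simp only [Prod.mk.injEq]
    constructor <;> omega
  right_inv := by
    rintro ⟨k, l⟩
    simp only [Prod.mk.injEq]
    constructor <;> omega

theorem besselI_term_eq (z : ℂ) (w : ℂ) (hw : w ≠ 0) (n : ℤ) (m : ℕ) :
    (z * w) ^ (m + n.toNat) / ((m + n.toNat).factorial : ℂ) *
      ((z * w⁻¹) ^ (m + (-n).toNat) / ((m + (-n).toNat).factorial : ℂ))
      = z ^ n.natAbs * (z ^ (2 * m) /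
        ((m.factorial : ℂ) * ((n.natAbs + m).factorial : ℂ))) * w ^ n := by
  obtain ⟨k, rfl | rfl⟩ := n.eq_nat_or_neg
  · have h1 : ((k : ℤ)).toNat = k := by simp
    have h2 : (-(k : ℤ)).toNat = 0 := by simp
    rw [h1, h2, add_zero, Int.natAbs_natCast, zpow_natCast, mul_pow, mul_pow, inv_pow,
      add_comm k m, pow_add w m k]
    field_simp
    ring
  · have h1 : (-(k : ℤ)).toNat = 0 := by simp
    have h2 : (-(-(k : ℤ))).toNat = k := by simp
    rw [h1, h2, add_zero, Int.natAbs_neg, Int.natAbs_natCast, zpow_neg, zpow_natCast, mul_pow,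
      mul_pow, inv_pow, add_comm k m, pow_add w m k]
    field_simp
    ring

/-- Multiply the exponential series of zw/2 and z/(2w) and collect the pairs of exponents by their
difference n; the sum over the minimum of the exponents is the Bessel series. -/
theorem hasSum_besselI_mul_zpow (z : ℝ) (w : ℂ) (hw : w ≠ 0) :
    HasSum (fun n : ℤ => (besselI n.natAbs z : ℂ) * w ^ n)
      (Complex.exp ((z / 2 : ℂ) * w) * Complex.exp ((z / 2 : ℂ) * w⁻¹)) := by
  have h1 := NormedSpace.norm_expSeries_div_summable ((z / 2 : ℂ) * w)
  have h2 := NormedSpace.norm_expSeries_div_summable ((z / 2 : ℂ) * w⁻¹)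
  have e1 := NormedSpace.expSeries_div_hasSum_exp ((z / 2 : ℂ) * w)
  have e2 := NormedSpace.expSeries_div_hasSum_exp ((z / 2 : ℂ) * w⁻¹)
  rw [← Complex.exp_eq_exp_ℂ] at e1 e2
  have hs := (summable_mul_of_summable_norm h1 h2)
  have hp := e1.mul e2 hs
  rw [← intProdNatEquiv.hasSum_iff] at hp
  have hfib := hp.prod_fiberwise fun n => (hp.summable.prod_factor n).hasSum
  refine (congrArg (HasSum · _) (funext fun n => ?_)).mpr hfib
  have e : ∀ m : ℕ, ((fun x : ℕ × ℕ => ((z / 2 : ℂ) * w) ^ x.1 / (x.1.factorial : ℂ) *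
      (((z / 2 : ℂ) * w⁻¹) ^ x.2 / (x.2.factorial : ℂ))) ∘ intProdNatEquiv) (n, m)
      = (z / 2 : ℂ) ^ n.natAbs * ((z / 2 : ℂ) ^ (2 * m) /
        ((m.factorial : ℂ) * ((n.natAbs + m).factorial : ℂ))) * w ^ n := fun m =>
    besselI_term_eq _ w hw n m
  rw [tsum_congr e, tsum_mul_right, tsum_mul_left]
  unfold besselI
  push_cast
  rfl

theorem abs_besselI (n : ℕ) (z : ℝ) : |besselI n z| = besselI n |z| := by
  unfold besselI
  have h : ∀ l : ℕ, (|z| / 2) ^ (2 * l) = (z / 2) ^ (2 * l) := fun l => by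
    simp only [pow_mul, div_pow, sq_abs]
  simp_rw [abs_mul, abs_pow, abs_div, abs_two, h]
  congr 1
  refine abs_of_nonneg (tsum_nonneg fun l => div_nonneg ?_ (by positivity))
  rw [pow_mul]; positivity

theorem besselI_nonneg (n : ℕ) {z : ℝ} (hz : 0 ≤ z) : 0 ≤ besselI n z := by
  rw [← abs_of_nonneg hz, ← abs_besselI]; positivity

theorem besselI_zero_right (n : ℕ) : besselI n 0 = if n = 0 then 1 else 0 := by
  unfold besselI
  split_ifs with h
  · subst h
    rw [tsum_eq_single 0]
    · simp
    · intro l hl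
      simp [hl]
  · simp [h]

theorem hasSum_besselI (z : ℝ) : HasSum (fun n : ℤ => besselI n.natAbs z) (Real.exp z) := by
  have h := hasSum_besselI_mul_zpow z 1 one_ne_zero
  rw [← Complex.exp_add] at h
  simp only [one_zpow, mul_one, inv_one, add_halves] at h
  rw [← Complex.ofReal_exp] at h
  exact Complex.hasSum_ofReal.1 h

theorem summable_abs_besselI (z : ℝ) : Summable fun n : ℤ => |besselI n.natAbs z| := by
  simp_rw [abs_besselI]
  exact (hasSum_besselI |z|).summable

theorem hasSum_besselI_mul_cexp (z θ : ℝ) :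
    HasSum (fun n : ℤ => (besselI n.natAbs z : ℂ) * Complex.exp ((n * θ : ℝ) * Complex.I))
      (Real.exp (z * Real.cos θ) : ℂ) := by
  have h := hasSum_besselI_mul_zpow z (Complex.exp (θ * Complex.I)) (Complex.exp_ne_zero _)
  rw [← Complex.exp_neg, ← Complex.exp_add, ← mul_add] at h
  have e : (z / 2 : ℂ) * (Complex.exp (θ * Complex.I) + Complex.exp (-(θ * Complex.I)))
      = ((z * Real.cos θ : ℝ) : ℂ) := by
    push_cast
    rw [Complex.cos, neg_mul]; ring
  rw [e, ← Complex.ofReal_exp] at h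
  convert h using 2 with n
  rw [← Complex.exp_int_mul]
  congr 2
  push_cast; ring

theorem hasSum_besselI_mul_cos (z θ φ : ℝ) :
    HasSum (fun n : ℤ => besselI n.natAbs z * Real.cos (n * θ + φ))
      (Real.cos φ * Real.exp (z * Real.cos θ)) := by
  have h := (hasSum_besselI_mul_cexp z θ).mul_left (Complex.exp (φ * Complex.I))
  have h2 := Complex.hasSum_re h
  convert h2 using 2 with n
  · rw [mul_left_comm, ← Complex.exp_add, ← add_mul, ← Complex.ofReal_add, Complex.re_ofReal_mul,
      Complex.exp_ofReal_mul_I_re, add_comm]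
  · rw [mul_comm, mul_comm (Complex.exp _), Complex.re_ofReal_mul, Complex.exp_ofReal_mul_I_re]

theorem integral_cos_int_mul (k : ℤ) :
    ∫ θ in (-Real.pi)..Real.pi, Real.cos (k * θ) = if k = 0 then 2 * Real.pi else 0 := by
  split_ifs with hk
  · subst hk; simp; ring
  · have hk' : (k : ℝ) ≠ 0 := by exact_mod_cast hk
    rw [intervalIntegral.integral_comp_mul_left _ hk', integral_cos, mul_neg, Real.sin_neg,
      Real.sin_int_mul_pi]
    simp

theorem hasSum_integral_of_summable_abs {b : ℤ → ℝ} (hb : Summable fun n => |b n|)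
    {f : ℤ → ℝ → ℝ} (hf : ∀ n, Continuous (f n)) (hf1 : ∀ n x, |f n x| ≤ 1) {g : ℝ → ℝ}
    (h : ∀ x, HasSum (fun n => b n * f n x) (g x)) (u v : ℝ) :
    HasSum (fun n => b n * ∫ x in u..v, f n x) (∫ x in u..v, g x) := by
  simp_rw [← intervalIntegral.integral_const_mul]
  refine intervalIntegral.hasSum_integral_of_dominated_convergence (fun n _ => |b n|)
    (fun n => (continuous_const.mul (hf n)).aestronglyMeasurable) (fun n => ?_) ?_ ?_ ?_
  · refine Eventually.of_forall fun x _ => ?_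
    rw [Real.norm_eq_abs, abs_mul]
    exact mul_le_of_le_one_right (abs_nonneg _) (hf1 n x)
  · exact Eventually.of_forall fun x _ => hb
  · exact intervalIntegrable_const
  · exact Eventually.of_forall fun x _ => h x

/-- The Bessel values are the Fourier coefficients of θ ↦ exp(z cos θ); orthogonality of the cosines
isolates one of them. -/
theorem besselI_eq_integral (n : ℤ) (z : ℝ) :
    2 * Real.pi * besselI n.natAbs z
      = ∫ θ in (-Real.pi)..Real.pi, Real.cos (n * θ) * Real.exp (z * Real.cos θ) := by
  have h := hasSum_integral_of_summable_abs (summable_abs_besselI z)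
    (f := fun m θ => Real.cos (((m - n : ℤ) : ℝ) * θ)) (fun m => by fun_prop)
    (fun m x => Real.abs_cos_le_one _)
    (g := fun θ => Real.cos (n * θ) * Real.exp (z * Real.cos θ)) (fun θ => by
      have := hasSum_besselI_mul_cos z θ (-(n * θ))
      rw [Real.cos_neg] at this
      convert this using 4 with m
      push_cast; ring) (-Real.pi) Real.pi
  simp_rw [integral_cos_int_mul, sub_eq_zero] at h
  have h2 := h.unique (hasSum_single n fun m hm => by simp [hm])
  rw [h2]; simp [mul_comm]

theorem sinc_pi_mul (u : ℝ) :
    2 * Real.pi * Real.sinc (Real.pi * u) = ∫ l in (-Real.pi)..Real.pi, Real.cos (l * u) := by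
  by_cases hu : u = 0
  · subst hu; simp; ring
  · rw [intervalIntegral.integral_comp_mul_right _ hu, integral_cos,
      Real.sinc_of_ne_zero (mul_ne_zero Real.pi_ne_zero hu), neg_mul, Real.sin_neg, smul_eq_mul]
    field_simp; ring

/-- The martingale functions as superpositions of trigonometric functions. -/
theorem martM_eq (a : ℕ) (k : ℤ) (t : ℝ) (y : ℤ) :
    2 * Real.pi * martM a k t y = ∫ l in (-Real.pi)..Real.pi,
      Real.cos (l * ((y : ℝ) / a - k)) * Real.exp (t * (1 - Real.cos (l / a))) := by
  have hb : Summable fun w : ℤ => |besselI (w - y).natAbs (-t)| :=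
    (Equiv.subRight y).summable_iff.2 (summable_abs_besselI (-t))
  have h := hasSum_integral_of_summable_abs hb
    (f := fun w l => Real.cos (l * ((w : ℝ) / a - k))) (fun m => by fun_prop)
    (fun m x => Real.abs_cos_le_one _)
    (g := fun l => Real.cos (l * ((y : ℝ) / a - k)) * Real.exp (-t * Real.cos (l / a)))
    (fun l => by
      have := (Equiv.subRight y).hasSum_iff.2
        (hasSum_besselI_mul_cos (-t) (l / a) (l * ((y : ℝ) / a - k)))
      convert this using 2 with w
      simp only [Function.comp_apply, Equiv.subRight_apply]
      congr 2
      push_cast; ring) (-Real.pi) Real.pi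
  simp_rw [← sinc_pi_mul] at h
  unfold martM transformS interpPhi
  have h2 := h.tsum_eq
  simp_rw [mul_left_comm _ (2 * Real.pi)] at h2
  rw [tsum_mul_left] at h2
  rw [mul_left_comm, h2, ← intervalIntegral.integral_const_mul]
  congr 1
  funext l
  rw [mul_left_comm, ← Real.exp_add]
  congr 2; ring

end Bessel

/-! ### Transition probabilities and the Markov property of the random walks -/

section Walks

/-- The transition probability `exp (-τ) I_{|n|}(τ)` of the random walk. -/
noncomputable def walkProb (τ : ℝ) (n : ℤ) : ℝ := Real.exp (-τ) * besselI n.natAbs τ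

theorem walkProb_nonneg {τ : ℝ} (hτ : 0 ≤ τ) (n : ℤ) : 0 ≤ walkProb τ n :=
  mul_nonneg (Real.exp_pos _).le (besselI_nonneg _ hτ)

theorem walkProb_zero (n : ℤ) : walkProb 0 n = if n = 0 then 1 else 0 := by
  simp [walkProb, besselI_zero_right]

theorem hasSum_walkProb (τ : ℝ) : HasSum (walkProb τ) 1 := by
  have := (hasSum_besselI τ).mul_left (Real.exp (-τ))
  rwa [← Real.exp_add, neg_add_cancel, Real.exp_zero] at this

theorem hasSum_walkProb_mul_cos (τ θ φ : ℝ) :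
    HasSum (fun n : ℤ => walkProb τ n * Real.cos (n * θ + φ))
      (Real.cos φ * Real.exp (-τ * (1 - Real.cos θ))) := by
  have := (hasSum_besselI_mul_cos τ θ φ).mul_left (Real.exp (-τ))
  have e : Real.exp (-τ) * (Real.cos φ * Real.exp (τ * Real.cos θ))
      = Real.cos φ * Real.exp (-τ * (1 - Real.cos θ)) := by
    rw [mul_left_comm, ← Real.exp_add]; ring_nf
  rw [e] at this
  simpa only [walkProb, mul_assoc] using this

theorem summable_walkProb_mul {τ : ℝ} (hτ : 0 ≤ τ) {g : ℤ → ℝ} {C : ℝ} (hg : ∀ n, |g n| ≤ C) :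
    Summable fun n => walkProb τ n * g n := by
  refine Summable.of_norm_bounded ((hasSum_walkProb τ).summable.mul_right C) fun n => ?_
  rw [Real.norm_eq_abs, abs_mul, abs_of_nonneg (walkProb_nonneg hτ n)]
  exact mul_le_mul_of_nonneg_left (hg n) (walkProb_nonneg hτ n)

/-- The transition operator of the random walk with step distribution `walkProb`, projected by
`π`. -/
noncomputable def walkOp {Y : Type*} [Add Y] (π : ℤ → Y) (τ : ℝ) (g : Y → ℝ) (y : Y) : ℝ :=
  ∑' n : ℤ, walkProb τ n * g (y + π n)

variable {Ω : Type*} [MeasurableSpace Ω] {Pr : Measure Ω}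
  {V : ℤ → ℝ≥0 → Ω → ℤ} {u : ℤ → ℤ}

theorem IsIndepRandomWalks.integral_cos [IsProbabilityMeasure Pr]
    (hV : IsIndepRandomWalks Pr V u) (j : ℤ) {s t : ℝ≥0}
    (hst : s ≤ t) (z φ : ℝ) :
    ∫ v, Real.cos (z * ((V j t v - V j s v : ℤ) : ℝ) + φ) ∂Pr
      = Real.cos φ * Real.exp (((t : ℝ) - s) * (Real.cos z - 1)) := by
  have h := hV.charFun j s t hst z
  have hm : Measurable fun v => (z * ((V j t v - V j s v : ℤ) : ℝ) : ℝ) :=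
    measurable_const.mul (measurable_from_top.comp ((hV.measurable j t).sub (hV.measurable j s)))
  have hi : Integrable (fun v => Complex.exp (φ * Complex.I) * Complex.exp (Complex.I *
      (z * ((V j t v - V j s v : ℤ) : ℝ) : ℝ))) Pr := by
    refine Integrable.const_mul (Integrable.of_bound (C := 1) ?_ (Eventually.of_forall fun v => ?_)) _
    · exact (Complex.measurable_exp.comp
        (measurable_const.mul (Complex.measurable_ofReal.comp hm))).aestronglyMeasurable
    · rw [mul_comm, Complex.norm_exp_ofReal_mul_I]
  have h2 := integral_re hi
  rw [integral_const_mul, h] at h2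
  have e : ∀ v, RCLike.re (Complex.exp (φ * Complex.I) * Complex.exp (Complex.I *
      (z * ((V j t v - V j s v : ℤ) : ℝ) : ℝ)))
      = Real.cos (z * ((V j t v - V j s v : ℤ) : ℝ) + φ) := by
    intro v
    rw [← Complex.exp_add, mul_comm Complex.I, ← add_mul, ← Complex.ofReal_add, add_comm φ]
    exact Complex.exp_ofReal_mul_I_re _
  simp_rw [e] at h2
  rw [h2, mul_comm, RCLike.re_eq_complex_re, Complex.re_ofReal_mul, Complex.exp_ofReal_mul_I_re,
    mul_comm]

/-- The increments have distribution `walkProb`. -/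
theorem IsIndepRandomWalks.measureReal_sub_eq [IsProbabilityMeasure Pr]
    (hV : IsIndepRandomWalks Pr V u) (j : ℤ) {s t : ℝ≥0}
    (hst : s ≤ t) (n : ℤ) :
    Pr.real {v | V j t v - V j s v = n} = walkProb ((t : ℝ) - s) n := by
  have hm : Measurable fun v => V j t v - V j s v := (hV.measurable j t).sub (hV.measurable j s)
  -- Fourier inversion for integer-valued variables: 2π times the indicator of the event is the
  -- integral of a cosine over one period, and Fubini brings in the characteristic function.
  have h1 : ∀ v, ∫ z in (-Real.pi)..Real.pi, Real.cos (z * ((V j t v - V j s v : ℤ) : ℝ) + -(z * n))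
      = {v | V j t v - V j s v = n}.indicator (fun _ => 2 * Real.pi) v := by
    intro v
    have := integral_cos_int_mul (V j t v - V j s v - n)
    rw [Set.indicator_apply]
    simp only [Set.mem_ofPred_eq]
    simp_rw [sub_eq_zero] at this
    rw [← this]
    congr 1; funext z; congr 1; push_cast; ring
  have h2 : ∫ v, (∫ z in (-Real.pi)..Real.pi,
      Real.cos (z * ((V j t v - V j s v : ℤ) : ℝ) + -(z * n))) ∂Pr
      = ∫ z in (-Real.pi)..Real.pi, ∫ v,
        Real.cos (z * ((V j t v - V j s v : ℤ) : ℝ) + -(z * n)) ∂Pr := by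
    simp_rw [intervalIntegral.integral_of_le (neg_le_self Real.pi_pos.le)]
    refine integral_integral_swap (Integrable.of_bound (C := 1) ?_ ?_)
    · refine Measurable.aestronglyMeasurable ?_
      refine Real.measurable_cos.comp (((measurable_snd).mul
        ((measurable_from_top (f := fun n : ℤ => (n : ℝ))).comp (hm.comp measurable_fst))).add ?_)
      exact (measurable_snd.mul measurable_const).neg
    · exact Eventually.of_forall fun p => Real.abs_cos_le_one _
  simp_rw [h1, hV.integral_cos j hst, Real.cos_neg] at h2
  have hms : MeasurableSet {v | V j t v - V j s v = n} := hm (measurableSet_singleton n)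
  rw [integral_indicator_const _ hms, smul_eq_mul] at h2
  have h3 : ∫ z in (-Real.pi)..Real.pi, Real.cos (z * n) * Real.exp (((t : ℝ) - s) * (Real.cos z - 1))
      = Real.exp (-((t : ℝ) - s)) * (2 * Real.pi * besselI n.natAbs ((t : ℝ) - s)) := by
    rw [besselI_eq_integral, ← intervalIntegral.integral_const_mul]
    congr 1; funext z
    rw [mul_left_comm, ← Real.exp_add, mul_comm z]
    ring_nf
  rw [h3] at h2
  have hpi : (2 * Real.pi) ≠ 0 := by positivity
  unfold walkProb
  apply mul_right_cancel₀ hpi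
  rw [h2]; ring

theorem IsIndepRandomWalks.integral_comp_sub [IsProbabilityMeasure Pr]
    (hV : IsIndepRandomWalks Pr V u) (j : ℤ) {s t : ℝ≥0}
    (hst : s ≤ t) (g : ℤ → ℝ) (C : ℝ) (hg : ∀ n, |g n| ≤ C) :
    ∫ v, g (V j t v - V j s v) ∂Pr = ∑' n : ℤ, walkProb ((t : ℝ) - s) n * g n := by
  have hm : Measurable fun v => V j t v - V j s v := (hV.measurable j t).sub (hV.measurable j s)
  have hP : IsProbabilityMeasure (Pr.map fun v => V j t v - V j s v) :=
    Measure.isProbabilityMeasure_map hm.aemeasurable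
  rw [← integral_map (f := g) hm.aemeasurable (measurable_from_top).aestronglyMeasurable,
    integral_countable]
  · refine tsum_congr fun n => ?_
    rw [map_measureReal_apply hm (measurableSet_singleton n), ← hV.measureReal_sub_eq j hst n,
      smul_eq_mul]
    rfl
  · exact Integrable.of_bound (measurable_from_top).aestronglyMeasurable C
      (Eventually.of_forall hg)

theorem IsIndepRandomWalks.indepFun_past (hV : IsIndepRandomWalks Pr V u) (j : ℤ) {n : ℕ}
    {t : Fin n → ℝ≥0} (ht : Monotone t) (k : Fin n) {r : ℝ≥0} (hr : t k ≤ r) :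
    IndepFun (fun v (l : Fin n) => V j (t (min l k)) v) (fun v => V j r v - V j (t k) v) Pr := by
  -- The time sequence 0, t 0, …, t k, r, r, …. Starting at 0, where the position is the constant `u
  -- j`, makes the past a function of the first k + 1 increments; the future increment has index k +
  -- 1.
  let τ : ℕ → ℝ≥0 := fun i => if i = 0 then 0 else
    if h : i - 1 ≤ k then t ⟨i - 1, lt_of_le_of_lt h k.2⟩ else r
  have hτs : ∀ (l : ℕ) (h : l ≤ k), τ (l + 1) = t ⟨l, lt_of_le_of_lt h k.2⟩ := fun l h => by
    simp [τ, h]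
  have hτr : ∀ l : ℕ, ¬ l ≤ k → τ (l + 1) = r := fun l h => by simp [τ, h]
  have hτ : Monotone τ := by
    refine monotone_nat_of_le_succ fun i => ?_
    rcases i with _ | i
    · simp [τ]
    · by_cases h1 : i + 1 ≤ k
      · rw [hτs i (by omega), hτs (i + 1) h1]
        exact ht (by simp)
      · rw [hτr _ h1]
        by_cases h2 : i ≤ k
        · rw [hτs i h2]
          refine le_trans (ht ?_) hr
          exact h2
        · rw [hτr _ h2]
  have hind := (hV.indepIncrements j).nat hτ
  have hmeas : ∀ i, Measurable fun v => V j (τ (i + 1)) v - V j (τ i) v := fun i =>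
    (hV.measurable j _).sub (hV.measurable j _)
  have h2 := hind.indepFun_finset (Finset.range (k + 1)) {k.1 + 1} (by simp) hmeas
  have h3 := h2.comp
    (φ := fun (x : Finset.range (k.1 + 1) → ℤ) (l : Fin n) =>
      u j + ∑ i : Finset.range (k.1 + 1), if i.1 ≤ min l k then x i else 0)
    (ψ := fun x : ({k.1 + 1} : Finset ℕ) → ℤ => x ⟨k.1 + 1, by simp⟩)
    Measurable.of_discrete Measurable.of_discrete
  refine h3.congr ?_ ?_
  · filter_upwards [hV.start j] with v hv
    funext l
    simp only [Function.comp_apply]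
    have hsum : ∀ m : ℕ, V j (τ m) v = u j + ∑ i ∈ Finset.range m, (V j (τ (i + 1)) v - V j (τ i) v) := by
      intro m
      rw [Finset.sum_range_sub fun i => V j (τ i) v]
      have : τ 0 = 0 := by simp [τ]
      rw [this, hv]; ring
    have hml : (min l k).1 ≤ k := by simp
    have e1 : V j (t (min l k)) v = V j (τ ((min l k).1 + 1)) v := by
      rw [hτs _ hml]
    rw [e1, hsum]
    congr 1
    rw [Finset.sum_coe_sort (Finset.range (k.1 + 1)) fun i =>
      if i ≤ (min l k).1 then (V j (τ (i + 1)) v - V j (τ i) v) else 0, ← Finset.sum_filter]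
    refine Finset.sum_congr ?_ fun _ _ => rfl
    ext i
    simp only [Finset.mem_filter, Finset.mem_range]
    omega
  · refine Eventually.of_forall fun v => ?_
    simp only [Function.comp_apply]
    rw [hτr (k.1 + 1) (by omega), hτs k.1 le_rfl]

/-- The Markov property of a random walk, projected by a homomorphism `π`. -/
theorem IsIndepRandomWalks.markov [IsProbabilityMeasure Pr]
    (hV : IsIndepRandomWalks Pr V u) (j : ℤ) {n : ℕ}
    {t : Fin n → ℝ≥0} (ht : Monotone t) (k : Fin n) {r : ℝ≥0} (hr : t k ≤ r)
    {Y : Type*} [AddCommGroup Y] [DecidableEq Y] (π : ℤ →+ Y) (H : (Fin n → ℤ) → ℝ) (y : Y)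
    (g : Y → ℝ) (C : ℝ) (hg : ∀ y, |g y| ≤ C) :
    ∫ v, (H (fun l => V j (t (min l k)) v) * if π (V j (t k) v) = y then 1 else 0) * g (π (V j r v)) ∂Pr
      = (∫ v, H (fun l => V j (t (min l k)) v) * (if π (V j (t k) v) = y then 1 else 0) ∂Pr) *
        walkOp π ((r : ℝ) - t k) g y := by
  -- On the event that the walk is at `y`, its later position is `y` plus an increment that is
  -- independent of the past.
  have h1 : ∀ v, (H (fun l => V j (t (min l k)) v) * if π (V j (t k) v) = y then 1 else 0) *
      g (π (V j r v)) = (H (fun l => V j (t (min l k)) v) * if π (V j (t k) v) = y then 1 else 0) *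
      g (y + π (V j r v - V j (t k) v)) := by
    intro v
    by_cases h : π (V j (t k) v) = y
    · rw [map_sub, h, add_sub_cancel]
    · simp [h]
  simp_rw [h1]
  have hind := (hV.indepFun_past j ht k hr).comp
    (φ := fun x : Fin n → ℤ => H x * if π (x k) = y then 1 else 0)
    (ψ := fun d : ℤ => g (y + π d)) Measurable.of_discrete Measurable.of_discrete
  have hmp : Measurable fun v (l : Fin n) => V j (t (min l k)) v :=
    measurable_pi_lambda _ fun l => hV.measurable j _
  have := hind.integral_fun_mul_eq_mul_integral
    ((Measurable.of_discrete.comp hmp).aestronglyMeasurable)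
    ((Measurable.of_discrete.comp ((hV.measurable j r).sub
      (hV.measurable j (t k)))).aestronglyMeasurable)
  simp only [Function.comp_apply, min_self] at this
  rw [this]
  congr 1
  exact hV.integral_comp_sub j hr (fun d => g (y + π d)) C fun n => hg _

theorem IsIndepRandomWalks.integral_comp [IsProbabilityMeasure Pr]
    (hV : IsIndepRandomWalks Pr V u) (j : ℤ) (r : ℝ≥0)
    {Y : Type*} [AddCommGroup Y] (π : ℤ →+ Y) (g : Y → ℝ) (C : ℝ) (hg : ∀ y, |g y| ≤ C) :
    ∫ v, g (π (V j r v)) ∂Pr = walkOp π r g (π (u j)) := by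
  have := hV.integral_comp_sub j (zero_le (a := r)) (fun d => g (π (u j) + π d)) C fun n => hg _
  rw [NNReal.coe_zero, sub_zero] at this
  rw [walkOp, ← this]
  refine integral_congr_ae ?_
  filter_upwards [hV.start j] with v hv
  rw [map_sub, hv, add_sub_cancel]

end Walks

/-! ### Determinantal functionals of finitely many independent walks -/

section ManyWalks

/-- Row i involves only the variable X i, so each term of the Leibniz expansion is a product of
functions of distinct independent variables. -/
theorem integral_det_of_iIndepFun {Ω ι E : Type*} [MeasurableSpace Ω] [Fintype ι] [DecidableEq ι]
    [MeasurableSpace E] {μ : Measure Ω} [IsProbabilityMeasure μ] {X : ι → Ω → E}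
    (hX : iIndepFun X μ) (mX : ∀ i, Measurable (X i)) {φ : ι → ι → E → ℝ}
    (hφ : ∀ i k, Measurable (φ i k)) {C : ℝ} (hC : ∀ i k x, |φ i k x| ≤ C) :
    Integrable (fun ω => (Matrix.of fun i k => φ i k (X i ω)).det) μ ∧
    ∫ ω, (Matrix.of fun i k => φ i k (X i ω)).det ∂μ
      = (Matrix.of fun i k => ∫ ω, φ i k (X i ω) ∂μ).det := by
  have hint : ∀ σ : Equiv.Perm ι, Integrable (fun ω => ∏ i, φ i (σ i) (X i ω)) μ := fun σ => by
    refine Integrable.of_bound (Finset.measurable_fun_prod _ fun i _ =>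
      (hφ i _).comp (mX i)).aestronglyMeasurable (∏ _i : ι, C) (Eventually.of_forall fun ω => ?_)
    rw [Real.norm_eq_abs, Finset.abs_prod]
    exact Finset.prod_le_prod (fun _ _ => abs_nonneg _) fun i _ => hC _ _ _
  have e : ∀ A : Matrix ι ι ℝ, A.det = ∑ σ : Equiv.Perm ι, ((Equiv.Perm.sign σ : ℤ) : ℝ) *
      ∏ i, A i (σ i) := fun A => by
    rw [← Matrix.det_transpose, Matrix.det_apply']; rfl
  simp_rw [e, Matrix.of_apply]
  refine ⟨integrable_finsetSum _ fun σ _ => (hint σ).const_mul _, ?_⟩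
  rw [integral_finsetSum _ fun σ _ => (hint σ).const_mul _]
  refine Finset.sum_congr rfl fun σ _ => ?_
  rw [integral_const_mul]
  congr 1
  exact hX.integral_fun_prod_comp (f := fun i => φ i (σ i)) (fun i => (mX i).aemeasurable)
    fun i => (hφ i _).aestronglyMeasurable

open Classical in
/-- The indicator function of a point. -/
noncomputable def pointIndicator {Y : Type*} (y : Y) : Y → ℝ := fun y' => if y' = y then 1 else 0

theorem abs_pointIndicator_le {Y : Type*} (y y' : Y) : |pointIndicator y y'| ≤ 1 := by
  unfold pointIndicator; split_ifs <;> simp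

/-- The correlation kernel of the walks with labels in `J` weighted by the determinant of the
functions `M k` at time `T`. -/
noncomputable def walkKernel {Y : Type*} [Add Y] (π : ℤ → Y) (u : ℤ → ℤ) (M : ℤ → Y → ℝ)
    (T : ℝ≥0) (J : Finset ℤ) (p q : ℝ≥0 × Y) : ℝ :=
  (∑ k ∈ J, walkOp π ((T : ℝ) - p.1) (M k) p.2 * walkOp π q.1 (pointIndicator q.2) (π (u k)))
    - if p.1 < q.1 then walkOp π ((q.1 : ℝ) - p.1) (pointIndicator q.2) p.2 else 0

variable {Ω : Type*} [MeasurableSpace Ω] {Pr : Measure Ω}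
  {V : ℤ → ℝ≥0 → Ω → ℤ} {u : ℤ → ℤ} {Y : Type*} [AddCommGroup Y] (π : ℤ →+ Y)

theorem IsIndepRandomWalks.integrable_mul_comp (hV : IsIndepRandomWalks Pr V u) (j : ℤ) (r : ℝ≥0)
    {h : Ω → ℝ} (hh : Integrable h Pr) (g : ℤ → ℝ) {C : ℝ} (hg : ∀ n, |g n| ≤ C) :
    Integrable (fun v => h v * g (V j r v)) Pr := by
  simp_rw [mul_comm (h _)]
  exact hh.bdd_mul (c := C) (Measurable.of_discrete.comp (hV.measurable j r)).aestronglyMeasurable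
    (Eventually.of_forall fun v => hg _)

theorem IsIndepRandomWalks.integrable_prod_one_add [IsProbabilityMeasure Pr]
    (hV : IsIndepRandomWalks Pr V u) (j : ℤ)
    {n : ℕ} (t : Fin n → ℝ≥0) (y : Fin n → Y) (χ : Fin n → ℝ) (s : Finset (Fin n)) :
    Integrable (fun v => ∏ l ∈ s, (1 + χ l * pointIndicator (y l) (π (V j (t l) v)))) Pr := by
  induction s using Finset.induction_on with
  | empty => simp
  | insert i s hi ih =>
    simp_rw [Finset.prod_insert hi]
    have := hV.integrable_mul_comp j (t i) ih
      (fun x => 1 + χ i * pointIndicator (y i) (π x)) (C := 1 + |χ i|) fun x => by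
        refine (abs_add_le _ _).trans ?_
        rw [abs_one, abs_mul]
        have := mul_le_mul_of_nonneg_left (abs_pointIndicator_le (y i) (π x)) (abs_nonneg (χ i))
        linarith
    simpa only [mul_comm] using this

/-- The mass of the walk at the point `i`, dressed by the weights at the preceding points. -/
noncomputable def dressedMass (Pr : Measure Ω) (V : ℤ → ℝ≥0 → Ω → ℤ) (j : ℤ) {n : ℕ}
    (t : Fin n → ℝ≥0) (y : Fin n → Y) (χ : Fin n → ℝ) (i : Fin n) : ℝ :=
  ∫ v, (∏ l with l < i, (1 + χ l * pointIndicator (y l) (π (V j (t l) v)))) *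
    pointIndicator (y i) (π (V j (t i) v)) ∂Pr

theorem IsIndepRandomWalks.integral_dressed_mul [IsProbabilityMeasure Pr]
    (hV : IsIndepRandomWalks Pr V u) (j : ℤ)
    {n : ℕ} {t : Fin n → ℝ≥0} (ht : Monotone t) (y : Fin n → Y) (χ : Fin n → ℝ) (i : Fin n)
    {r : ℝ≥0} (hr : t i ≤ r) (g : Y → ℝ) {C : ℝ} (hg : ∀ y, |g y| ≤ C) :
    ∫ v, ((∏ l with l < i, (1 + χ l * pointIndicator (y l) (π (V j (t l) v)))) *
      pointIndicator (y i) (π (V j (t i) v))) * g (π (V j r v)) ∂Pr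
      = dressedMass π Pr V j t y χ i * walkOp π ((r : ℝ) - t i) g (y i) := by
  classical
  have := hV.markov j ht i hr π
    (fun x => ∏ l with l < i, (1 + χ l * pointIndicator (y l) (π (x l)))) (y i) g C hg
  have e : ∀ v, ∏ l with l < i, (1 + χ l * pointIndicator (y l) (π (V j (t (min l i)) v)))
      = ∏ l with l < i, (1 + χ l * pointIndicator (y l) (π (V j (t l) v))) := fun v =>
    Finset.prod_congr rfl fun l hl => by rw [min_eq_left (Finset.mem_filter.1 hl).2.le]
  simp_rw [e] at this
  unfold dressedMass
  exact this

/-- Expand the product according to the largest index i at which the χ-term is chosen. The factors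
before i are absorbed in `dressedMass`, those after i contribute 1, and the walk then runs freely
from y i to time r. For `g` the indicator of a point this is the renewal equation. -/
theorem IsIndepRandomWalks.integral_prod_one_add_mul [IsProbabilityMeasure Pr]
    (hV : IsIndepRandomWalks Pr V u) (j : ℤ)
    {n : ℕ} {t : Fin n → ℝ≥0} (ht : Monotone t) (y : Fin n → Y) (χ : Fin n → ℝ)
    (s : Finset (Fin n)) (hs : ∀ i ∈ s, ∀ l < i, l ∈ s)
    {r : ℝ≥0} (hr : ∀ i ∈ s, t i ≤ r) (g : Y → ℝ) {C : ℝ} (hg : ∀ y, |g y| ≤ C) :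
    ∫ v, (∏ l ∈ s, (1 + χ l * pointIndicator (y l) (π (V j (t l) v)))) * g (π (V j r v)) ∂Pr
      = walkOp π r g (π (u j)) + ∑ i ∈ s, dressedMass π Pr V j t y χ i *
        (χ i * walkOp π ((r : ℝ) - t i) g (y i)) := by
  have e : ∀ v, ∏ l ∈ s, (1 + χ l * pointIndicator (y l) (π (V j (t l) v)))
      = 1 + ∑ i ∈ s, χ i * pointIndicator (y i) (π (V j (t i) v)) *
        ∏ l ∈ s with l < i, (1 + χ l * pointIndicator (y l) (π (V j (t l) v))) :=
    fun v => Finset.prod_one_add_ordered _ _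
  simp_rw [e, add_mul, one_mul, Finset.sum_mul]
  have hint : ∀ i ∈ s, Integrable (fun v => χ i * pointIndicator (y i) (π (V j (t i) v)) *
      (∏ l ∈ s with l < i, (1 + χ l * pointIndicator (y l) (π (V j (t l) v)))) *
      g (π (V j r v))) Pr := fun i _ => by
    refine hV.integrable_mul_comp j r ?_ (fun x => g (π x)) (C := C) fun x => hg _
    have := hV.integrable_mul_comp j (t i) (hV.integrable_prod_one_add π j t y χ (s.filter (· < i)))
      (fun x => χ i * pointIndicator (y i) (π x)) (C := |χ i|) fun x => by
        rw [abs_mul]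
        exact mul_le_of_le_one_right (abs_nonneg _) (abs_pointIndicator_le _ _)
    simpa only [mul_comm] using this
  have hg0 : Integrable (fun v => g (π (V j r v))) Pr :=
    Integrable.of_bound ((Measurable.of_discrete (f := fun x : ℤ => g (π x))).comp
      (hV.measurable j r)).aestronglyMeasurable C (Eventually.of_forall fun v => hg _)
  rw [integral_add hg0 (integrable_finsetSum _ hint), integral_finsetSum _ hint,
    hV.integral_comp j r π g C hg]
  congr 1
  refine Finset.sum_congr rfl fun i hi => ?_
  have hfil : s.filter (· < i) = Finset.univ.filter (· < i) := by
    ext l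
    simp only [Finset.mem_filter, Finset.mem_univ, true_and, and_iff_right_iff_imp]
    exact hs i hi l
  rw [mul_left_comm, ← hV.integral_dressed_mul π j ht y χ i (hr i hi) g hg, ← integral_const_mul,
    hfil]
  congr 1; funext v; ring

/-- The weight is a product over walks; putting the factor of walk j into row j leaves a determinant
whose rows are independent. -/
theorem IsIndepRandomWalks.integral_weight_mul_det [IsProbabilityMeasure Pr]
    (hV : IsIndepRandomWalks Pr V u) {M : ℤ → Y → ℝ} {C : ℝ} (hM : ∀ k y, |M k y| ≤ C)
    (J : Finset ℤ) (T : ℝ≥0) {n : ℕ} (t : Fin n → ℝ≥0) (y : Fin n → Y) (χ : Fin n → ℝ)  :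
    Integrable (fun v => (∏ j : J, ∏ i, (1 + χ i * pointIndicator (y i) (π (V j (t i) v)))) *
      (Matrix.of fun j k : J => M k (π (V j T v))).det) Pr ∧
    ∫ v, (∏ j : J, ∏ i, (1 + χ i * pointIndicator (y i) (π (V j (t i) v)))) *
      (Matrix.of fun j k : J => M k (π (V j T v))).det ∂Pr
      = (Matrix.of fun j k : J => ∫ v, (∏ i, (1 + χ i * pointIndicator (y i) (π (V j (t i) v)))) *
          M k (π (V j T v)) ∂Pr).det := by
  have hX : iIndepFun (fun (j : J) (v : Ω) (s : ℝ≥0) => V j s v) Pr :=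
    hV.indep.precomp Subtype.val_injective
  have mX : ∀ j : J, Measurable (fun (v : Ω) (s : ℝ≥0) => V j s v) := fun j =>
    measurable_pi_lambda _ fun s => hV.measurable j s
  have hmi : ∀ i, Measurable fun x : ℝ≥0 → ℤ => 1 + χ i * pointIndicator (y i) (π (x (t i))) :=
    fun i => (Measurable.of_discrete (f := fun m : ℤ => 1 + χ i * pointIndicator (y i) (π m))).comp
      (measurable_pi_apply (t i))
  have := integral_det_of_iIndepFun hX mX
    (φ := fun j k x => (∏ i, (1 + χ i * pointIndicator (y i) (π (x (t i))))) * M k (π (x T)))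
    (fun j k => (Finset.measurable_fun_prod _ fun i _ => hmi i).mul
      ((Measurable.of_discrete (f := fun m : ℤ => M k (π m))).comp (measurable_pi_apply T)))
    (C := (∏ i, (1 + |χ i|)) * C) fun j k x => by
      rw [abs_mul, Finset.abs_prod]
      refine mul_le_mul (Finset.prod_le_prod (fun _ _ => abs_nonneg _) fun i _ => ?_) (hM _ _)
        (abs_nonneg _) (Finset.prod_nonneg fun i _ => by positivity)
      refine (abs_add_le _ _).trans ?_
      rw [abs_one, abs_mul]
      have := mul_le_mul_of_nonneg_left (abs_pointIndicator_le (y i) (π (x (t i)))) (abs_nonneg (χ i))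
      linarith
  have e : ∀ v, (∏ j : J, ∏ i, (1 + χ i * pointIndicator (y i) (π (V j (t i) v)))) *
      (Matrix.of fun j k : J => M k (π (V j T v))).det
      = (Matrix.of fun j k : J => (∏ i, (1 + χ i * pointIndicator (y i) (π (V j (t i) v)))) *
          M k (π (V j T v))).det := fun v => by
    rw [← Matrix.det_mul_column]; rfl
  simp_rw [e]
  exact this

/-- The one-walk expectations form the matrix 1 + cχW, the identity coming from `hMT`, and the
dressed masses satisfy c = U + cχP, where P propagates between earlier and later points. Eliminating
c gives det(1 + χ(WU - P)), whose entries are those of `walkKernel`. -/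
theorem IsIndepRandomWalks.generatingFunction_det [IsProbabilityMeasure Pr]
    (hV : IsIndepRandomWalks Pr V u) {M : ℤ → Y → ℝ} {C : ℝ} (hM : ∀ k y, |M k y| ≤ C)
    (J : Finset ℤ) (T : ℝ≥0) (hMT : ∀ j ∈ J, ∀ k ∈ J,
      walkOp π T (M k) (π (u j)) = if j = k then 1 else 0)
    {n : ℕ} {t : Fin n → ℝ≥0} (ht : Monotone t) (hT : ∀ i, t i ≤ T) (y : Fin n → Y)
    (hty : ∀ i i', t i = t i' → y i = y i' → i = i') (χ : Fin n → ℝ)  :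
    ∫ v, (∏ j : J, ∏ i, (1 + χ i * pointIndicator (y i) (π (V j (t i) v)))) *
      (Matrix.of fun j k : J => M k (π (V j T v))).det ∂Pr
      = ∑ A : Finset (Fin n), (∏ i ∈ A, χ i) *
        principalMinor (fun i i' => walkKernel π u M T J (t i, y i) (t i', y i')) A := by
  rw [(hV.integral_weight_mul_det π hM J T t y χ).2, ← det_one_add_diagonal_mul]
  set U : Matrix J (Fin n) ℝ := Matrix.of fun j i => walkOp π (t i) (pointIndicator (y i)) (π (u j))
  set c : Matrix J (Fin n) ℝ := Matrix.of fun j i => dressedMass π Pr V j t y χ i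
  set W : Matrix (Fin n) J ℝ := Matrix.of fun i k => walkOp π ((T : ℝ) - t i) (M k) (y i)
  set P : Matrix (Fin n) (Fin n) ℝ := Matrix.of fun l i =>
    if l < i then walkOp π ((t i : ℝ) - t l) (pointIndicator (y i)) (y l) else 0
  have hc : c = U + c * (Matrix.diagonal χ * P) := by
    ext j i
    rw [Matrix.add_apply, Matrix.mul_apply]
    simp only [Matrix.diagonal_mul, c, U, P, Matrix.of_apply]
    rw [dressedMass, hV.integral_prod_one_add_mul π j ht y χ _ ?_ ?_ (pointIndicator (y i))
      (abs_pointIndicator_le _)]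
    · congr 1
      rw [Finset.sum_filter]
      refine Finset.sum_congr rfl fun l _ => ?_
      split_ifs <;> simp
    · intro i' hi' l hl
      simp only [Finset.mem_filter, Finset.mem_univ, true_and] at hi' ⊢
      exact hl.trans hi'
    · intro i' hi'
      exact ht (Finset.mem_filter.1 hi').2.le
  have hP : ∀ i j, ¬ i < j → P i j = 0 := fun i j h => by simp [P, h]
  have hZ : (Matrix.of fun j k : J => ∫ v, (∏ i, (1 + χ i * pointIndicator (y i) (π (V j (t i) v)))) *
          M k (π (V j T v)) ∂Pr) = 1 + c * (Matrix.diagonal χ * W) := by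
    ext j k
    rw [Matrix.of_apply, hV.integral_prod_one_add_mul π j ht y χ Finset.univ (by simp)
      (fun i _ => hT i) (M k) (hM k), hMT j j.2 k k.2]
    rw [Matrix.add_apply, Matrix.mul_apply]
    simp only [Matrix.diagonal_mul, c, W, Matrix.one_apply, Subtype.ext_iff, Matrix.of_apply]
  rw [hZ, det_one_add_mul_of_renewal χ U c W P hP hc]
  congr 3
  ext i i'
  simp only [Matrix.sub_apply, Matrix.mul_apply, W, U, P, Matrix.of_apply, walkKernel]
  rw [← Finset.sum_coe_sort J]
  congr 1
  rcases lt_trichotomy (t i) (t i') with h | h | h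
  · have : i < i' := by
      by_contra hc; exact absurd (ht (not_lt.1 hc)) (not_le.2 h)
    simp [h, this]
  -- P is ordered by index but the kernel by time. At equal times they agree, because a walk does
  -- not pass between distinct points in time zero; this is where `hty` enters.
  · by_cases hi : i < i'
    · have hy : y i ≠ y i' := fun hy => hi.ne (hty i i' h hy)
      simp only [hi, h, if_true, lt_irrefl, if_false, sub_self, walkOp, walkProb_zero]
      rw [tsum_eq_single 0 fun m hm => by simp [hm]]
      simp [pointIndicator, hy]
    · simp [hi, h]
  · have : ¬ i < i' := fun hc => absurd (ht hc.le) (not_le.2 h)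
    simp [this, h.le]

end ManyWalks

/-! ### Occupation numbers of finitely many weighted walks -/

section WalkOccupation

theorem sum_powerset_map {ι X N : Type*} [AddCommMonoid N] (e : ι ↪ X) (s : Finset ι)
    (f : Finset X → N) : ∑ D ∈ (s.map e).powerset, f D = ∑ D ∈ s.powerset, f (D.map e) := by
  symm
  refine Finset.sum_nbij (fun D => D.map e) ?_ ?_ ?_ fun _ _ => rfl
  · intro D hD
    exact Finset.mem_powerset.2 (Finset.map_subset_map.2 (Finset.mem_powerset.1 hD))
  · exact (Finset.map_injective e).injOn
  · intro D hD
    obtain ⟨u, hu, rfl⟩ := Finset.subset_map_iff.1 (Finset.mem_powerset.1 (Finset.mem_coe.1 hD))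
    exact ⟨u, Finset.mem_coe.2 (Finset.mem_powerset.2 hu), rfl⟩

theorem occupationWeight_map {ι X : Type*} (e : ι ↪ X) (c : Finset X → ℝ) (S A : Finset ι) :
    occupationWeight c (S.map e) (A.map e) = occupationWeight (fun B => c (B.map e)) S A := by
  classical
  unfold occupationWeight
  have : S.map e \ A.map e = (S \ A).map e := by
    ext x
    simp only [Finset.mem_sdiff, Finset.mem_map]
    constructor
    · rintro ⟨⟨i, hi, rfl⟩, h⟩
      exact ⟨i, ⟨hi, fun hA => h ⟨i, hA, rfl⟩⟩, rfl⟩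
    · rintro ⟨i, ⟨hi, hA⟩, rfl⟩
      exact ⟨⟨i, hi, rfl⟩, fun ⟨i', hi', h⟩ => hA (e.injective h ▸ hi')⟩
  have h2 := sum_powerset_map e (S \ A) fun D => (-1) ^ D.card * c (A.map e ∪ D)
  rw [← this] at h2
  convert h2 using 3 with D
  · rw [Finset.card_map]
  · exact congrArg c (Finset.map_union _ _)

theorem exists_monotone_enum {Y : Type*} (S : Finset (ℝ≥0 × Y)) :
    ∃ (n : ℕ) (e : Fin n ↪ ℝ≥0 × Y), Finset.univ.map e = S ∧ Monotone fun i => (e i).1 := by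
  let f : Fin S.card ≃ S := S.equivFin.symm
  let σ := Tuple.sort fun i => (f i).1.1
  refine ⟨S.card, ((σ.trans f).toEmbedding).trans (Function.Embedding.subtype _), ?_, ?_⟩
  · ext p
    simp only [Finset.mem_map, Finset.mem_univ, true_and]
    constructor
    · rintro ⟨i, rfl⟩
      exact (f (σ i)).2
    · intro hp
      exact ⟨σ.symm (f.symm ⟨p, hp⟩), by simp⟩
  · exact Tuple.monotone_sort fun i => (f i).1.1

open Classical in
/-- The number of walks with label in `J` that visit the space-time point `p`. -/
noncomputable def walkOcc {Ω Y : Type*} [AddCommGroup Y] (π : ℤ →+ Y) (V : ℤ → ℝ≥0 → Ω → ℤ)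
    (J : Finset ℤ) (p : ℝ≥0 × Y) (v : Ω) : ℕ :=
  (J.filter fun j => π (V j p.1 v) = p.2).card

theorem prod_pow_walkOcc {Ω Y : Type*} [AddCommGroup Y] (π : ℤ →+ Y) (V : ℤ → ℝ≥0 → Ω → ℤ)
    (J : Finset ℤ) {n : ℕ} (p : Fin n → ℝ≥0 × Y) (z : Fin n → ℝ) (v : Ω) :
    ∏ i, z i ^ walkOcc π V J (p i) v
      = ∏ j : J, ∏ i, (1 + (z i - 1) * pointIndicator (p i).2 (π (V j (p i).1 v))) := by
  rw [Finset.prod_comm]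
  refine Finset.prod_congr rfl fun i _ => ?_
  rw [Finset.prod_coe_sort J fun j => 1 + (z i - 1) * pointIndicator (p i).2 (π (V j (p i).1 v)),
    walkOcc, ← Finset.prod_const, Finset.prod_filter]
  refine Finset.prod_congr rfl fun j _ => ?_
  unfold pointIndicator
  split_ifs <;> simp

variable {Ω : Type*} [MeasurableSpace Ω] {Pr : Measure Ω}
  {V : ℤ → ℝ≥0 → Ω → ℤ} {u : ℤ → ℤ} {Y : Type*} [AddCommGroup Y] (π : ℤ →+ Y)

theorem IsIndepRandomWalks.measurable_walkOcc (hV : IsIndepRandomWalks Pr V u) (J : Finset ℤ)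
    (p : ℝ≥0 × Y) : Measurable (walkOcc π V J p) := by
  classical
  have : walkOcc π V J p = fun v => ∑ j ∈ J, if π (V j p.1 v) = p.2 then 1 else 0 := by
    funext v
    rw [walkOcc, Finset.card_filter]
  rw [this]
  exact Finset.measurable_fun_sum _ fun j _ =>
    (Measurable.of_discrete (f := fun x : ℤ => if π x = p.2 then (1 : ℕ) else 0)).comp
      (hV.measurable j p.1)

/-- Under the determinantal weight, every functional of the occupation numbers is a sum over
configurations without multiple points. -/
theorem IsIndepRandomWalks.integral_walkOcc_mul_det [IsProbabilityMeasure Pr]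
    (hV : IsIndepRandomWalks Pr V u) {M : ℤ → Y → ℝ} {C : ℝ} (hM : ∀ k y, |M k y| ≤ C)
    (J : Finset ℤ) (T : ℝ≥0) (hMT : ∀ j ∈ J, ∀ k ∈ J,
      walkOp π T (M k) (π (u j)) = if j = k then 1 else 0)
    (S : Finset (ℝ≥0 × Y)) (hS : ∀ p ∈ S, p.1 ≤ T) (g : (ℝ≥0 × Y → ℕ) → ℝ) :
    ∫ v, g (truncConfig S fun p => walkOcc π V J p v) *
      (Matrix.of fun j k : J => M k (π (V j T v))).det ∂Pr
      = ∑ A ∈ S.powerset, occupationWeight (principalMinor (walkKernel π u M T J)) S A *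
        g (finsetConfig A) := by
  classical
  obtain ⟨n, e, he, hmono⟩ := exists_monotone_enum S
  have hmem : ∀ i, e i ∈ S := fun i => by
    rw [← he]; exact Finset.mem_map_of_mem e (Finset.mem_univ i)
  have hD : Integrable (fun v => (Matrix.of fun j k : J => M k (π (V j T v))).det) Pr := by
    simpa using (hV.integral_weight_mul_det π hM J T (fun i => (e i).1) (fun i => (e i).2)
      fun _ => 0).1
  have h := integral_comp_mul_of_generatingFunction (μ := Pr)
    (n := fun i => walkOcc π V J (e i)) (fun i => hV.measurable_walkOcc π J _) (M := J.card)
    (fun i v => Finset.card_filter_le _ _) hD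
    (c := principalMinor (fun i i' => walkKernel π u M T J (e i) (e i'))) (fun z => by
      have := hV.generatingFunction_det π hM J T hMT (t := fun i => (e i).1) hmono
        (fun i => hS _ (hmem i)) (fun i => (e i).2)
        (fun i i' h1 h2 => e.injective (Prod.ext h1 h2)) (fun i => z i - 1)
      rw [← this]
      congr 1; funext v
      rw [prod_pow_walkOcc π V J e z v])
    -- Occupation numbers are listed by `Fin n` in order of time; extension by zero turns the list
    -- back into a configuration on space-time supported in `S`.
    (fun m => g (Function.extend e m 0))
  have e1 : ∀ v, Function.extend e (fun i => walkOcc π V J (e i) v) 0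
      = truncConfig S fun p => walkOcc π V J p v := fun v => by
    funext p
    by_cases hp : ∃ i, e i = p
    · obtain ⟨i, rfl⟩ := hp
      rw [e.injective.extend_apply]
      simp [truncConfig, hmem i]
    · have : p ∉ S := by
        rw [← he, Finset.mem_map]
        rintro ⟨i, -, hi⟩
        exact hp ⟨i, hi⟩
      rw [Function.extend_apply' _ _ _ hp]
      simp [truncConfig, this]
  have e2 : ∀ A : Finset (Fin n), Function.extend e (finsetConfig A) 0
      = finsetConfig (A.map e) := fun A => by
    funext p
    by_cases hp : ∃ i, e i = p
    · obtain ⟨i, rfl⟩ := hp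
      rw [e.injective.extend_apply]
      simp [finsetConfig]
    · have : p ∉ A.map e := by
        rw [Finset.mem_map]
        rintro ⟨i, -, hi⟩
        exact hp ⟨i, hi⟩
      rw [Function.extend_apply' _ _ _ hp]
      simp only [finsetConfig, this, if_false, Pi.zero_apply]
  simp_rw [e1, e2] at h
  rw [h]
  conv_rhs => rw [← he, sum_powerset_map e, Finset.powerset_univ]
  refine Finset.sum_congr rfl fun A _ => ?_
  rw [occupationWeight_map]
  congr 2
  funext B
  exact (principalMinor_map _ e B).symm

end WalkOccupation

/-! ### The semigroup of several independent walks on a discrete circle -/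

section VectorMarkov

variable {Ω : Type*} [MeasurableSpace Ω] {Pr : Measure Ω}
  {V : ℤ → ℝ≥0 → Ω → ℤ} {u : ℤ → ℤ} {Y : Type*} [AddCommGroup Y] [Fintype Y] (π : ℤ →+ Y)
  {ι : Type*} [Fintype ι] [DecidableEq ι]

/-- The transition operator of independent walks on a finite group. -/
noncomputable def vecOp (τ : ℝ) (f : (ι → Y) → ℝ) (x : ι → Y) : ℝ :=
  ∑ y : ι → Y, f y * ∏ i, walkOp π τ (pointIndicator (y i)) (x i)

theorem prod_pointIndicator {κ Z : Type*} [Fintype κ] [DecidableEq (κ → Z)] (z z' : κ → Z) :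
    ∏ i, pointIndicator (z i) (z' i) = if z' = z then 1 else 0 := by
  unfold pointIndicator
  split_ifs with h
  · subst h; simp
  · obtain ⟨i, hi⟩ := Function.ne_iff.1 h
    exact Finset.prod_eq_zero (Finset.mem_univ i) (by simp [hi])

theorem sum_mul_prod_pointIndicator {κ Z : Type*} [Fintype κ] [Fintype (κ → Z)] (f : (κ → Z) → ℝ)
    (z' : κ → Z) : ∑ z : κ → Z, f z * ∏ i, pointIndicator (z i) (z' i) = f z' := by
  classical
  simp_rw [prod_pointIndicator]
  simp

/-- On a finite group there are finitely many joint trajectories at the given times. For each of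
them the event factorises over the independent walks, the one-walk Markov property applies to each
factor, and summation restores general functionals. -/
theorem IsIndepRandomWalks.vector_markov [IsProbabilityMeasure Pr]
    (hV : IsIndepRandomWalks Pr V u)
    {lab : ι → ℤ} (hlab : Function.Injective lab) {k : ℕ} {t : Fin (k + 1) → ℝ≥0} (ht : Monotone t)
    {r : ℝ≥0} (hr : t (Fin.last k) ≤ r) (G : (Fin (k + 1) → ι → Y) → ℝ) (f : (ι → Y) → ℝ) :
    ∫ v, G (fun l i => π (V (lab i) (t l) v)) * f (fun i => π (V (lab i) r v)) ∂Pr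
      = ∫ v, G (fun l i => π (V (lab i) (t l) v)) *
        vecOp π ((r : ℝ) - t (Fin.last k)) f (fun i => π (V (lab i) (t (Fin.last k)) v)) ∂Pr := by
  classical
  have hX : iIndepFun (fun (i : ι) (v : Ω) (s : ℝ≥0) => V (lab i) s v) Pr := hV.indep.precomp hlab
  have mX : ∀ i : ι, Measurable (fun (v : Ω) (s : ℝ≥0) => V (lab i) s v) := fun i =>
    measurable_pi_lambda _ fun s => hV.measurable _ s
  have mI : ∀ (y : Y) (s : ℝ≥0), Measurable fun x : ℝ≥0 → ℤ => pointIndicator y (π (x s)) :=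
    fun y s => (Measurable.of_discrete (f := fun m : ℤ => pointIndicator y (π m))).comp
      (measurable_pi_apply s)
  let a : (Fin (k + 1) → ι → Y) → ι → (ℝ≥0 → ℤ) → ℝ := fun p i x =>
    ∏ l, pointIndicator (p l i) (π (x (t l)))
  have ma : ∀ p i, Measurable (a p i) := fun p i =>
    Finset.measurable_fun_prod _ fun l _ => mI _ _
  have habs : ∀ p i x, |a p i x| ≤ 1 := fun p i x => by
    rw [Finset.abs_prod]
    exact Finset.prod_le_one (fun _ _ => abs_nonneg _) fun _ _ => abs_pointIndicator_le _ _
  have hG : ∀ (Φ : (Fin (k + 1) → ι → Y) → ℝ) v, Φ (fun l i => π (V (lab i) (t l) v))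
      = ∑ p, Φ p * ∏ i, a p i (fun s => V (lab i) s v) := fun Φ v => by
    have e : ∀ p, ∏ i, a p i (fun s => V (lab i) s v)
        = ∏ l, if (fun i => π (V (lab i) (t l) v)) = p l then 1 else 0 := fun p => by
      simp only [a]
      rw [Finset.prod_comm]
      exact Finset.prod_congr rfl fun l _ => prod_pointIndicator (p l) _
    have e2 : ∀ p, ∏ i, a p i (fun s => V (lab i) s v)
        = ∏ l, pointIndicator (p l) (fun i => π (V (lab i) (t l) v)) := fun p => by
      rw [e]
      refine Finset.prod_congr rfl fun l _ => ?_
      unfold pointIndicator; congr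
    simp_rw [e2]
    exact (sum_mul_prod_pointIndicator Φ _).symm
  have h1 : ∀ p, ∫ v, ∏ i, a p i (fun s => V (lab i) s v) ∂Pr
      = ∏ i, ∫ v, a p i (fun s => V (lab i) s v) ∂Pr := fun p =>
    hX.integral_fun_prod_comp (fun i => (mX i).aemeasurable) fun i => (ma p i).aestronglyMeasurable
  have h2 : ∀ p (y : ι → Y), ∫ v, (∏ i, a p i (fun s => V (lab i) s v)) *
      ∏ i, pointIndicator (y i) (π (V (lab i) r v)) ∂Pr
      = (∫ v, ∏ i, a p i (fun s => V (lab i) s v) ∂Pr) *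
        ∏ i, walkOp π ((r : ℝ) - t (Fin.last k)) (pointIndicator (y i)) (p (Fin.last k) i) := by
    intro p y
    simp_rw [← Finset.prod_mul_distrib]
    rw [hX.integral_fun_prod_comp
      (f := fun i x => a p i x * pointIndicator (y i) (π (x r)))
      (fun i => (mX i).aemeasurable) fun i => ((ma p i).mul (mI _ _)).aestronglyMeasurable,
      h1, ← Finset.prod_mul_distrib]
    refine Finset.prod_congr rfl fun i _ => ?_
    have := hV.markov (lab i) ht (Fin.last k) hr π
      (fun x => ∏ l, pointIndicator (p l i) (π (x l))) (p (Fin.last k) i) (pointIndicator (y i)) 1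
      (abs_pointIndicator_le _)
    have hmin : ∀ l, min l (Fin.last k) = l := fun l => min_eq_left (Fin.le_last l)
    simp_rw [hmin] at this
    have e : ∀ v, (∏ l, pointIndicator (p l i) (π (V (lab i) (t l) v))) *
        (if π (V (lab i) (t (Fin.last k)) v) = p (Fin.last k) i then 1 else 0)
        = ∏ l, pointIndicator (p l i) (π (V (lab i) (t l) v)) := fun v => by
      split_ifs with h
      · rw [mul_one]
      · rw [mul_zero]
        exact (Finset.prod_eq_zero (Finset.mem_univ (Fin.last k)) (by simp [pointIndicator, h])).symm
    simp_rw [e] at this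
    exact this
  have hi1 : ∀ p, Integrable (fun v => ∏ i, a p i (fun s => V (lab i) s v)) Pr := fun p => by
    refine Integrable.of_bound (Finset.measurable_fun_prod _ fun i _ =>
      (ma p i).comp (mX i)).aestronglyMeasurable 1 (Eventually.of_forall fun v => ?_)
    rw [Real.norm_eq_abs, Finset.abs_prod]
    exact Finset.prod_le_one (fun _ _ => abs_nonneg _) fun i _ => habs p i fun s => V (lab i) s v
  have hi2 : ∀ p (y : ι → Y), Integrable (fun v => (∏ i, a p i (fun s => V (lab i) s v)) *
      ∏ i, pointIndicator (y i) (π (V (lab i) r v))) Pr := fun p y => by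
    refine (hi1 p).mul_bdd (c := 1) (Finset.measurable_fun_prod _ fun i _ =>
      (mI _ _).comp (mX i)).aestronglyMeasurable (Eventually.of_forall fun v => ?_)
    rw [Real.norm_eq_abs, Finset.abs_prod]
    exact Finset.prod_le_one (fun _ _ => abs_nonneg _) fun _ _ => abs_pointIndicator_le _ _
  have hl : ∀ v, G (fun l i => π (V (lab i) (t l) v)) * f (fun i => π (V (lab i) r v))
      = ∑ p, ∑ y : ι → Y, G p * f y * ((∏ i, a p i (fun s => V (lab i) s v)) *
        ∏ i, pointIndicator (y i) (π (V (lab i) r v))) := fun v => by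
    rw [hG G v, ← sum_mul_prod_pointIndicator f, Finset.sum_mul_sum]
    exact Finset.sum_congr rfl fun _ _ => Finset.sum_congr rfl fun _ _ => by ring
  simp_rw [hl]
  rw [integral_finsetSum _ fun p _ => integrable_finsetSum _ fun y _ => (hi2 p y).const_mul _]
  have hr2 := fun v => hG (fun p => G p * vecOp π ((r : ℝ) - t (Fin.last k)) f (p (Fin.last k))) v
  simp only at hr2
  simp_rw [hr2]
  rw [integral_finsetSum _ fun p _ => (hi1 p).const_mul _]
  refine Finset.sum_congr rfl fun p _ => ?_
  rw [integral_finsetSum _ fun y _ => (hi2 p y).const_mul _, integral_const_mul, vecOp,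
    Finset.mul_sum, Finset.sum_mul]
  refine Finset.sum_congr rfl fun y _ => ?_
  rw [integral_const_mul, h2]
  ring

end VectorMarkov

/-! ### The semigroup as a power series in unit jumps -/

section CircleSemigroup

variable {Y : Type*} [AddCommGroup Y] (π : ℤ →+ Y) {ι : Type*} [Fintype ι] [DecidableEq ι]

/-- Sum over all moves of a single walk by a unit step. -/
def hop {R : Type*} [AddCommMonoid R] (f : (ι → Y) → R) (x : ι → Y) : R :=
  ∑ i, (f (x + Pi.single i (π 1)) + f (x - Pi.single i (π 1)))

theorem hop_iterate_ofReal (f : (ι → Y) → ℝ) (n : ℕ) (x : ι → Y) :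
    (hop π)^[n] (fun y => (f y : ℂ)) x = (((hop π)^[n] f x : ℝ) : ℂ) := by
  induction n generalizing f with
  | zero => rfl
  | succ n ih =>
    have e : (hop π fun y => (f y : ℂ)) = fun y => ((hop π f y : ℝ) : ℂ) := by
      funext y
      simp [hop]
    rw [Function.iterate_succ_apply, Function.iterate_succ_apply, e, ih]

theorem hop_iterate_add (f g : (ι → Y) → ℂ) (n : ℕ) :
    (hop π)^[n] (f + g) = (hop π)^[n] f + (hop π)^[n] g := by
  induction n generalizing f g with
  | zero => rfl
  | succ n ih =>
    rw [Function.iterate_succ_apply, Function.iterate_succ_apply, Function.iterate_succ_apply, ← ih]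
    congr 1
    funext y
    simp only [hop, Pi.add_apply, ← Finset.sum_add_distrib]
    exact Finset.sum_congr rfl fun i _ => by ring

theorem hop_iterate_smul (c : ℂ) (f : (ι → Y) → ℂ) (n : ℕ) :
    (hop π)^[n] (c • f) = c • (hop π)^[n] f := by
  induction n generalizing f with
  | zero => rfl
  | succ n ih =>
    rw [Function.iterate_succ_apply, Function.iterate_succ_apply, ← ih]
    congr 1
    funext y
    simp only [hop, Pi.smul_apply, smul_eq_mul, Finset.mul_sum, mul_add]

theorem hop_addChar (ψ : AddChar (ι → Y) ℂ) :
    hop π (ψ : (ι → Y) → ℂ)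
      = (∑ i, (ψ (Pi.single i (π 1)) + (ψ (Pi.single i (π 1)))⁻¹)) • (ψ : (ι → Y) → ℂ) := by
  funext x
  simp only [hop, Pi.smul_apply, smul_eq_mul, Finset.sum_mul]
  refine Finset.sum_congr rfl fun i _ => ?_
  rw [AddChar.map_add_eq_mul, sub_eq_add_neg, AddChar.map_add_eq_mul, AddChar.map_neg_eq_inv]
  ring

theorem AddChar.apply_ne_zero {A : Type*} [AddCommGroup A] (φ : AddChar A ℂ) (x : A) : φ x ≠ 0 := by
  intro h
  have := φ.map_add_eq_mul x (-x)
  rw [add_neg_cancel, AddChar.map_zero_eq_one, h, zero_mul] at this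
  exact one_ne_zero this

theorem AddChar.apply_eq_prod_single {ι Y : Type*} [Fintype ι] [DecidableEq ι] [AddCommGroup Y]
    (ψ : AddChar (ι → Y) ℂ) (y : ι → Y) : ψ y = ∏ i, ψ (Pi.single i (y i)) := by
  have h : ∀ s : Finset ι, ψ (∑ i ∈ s, Pi.single i (y i)) = ∏ i ∈ s, ψ (Pi.single i (y i)) := by
    intro s
    induction s using Finset.induction_on with
    | empty => simp
    | insert i s hi ih => rw [Finset.sum_insert hi, Finset.prod_insert hi, ψ.map_add_eq_mul, ih]
  rw [← h, Finset.univ_sum_single]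

theorem sum_addChar_mul_walkOp [Fintype Y] {τ : ℝ} (hτ : 0 ≤ τ) (φ : AddChar Y ℂ) (x : Y) :
    ∑ y : Y, φ y * (walkOp π τ (pointIndicator y) x : ℂ)
      = Complex.exp (-τ) * Complex.exp ((τ / 2 : ℂ) * (φ (π 1) + (φ (π 1))⁻¹)) * φ x := by
  classical
  have hw : φ (π 1) ≠ 0 := φ.apply_ne_zero _
  have h1 : HasSum (fun n : ℤ => ∑ y : Y, φ y * ((walkProb τ n * pointIndicator y (x + π n) : ℝ) : ℂ))
      (∑ y : Y, φ y * (walkOp π τ (pointIndicator y) x : ℂ)) := by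
    refine hasSum_sum fun y _ => HasSum.mul_left _ (Complex.hasSum_ofReal.2 ?_)
    exact (summable_walkProb_mul hτ (C := 1) fun n => abs_pointIndicator_le _ _).hasSum
  have h2 := ((hasSum_besselI_mul_zpow τ (φ (π 1)) hw).mul_left (Complex.exp (-τ))).mul_right (φ x)
  rw [← Complex.exp_add, ← mul_add] at h2
  refine h1.unique ?_
  have h3 : (fun n : ℤ => ∑ y : Y, φ y * ((walkProb τ n * pointIndicator y (x + π n) : ℝ) : ℂ))
      = fun n : ℤ => Complex.exp (-τ) * ((besselI n.natAbs τ : ℂ) * φ (π 1) ^ n) * φ x := by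
    funext n
    have e : φ (x + π n) = φ x * φ (π 1) ^ n := by
      rw [AddChar.map_add_eq_mul, ← AddChar.map_zsmul_eq_zpow, ← map_zsmul, smul_eq_mul, mul_one]
    rw [Finset.sum_eq_single (x + π n)]
    · rw [e]
      simp only [pointIndicator, if_true, mul_one, walkProb]
      push_cast
      ring
    · intro y _ hy
      simp [pointIndicator, hy.symm]
    · simp
  rw [h3]
  convert h2 using 1

/-- The generator of the walks is hop/2 minus the number of walks, so e^{τ·card} times the semigroup
is exp((τ/2) hop). Both sides are linear in f and the characters, which span, are joint
eigenfunctions with equal eigenvalues. The gain is that all coefficients are nonnegative, so cones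
stable under `hop` are stable under the semigroup. -/
theorem hasSum_hop_iterate [Fintype Y] {τ : ℝ} (hτ : 0 ≤ τ) (f : (ι → Y) → ℝ) (x : ι → Y) :
    HasSum (fun n : ℕ => (τ / 2) ^ n / (n.factorial : ℝ) * (hop π)^[n] f x)
      (Real.exp τ ^ Fintype.card ι * vecOp π τ f x) := by
  have key : ∀ f : (ι → Y) → ℂ, HasSum
      (fun n : ℕ => ((τ / 2 : ℂ)) ^ n / (n.factorial : ℂ) * (hop π)^[n] f x)
      (Complex.exp τ ^ Fintype.card ι *
        ∑ y : ι → Y, f y * ∏ i, (walkOp π τ (pointIndicator (y i)) (x i) : ℂ)) := by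
    intro f
    have hf : f ∈ Submodule.span ℂ (Set.range (AddChar.complexBasis (ι → Y))) := by
      rw [Module.Basis.span_eq]; trivial
    induction hf using Submodule.span_induction with
    | mem f hf =>
      obtain ⟨ψ, rfl⟩ := hf
      rw [AddChar.complexBasis_apply]
      set w : ι → ℂ := fun i => ψ (Pi.single i (π 1))
      have hit : ∀ n : ℕ, (hop π)^[n] (ψ : (ι → Y) → ℂ)
          = ((∑ i, (w i + (w i)⁻¹)) ^ n) • (ψ : (ι → Y) → ℂ) := by
        intro n
        induction n with
        | zero => simp
        | succ n ih =>
          rw [Function.iterate_succ_apply, hop_addChar, hop_iterate_smul, ih, smul_smul, pow_succ']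
      have hsum : ∑ y : ι → Y, ψ y * ∏ i, (walkOp π τ (pointIndicator (y i)) (x i) : ℂ)
          = Complex.exp (-τ) ^ Fintype.card ι *
            Complex.exp ((τ / 2 : ℂ) * ∑ i, (w i + (w i)⁻¹)) * ψ x := by
        rw [Finset.sum_congr rfl fun y _ => by
          rw [ψ.apply_eq_prod_single y, ← Finset.prod_mul_distrib], ψ.apply_eq_prod_single x]
        have hps := (Finset.prod_univ_sum (fun _ : ι => (Finset.univ : Finset Y)) fun i y =>
          ψ (Pi.single i y) * (walkOp π τ (pointIndicator y) (x i) : ℂ))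
        rw [Fintype.piFinset_univ] at hps
        rw [← hps]
        have h1 : ∀ i, ∑ y : Y, ψ (Pi.single i y) * (walkOp π τ (pointIndicator y) (x i) : ℂ)
            = Complex.exp (-τ) * Complex.exp ((τ / 2 : ℂ) * (w i + (w i)⁻¹)) *
              ψ (Pi.single i (x i)) := fun i =>
          sum_addChar_mul_walkOp π hτ (ψ.compAddMonoidHom (AddMonoidHom.single (fun _ => Y) i)) (x i)
        simp_rw [h1, Finset.prod_mul_distrib]
        rw [Finset.prod_const, Finset.card_univ, ← Complex.exp_sum, ← Finset.mul_sum]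
      simp_rw [hit, Pi.smul_apply, smul_eq_mul]
      rw [hsum]
      have he : Complex.exp τ ^ Fintype.card ι * (Complex.exp (-τ) ^ Fintype.card ι *
            Complex.exp ((τ / 2 : ℂ) * ∑ i, (w i + (w i)⁻¹)) * ψ x)
          = Complex.exp ((τ / 2 : ℂ) * ∑ i, (w i + (w i)⁻¹)) * ψ x := by
        rw [← mul_assoc, ← mul_assoc, ← mul_pow, ← Complex.exp_add]; simp
      rw [he]
      have h := (NormedSpace.expSeries_div_hasSum_exp
        ((τ / 2 : ℂ) * ∑ i, (w i + (w i)⁻¹))).mul_right (ψ x)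
      rw [← Complex.exp_eq_exp_ℂ] at h
      refine Eq.mp (congrArg (HasSum · _) (funext fun n => ?_)) h
      rw [mul_pow]; ring
    | zero =>
      have : ∀ n : ℕ, (hop π)^[n] (0 : (ι → Y) → ℂ) = 0 := fun n => by
        have := hop_iterate_smul π (0 : ℂ) (0 : (ι → Y) → ℂ) n
        simpa using this
      simp [this, hasSum_zero]
    | add f g _ _ hf hg =>
      have e : ∀ n : ℕ, (τ / 2 : ℂ) ^ n / (n.factorial : ℂ) * (hop π)^[n] (f + g) x
          = (τ / 2 : ℂ) ^ n / (n.factorial : ℂ) * (hop π)^[n] f x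
            + (τ / 2 : ℂ) ^ n / (n.factorial : ℂ) * (hop π)^[n] g x := fun n => by
        rw [hop_iterate_add, Pi.add_apply, mul_add]
      simp_rw [e, Pi.add_apply, add_mul, Finset.sum_add_distrib, mul_add]
      exact hf.add hg
    | smul c f _ hf =>
      have e : ∀ n : ℕ, (τ / 2 : ℂ) ^ n / (n.factorial : ℂ) * (hop π)^[n] (c • f) x
          = c * ((τ / 2 : ℂ) ^ n / (n.factorial : ℂ) * (hop π)^[n] f x) := fun n => by
        rw [hop_iterate_smul, Pi.smul_apply, smul_eq_mul]; ring
      simp_rw [e, Pi.smul_apply, smul_eq_mul, mul_assoc, ← Finset.mul_sum, mul_left_comm _ c]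
      exact hf.mul_left c
  have h := key fun y => (f y : ℂ)
  simp_rw [hop_iterate_ofReal] at h
  refine Complex.hasSum_ofReal.1 ?_
  unfold vecOp
  push_cast
  exact h

end CircleSemigroup

/-! ### Positivity of the Vandermonde-weighted walks -/

section Cone

set_option linter.unusedSectionVars false

variable {Ω : Type*} [MeasurableSpace Ω] {Pr : Measure Ω}
  {V : ℤ → ℝ≥0 → Ω → ℤ} {u : ℤ → ℤ} {Y : Type*} [AddCommGroup Y] (π : ℤ →+ Y)
  {ι : Type*} [Fintype ι] [DecidableEq ι]

/-- `s` is the sign function of a chamber decomposition of the configuration space of labelled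
particles, whose walls cannot be crossed by unit steps. -/
structure IsChamberSign (s : (ι → Y) → ℝ) : Prop where
  swap : ∀ x i j, i ≠ j → s (x ∘ Equiv.swap i j) = -s x
  eq_zero : ∀ x, s x = 0 → ¬ Function.Injective x
  add_single : ∀ x i, 0 ≤ s x * s (x + Pi.single i (π 1))
  sub_single : ∀ x i, 0 ≤ s x * s (x - Pi.single i (π 1))

/-- The antisymmetric functions with the sign of `s`. -/
structure InChamberCone (s f : (ι → Y) → ℝ) : Prop where
  swap : ∀ x i j, i ≠ j → f (x ∘ Equiv.swap i j) = -f x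
  nonneg : ∀ x, 0 ≤ f x * s x

variable {π} {s f : (ι → Y) → ℝ}

theorem InChamberCone.eq_zero (hf : InChamberCone s f) {x : ι → Y}
    (hx : ¬ Function.Injective x) : f x = 0 := by
  simp only [Function.Injective, not_forall] at hx
  obtain ⟨i, j, h, hij⟩ := hx
  have e : x ∘ Equiv.swap i j = x := by
    funext k
    simp only [Function.comp_apply, Equiv.swap_apply_def]
    split_ifs with h1 h2
    · rw [h1, h]
    · rw [h2, h]
    · rfl
  have := hf.swap x i j hij
  rw [e] at this
  linarith

theorem InChamberCone.symm_mul (hf : InChamberCone s f) {F : (ι → Y) → ℝ}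
    (hF : ∀ x (σ : Equiv.Perm ι), F (x ∘ σ) = F x) (hF0 : ∀ x, 0 ≤ F x) :
    InChamberCone s fun x => F x * f x where
  swap x i j hij := by simp only [hF, hf.swap x i j hij, mul_neg]
  nonneg x := by
    rw [mul_assoc]
    exact mul_nonneg (hF0 x) (hf.nonneg x)

theorem comp_add_single (σ : Equiv.Perm ι) (x : ι → Y) (i : ι) (c : Y) :
    (x + Pi.single (σ i) c) ∘ σ = x ∘ σ + Pi.single i c := by
  funext k
  simp [Pi.single_apply, σ.injective.eq_iff]

theorem comp_sub_single (σ : Equiv.Perm ι) (x : ι → Y) (i : ι) (c : Y) :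
    (x - Pi.single (σ i) c) ∘ σ = x ∘ σ - Pi.single i c := by
  funext k
  simp [Pi.single_apply, σ.injective.eq_iff]

/-- At a neighbour y of x, either s(y) = 0, so that y has a coincidence and f(y) = 0 by
antisymmetry, or s(y) does not have the sign opposite to s(x). Every summand of the hop sum then has
the right sign. -/
theorem InChamberCone.hop (hs : IsChamberSign π s) (hf : InChamberCone s f) :
    InChamberCone s (hop π f) where
  swap x i j hij := by
    unfold _root_.hop
    rw [← Equiv.sum_comp (Equiv.swap i j) fun k => f (x + _) + f (x - _), ← Finset.sum_neg_distrib]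
    refine Finset.sum_congr rfl fun k _ => ?_
    rw [← comp_add_single, ← comp_sub_single, hf.swap _ i j hij, hf.swap _ i j hij]
    ring
  nonneg x := by
    have key : ∀ y, 0 ≤ s x * s y → 0 ≤ f y * s x := fun y hy => by
      rcases eq_or_ne (s y) 0 with h0 | h0
      · rw [hf.eq_zero (hs.eq_zero y h0), zero_mul]
      · have h1 := mul_nonneg (hf.nonneg y) hy
        have h2 : f y * s y * (s x * s y) = (f y * s x) * (s y) ^ 2 := by ring
        rw [h2] at h1
        exact nonneg_of_mul_nonneg_left h1 (by positivity)
    unfold _root_.hop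
    rw [Finset.sum_mul]
    refine Finset.sum_nonneg fun i _ => ?_
    rw [add_mul]
    exact add_nonneg (key _ (hs.add_single x i)) (key _ (hs.sub_single x i))

theorem InChamberCone.hop_iterate (hs : IsChamberSign π s) (hf : InChamberCone s f) (n : ℕ) :
    InChamberCone s ((_root_.hop π)^[n] f) := by
  induction n with
  | zero => exact hf
  | succ n ih =>
    rw [Function.iterate_succ_apply']
    exact ih.hop hs

theorem InChamberCone.vecOp [Fintype Y] (hs : IsChamberSign π s) (hf : InChamberCone s f) {τ : ℝ}
    (hτ : 0 ≤ τ) : InChamberCone s (vecOp π τ f) where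
  swap x i j hij := by
    have h1 := hasSum_hop_iterate π hτ f (x ∘ Equiv.swap i j)
    have h2 := (hasSum_hop_iterate π hτ f x).neg
    simp_rw [(hf.hop_iterate hs _).swap x i j hij, mul_neg] at h1
    have h3 := h1.unique h2
    have : Real.exp τ ^ Fintype.card ι ≠ 0 := by positivity
    rw [← mul_neg] at h3
    exact mul_left_cancel₀ this h3
  nonneg x := by
    have h1 := (hasSum_hop_iterate π hτ f x).mul_right (s x)
    have h2 : 0 ≤ Real.exp τ ^ Fintype.card ι * (_root_.vecOp π τ f x * s x) := by
      rw [← mul_assoc]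
      refine h1.nonneg fun n => ?_
      rw [mul_assoc]
      exact mul_nonneg (by have := div_nonneg hτ zero_le_two; positivity) ((hf.hop_iterate hs n).nonneg x)
    exact nonneg_of_mul_nonneg_right h2 (by positivity)

/-- Integrate backwards in time. The Markov property replaces f by its image under the semigroup,
which stays in the cone, as does its product with a symmetric nonnegative F. At time 0 what remains
is a cone function at the starting point, where s > 0. -/
theorem IsIndepRandomWalks.integral_prod_mul_nonneg [Fintype Y] [IsProbabilityMeasure Pr]
    (hV : IsIndepRandomWalks Pr V u) {lab : ι → ℤ} (hlab : Function.Injective lab)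
    (hs : IsChamberSign π s) (hu : 0 < s fun i => π (u (lab i))) :
    ∀ {k : ℕ} {t : Fin k → ℝ≥0} (_ : Monotone t) {r : ℝ≥0} (_ : ∀ i, t i ≤ r)
      {F : Fin k → (ι → Y) → ℝ} (_ : ∀ l x (σ : Equiv.Perm ι), F l (x ∘ σ) = F l x)
      (_ : ∀ l x, 0 ≤ F l x) {f : (ι → Y) → ℝ} (_ : InChamberCone s f),
      0 ≤ ∫ v, (∏ l, F l fun i => π (V (lab i) (t l) v)) * f (fun i => π (V (lab i) r v)) ∂Pr := by
  intro k
  induction k with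
  | zero =>
    intro t _ r _ F _ _ f hf
    have h := hV.vector_markov π hlab (k := 0) (t := fun _ => 0) (fun _ _ _ => le_rfl)
      (r := r) zero_le (fun _ => 1) f
    simp only [one_mul, NNReal.coe_zero, sub_zero] at h
    simp only [Finset.univ_eq_empty, Finset.prod_empty, one_mul]
    rw [h]
    have hst : ∀ᵐ v ∂Pr, ∀ i, V (lab i) 0 v = u (lab i) := ae_all_iff.2 fun i => hV.start _
    refine integral_nonneg_of_ae (hst.mono fun v hv => ?_)
    simp only [hv]
    exact nonneg_of_mul_nonneg_left ((hf.vecOp hs r.2).nonneg _) hu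
  | succ k ih =>
    intro t ht r hr F hF hF0 f hf
    rw [hV.vector_markov π hlab ht (hr _) (fun p => ∏ l, F l (p l)) f]
    simp_rw [Fin.prod_univ_castSucc, mul_assoc]
    exact ih (t := fun i => t i.castSucc) (fun i j h => ht (Fin.castSucc_le_castSucc_iff.2 h))
      (fun i => ht (Fin.le_last _)) (fun l => hF _) (fun l => hF0 _)
      ((hf.vecOp hs (sub_nonneg.2 (NNReal.coe_le_coe.2 (hr _)))).symm_mul (hF _) (hF0 _))

/-- The weight is the determinantally weighted expectation of the event that exactly `A` is occupied
within `S`. The indicator of this event is a product over space-time points of functions symmetric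
in the walks, to which the backward integration applies. -/
theorem IsIndepRandomWalks.occupationWeight_nonneg [Fintype Y] [IsProbabilityMeasure Pr]
    (hV : IsIndepRandomWalks Pr V u) {M : ℤ → Y → ℝ} {C : ℝ} (hM : ∀ k y, |M k y| ≤ C)
    (J : Finset ℤ) (T : ℝ≥0) (hMT : ∀ j ∈ J, ∀ k ∈ J,
      walkOp π T (M k) (π (u j)) = if j = k then 1 else 0)
    {s : (J → Y) → ℝ} (hs : IsChamberSign π s) (hu : 0 < s fun i => π (u i))
    (hsM : InChamberCone s fun x => (Matrix.of fun j k : J => M k (x j)).det)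
    {S A : Finset (ℝ≥0 × Y)} (hS : ∀ p ∈ S, p.1 ≤ T) (hA : A ⊆ S) :
    0 ≤ occupationWeight (principalMinor (walkKernel π u M T J)) S A := by
  classical
  obtain ⟨n, e, he, hmono⟩ := exists_monotone_enum S
  have hmem : ∀ i, e i ∈ S := fun i => by
    rw [← he]; exact Finset.mem_map_of_mem e (Finset.mem_univ i)
  have h := hV.integral_walkOcc_mul_det π hM J T hMT S hS
    fun ω => if ω = finsetConfig A then 1 else 0
  rw [Finset.sum_eq_single A] at h
  · rw [if_pos rfl, mul_one] at h
    rw [← h]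
    let occ : ℝ≥0 × Y → (J → Y) → ℕ := fun p x => (Finset.univ.filter fun i => x i = p.2).card
    have hocc : ∀ p v, walkOcc π V J p v = occ p fun i : J => π (V i p.1 v) := fun p v => by
      simp only [walkOcc, occ]
      exact (Finset.card_bij (fun (i : J) _ => (i : ℤ)) (by simp)
        (fun i _ j _ h => Subtype.val_injective h)
        fun i hi => ⟨⟨i, (Finset.mem_filter.1 hi).1⟩, by simpa using (Finset.mem_filter.1 hi).2,
          rfl⟩).symm
    have hsymm : ∀ p x (σ : Equiv.Perm J), occ p (x ∘ σ) = occ p x := fun p x σ => by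
      simp only [occ]
      exact Finset.card_bij (fun i _ => σ i) (by simp) (fun i _ j _ h => σ.injective h)
        fun i hi => ⟨σ.symm i, by simpa using hi, by simp⟩
    have hpos := hV.integral_prod_mul_nonneg (lab := ((↑) : J → ℤ)) Subtype.val_injective hs hu
      hmono (fun i => hS _ (hmem i))
      (F := fun l x => if occ (e l) x = finsetConfig A (e l) then 1 else 0)
      (fun l x σ => by simp only [hsymm]) (fun l x => by split_ifs <;> norm_num) hsM
    refine hpos.trans_eq (integral_congr_ae (Eventually.of_forall fun v => ?_))
    simp only
    congr 1
    simp_rw [← hocc]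
    by_cases hv : (truncConfig S fun p => walkOcc π V J p v) = finsetConfig A
    · rw [if_pos hv]
      refine Finset.prod_eq_one fun l _ => if_pos ?_
      rw [← hv]; simp [truncConfig, hmem l]
    · rw [if_neg hv]
      obtain ⟨p, hp⟩ := Function.ne_iff.1 hv
      have hpS : p ∈ S := by
        by_contra hpS
        exact hp (by
          have : p ∉ A := fun h => hpS (hA h)
          simp [truncConfig, finsetConfig, hpS, this])
      rw [← he, Finset.mem_map] at hpS
      obtain ⟨i, -, rfl⟩ := hpS
      refine Finset.prod_eq_zero (Finset.mem_univ i) (if_neg ?_)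
      simpa [truncConfig, hmem i] using hp
  · intro B _ hB
    rw [if_neg, mul_zero]
    intro h
    apply hB
    ext p
    have := congrFun h p
    simp only [finsetConfig] at this
    by_cases h1 : p ∈ B <;> by_cases h2 : p ∈ A <;> simp_all
  · intro h
    exact absurd (Finset.mem_powerset.2 hA) h

end Cone

/-! ### Martingale functions on a discrete circle -/

section CircleMart

variable (m a : ℕ)

/-- The angle of the `l`-th Fourier mode, centred, on the circle with `a (2 m + 1)` points. -/
noncomputable def circleAngle (l : Fin (2 * m + 1)) : ℝ :=
  2 * Real.pi * ((l : ℝ) - m) / (a * (2 * m + 1))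

/-- The analogue of `martM` on the circle with `a (2 m + 1)` points. -/
noncomputable def circleM (T : ℝ) (k x : ℤ) : ℝ :=
  1 / (2 * m + 1) * ∑ l : Fin (2 * m + 1), Real.cos (circleAngle m a l * (x - a * k)) *
    Real.exp (T * (1 - Real.cos (circleAngle m a l)))

theorem abs_circleM_le {T : ℝ} (hT : 0 ≤ T) (k x : ℤ) : |circleM m a T k x| ≤ Real.exp (T * 2) := by
  unfold circleM
  have hN : (0 : ℝ) < 2 * m + 1 := by positivity
  rw [abs_mul, abs_of_pos (by positivity), one_div, inv_mul_le_iff₀ hN]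
  refine (Finset.abs_sum_le_sum_abs _ _).trans ((Finset.sum_le_card_nsmul _ _ (Real.exp (T * 2))
    fun l _ => ?_).trans_eq (by simp))
  rw [abs_mul, Real.abs_exp]
  refine (mul_le_of_le_one_left (Real.exp_pos _).le (Real.abs_cos_le_one _)).trans
    (Real.exp_le_exp.2 (mul_le_mul_of_nonneg_left ?_ hT))
  linarith [Real.neg_one_le_cos (circleAngle m a l)]

/-- The centred frequencies l - m are integers because the number of modes is odd. With an even
number they would be half-integers and the functions antiperiodic. -/
theorem circleM_add_period [NeZero a] (T : ℝ) (k x q : ℤ) :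
    circleM m a T k (x + (a * (2 * m + 1) : ℕ) * q) = circleM m a T k x := by
  have ha : (a : ℝ) ≠ 0 := NeZero.ne _
  unfold circleM
  congr 1
  refine Finset.sum_congr rfl fun l _ => ?_
  congr 1
  rw [← Real.cos_add_int_mul_two_pi (circleAngle m a l * (x - a * k)) ((((l : ℕ) : ℤ) - m) * q)]
  congr 1
  unfold circleAngle
  push_cast
  field_simp
  ring

theorem circleM_index_add [NeZero a] (T : ℝ) (k x q : ℤ) :
    circleM m a T (k + (2 * m + 1) * q) x = circleM m a T k x := by
  rw [← circleM_add_period m a T k x (-q)]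
  unfold circleM
  push_cast
  congr 1
  refine Finset.sum_congr rfl fun l _ => ?_
  congr 2
  ring

/-- Cosine waves are eigenfunctions of the walk, and the eigenvalue cancels the exponential growth
over a time τ: this is the martingale property. -/
theorem hasSum_walkProb_mul_circleM (τ T : ℝ) (k x : ℤ) :
    HasSum (fun n : ℤ => walkProb τ n * circleM m a T k (x + n)) (circleM m a (T - τ) k x) := by
  have h : ∀ l : Fin (2 * m + 1), HasSum (fun n : ℤ => walkProb τ n *
      Real.cos (n * circleAngle m a l + circleAngle m a l * (x - a * k)) *
        Real.exp (T * (1 - Real.cos (circleAngle m a l))))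
      (Real.cos (circleAngle m a l * (x - a * k)) *
        Real.exp ((T - τ) * (1 - Real.cos (circleAngle m a l)))) := fun l => by
    have := (hasSum_walkProb_mul_cos τ (circleAngle m a l)
      (circleAngle m a l * (x - a * k))).mul_right
        (Real.exp (T * (1 - Real.cos (circleAngle m a l))))
    rw [mul_assoc, ← Real.exp_add] at this
    have e : (T - τ) * (1 - Real.cos (circleAngle m a l))
        = -τ * (1 - Real.cos (circleAngle m a l)) + T * (1 - Real.cos (circleAngle m a l)) := by
      ring
    rw [e]
    exact this
  have h2 := (hasSum_sum fun l (_ : l ∈ Finset.univ) => h l).mul_left (1 / (2 * m + 1 : ℝ))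
  refine Eq.mp (congrArg (HasSum · _) (funext fun n => ?_)) h2
  unfold circleM
  simp only [Finset.mul_sum]
  refine Finset.sum_congr rfl fun l _ => ?_
  have e : n * circleAngle m a l + circleAngle m a l * (x - a * k)
      = circleAngle m a l * (((x + n : ℤ) : ℝ) - a * k) := by
    push_cast
    ring
  rw [e]
  ring

theorem sum_exp_eq_zero {d : ℤ} (hd : d ≠ 0) (hdm : |d| < 2 * m + 1) :
    ∑ l : Fin (2 * m + 1), Complex.exp (2 * Real.pi * Complex.I * (((l : ℂ) - m) * d / (2 * m + 1)))
      = 0 := by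
  have hN : (2 * m + 1 : ℂ) ≠ 0 := by exact_mod_cast (Nat.succ_ne_zero (2 * m))
  set z : ℂ := Complex.exp (2 * Real.pi * Complex.I * (d / (2 * m + 1))) with hz
  have h1 : z ^ (2 * m + 1) = 1 := by
    rw [hz, ← Complex.exp_nat_mul, Complex.exp_eq_one_iff]
    refine ⟨d, ?_⟩
    push_cast
    field_simp
  have h2 : z ≠ 1 := by
    rw [hz, Ne, Complex.exp_eq_one_iff]
    rintro ⟨n, hn⟩
    have hpi : (2 * Real.pi * Complex.I : ℂ) ≠ 0 := Complex.two_pi_I_ne_zero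
    rw [mul_comm (n : ℂ)] at hn
    have h3 := mul_left_cancel₀ hpi hn
    rw [div_eq_iff hN] at h3
    have h4 : d = n * (2 * m + 1) := by exact_mod_cast h3
    rcases eq_or_ne n 0 with rfl | hn0
    · simp at h4; exact hd h4
    · have : 1 ≤ |n| := Int.one_le_abs hn0
      rw [h4, abs_mul, abs_of_pos (by positivity : (0 : ℤ) < 2 * m + 1)] at hdm
      nlinarith
  have h3 : ∀ l : Fin (2 * m + 1),
      Complex.exp (2 * Real.pi * Complex.I * (((l : ℂ) - m) * d / (2 * m + 1)))
      = Complex.exp (-(m : ℂ) * (2 * Real.pi * Complex.I * (d / (2 * m + 1)))) * z ^ (l : ℕ) := by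
    intro l
    rw [hz, ← Complex.exp_nat_mul, ← Complex.exp_add]
    congr 1
    ring
  simp_rw [h3]
  rw [← Finset.mul_sum, Fin.sum_univ_eq_sum_range (fun i => z ^ i), geom_sum_eq h2, h1]
  simp

theorem circleM_zero [NeZero a] {j k : ℤ} (h : |j - k| < 2 * m + 1) :
    circleM m a 0 k (a * j) = if j = k then 1 else 0 := by
  have ha : (a : ℝ) ≠ 0 := NeZero.ne _
  have hN : (2 * m + 1 : ℝ) ≠ 0 := by positivity
  unfold circleM
  split_ifs with hjk
  · subst hjk
    simp
    field_simp
  · have := congrArg Complex.re (sum_exp_eq_zero m (sub_ne_zero.2 hjk) h)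
    rw [Complex.re_sum] at this
    refine mul_eq_zero_of_right _ (Eq.trans ?_ this)
    refine Finset.sum_congr rfl fun l _ => ?_
    have e : (2 * Real.pi * Complex.I * (((l : ℂ) - m) * ((j - k : ℤ) : ℂ) / (2 * m + 1)) : ℂ)
        = ((circleAngle m a l * (a * j - a * k) : ℝ) : ℂ) * Complex.I := by
      have ha' : (a : ℂ) ≠ 0 := NeZero.ne _
      unfold circleAngle
      push_cast
      field_simp
    rw [e, Complex.exp_ofReal_mul_I_re]
    simp

/-! ### Product formula for the determinants -/

/-- The zeros of d ↦ sin(πd/L) are integers, so the sign cannot flip strictly between neighbouring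
integers. -/
theorem sin_mul_sin_nonneg {L : ℕ} [NeZero L] {d d' : ℤ} (h : |d' - d| ≤ 1) :
    0 ≤ Real.sin (Real.pi * d / L) * Real.sin (Real.pi * d' / L) := by
  have hL : (0 : ℝ) < L := Nat.cast_pos.2 (NeZero.pos L)
  have key : ∀ d : ℤ, 0 ≤ Real.sin (Real.pi * d / L) * Real.sin (Real.pi * (d + 1 : ℤ) / L) := by
    intro d
    have hL' : (0 : ℤ) < L := by exact_mod_cast NeZero.pos L
    have h1 := Int.emod_nonneg d hL'.ne'
    have h2 := Int.emod_lt_of_pos d hL'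
    have h3 := Int.emod_add_mul_ediv d L
    set r := d % L
    set q := d / L
    have e : ∀ i : ℤ, Real.sin (Real.pi * (d + i : ℤ) / L)
        = (-1) ^ q * Real.sin (Real.pi * (r + i) / L) := fun i => by
      rw [← Real.sin_add_int_mul_pi, ← h3]
      congr 1
      push_cast
      field_simp
      ring
    have e0 := e 0
    have e1 := e 1
    rw [add_zero] at e0
    rw [e0, e1, mul_mul_mul_comm, ← mul_zpow]
    simp only [mul_neg, mul_one, neg_neg, one_zpow, one_mul]
    have hr1 : (0 : ℝ) ≤ r := by exact_mod_cast h1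
    have hr2 : (r : ℝ) + 1 ≤ L := by exact_mod_cast h2
    refine mul_nonneg (Real.sin_nonneg_of_nonneg_of_le_pi (by positivity) ?_)
      (Real.sin_nonneg_of_nonneg_of_le_pi (by positivity) ?_)
    · rw [div_le_iff₀ hL]
      push_cast
      nlinarith [Real.pi_pos]
    · rw [div_le_iff₀ hL]
      push_cast
      nlinarith [Real.pi_pos]
  rw [abs_le] at h
  obtain h | h | h : d' = d + 1 ∨ d' = d ∨ d = d' + 1 := by omega
  · rw [h]; exact key d
  · rw [h]; exact mul_self_nonneg _
  · rw [h, mul_comm]; exact key d'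

/-- The Vandermonde product on the circle. -/
noncomputable def sineVandermonde (L : ℕ) {N : ℕ} (x : Fin N → ℤ) : ℝ :=
  ∏ i, ∏ j ∈ Finset.Ioi i, Real.sin (Real.pi * (x j - x i : ℤ) / L)

theorem sineVandermonde_mul_nonneg {L : ℕ} [NeZero L] {N : ℕ} {x x' : Fin N → ℤ}
    (h : ∀ i j, |(x' j - x' i) - (x j - x i)| ≤ 1) :
    0 ≤ sineVandermonde L x * sineVandermonde L x' := by
  unfold sineVandermonde
  simp_rw [← Finset.prod_mul_distrib]
  exact Finset.prod_nonneg fun i _ => Finset.prod_nonneg fun j _ => sin_mul_sin_nonneg (h i j)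

theorem exists_dvd_of_sineVandermonde_eq_zero {L : ℕ} [NeZero L] {N : ℕ} {x : Fin N → ℤ}
    (h : sineVandermonde L x = 0) : ∃ i j, i ≠ j ∧ (L : ℤ) ∣ x j - x i := by
  have hL : (L : ℝ) ≠ 0 := NeZero.ne _
  obtain ⟨i, -, hi⟩ := Finset.prod_eq_zero_iff.1 h
  obtain ⟨j, hj, hij⟩ := Finset.prod_eq_zero_iff.1 hi
  refine ⟨i, j, (Finset.mem_Ioi.1 hj).ne, ?_⟩
  obtain ⟨n, hn⟩ := Real.sin_eq_zero_iff.1 hij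
  refine ⟨n, ?_⟩
  rw [eq_div_iff hL] at hn
  have : (Real.pi) * ((n : ℝ) * L) = Real.pi * ((x j - x i : ℤ) : ℝ) := by rw [← hn]; ring
  have := mul_left_cancel₀ Real.pi_ne_zero this
  rw [mul_comm]
  exact_mod_cast this.symm

/-- With h_j = exp(iπ x_j/L), taking h_j^{-2m} out of row j leaves the Vandermonde matrix of the
h_j². Each difference h_j² - h_i² is h_i h_j · 2i · sin(π(x_j - x_i)/L), and every h_i occurs in 2m
pairs, so the prefactors cancel exactly. -/
theorem exists_det_fourier (L : ℕ) : ∃ κ : ℂ, ∀ x : Fin (2 * m + 1) → ℤ,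
    (Matrix.of fun j l : Fin (2 * m + 1) =>
      Complex.exp (2 * Real.pi * Complex.I * (((l : ℂ) - m) * x j / L))).det
      = κ * sineVandermonde L x := by
  refine ⟨∏ i : Fin (2 * m + 1), ∏ j ∈ Finset.Ioi i, (2 * Complex.I), fun x => ?_⟩
  set h : Fin (2 * m + 1) → ℂ := fun j => Complex.exp (Real.pi * Complex.I * (x j / L)) with hh
  have h0 : ∀ j, h j ≠ 0 := fun j => Complex.exp_ne_zero _
  have e1 : (Matrix.of fun j l : Fin (2 * m + 1) =>
      Complex.exp (2 * Real.pi * Complex.I * (((l : ℂ) - m) * x j / L)))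
      = Matrix.of fun j l => (h j ^ (2 * m))⁻¹ * Matrix.vandermonde (fun j => h j ^ 2) j l := by
    ext j l
    simp only [Matrix.of_apply, Matrix.vandermonde_apply]
    rw [hh, ← pow_mul, ← Complex.exp_nat_mul, ← Complex.exp_nat_mul, ← Complex.exp_neg,
      ← Complex.exp_add]
    congr 1
    push_cast
    ring
  have e2 : ∀ i j, h j ^ 2 - h i ^ 2
      = (h i * h j) * ((2 * Complex.I) * (Real.sin (Real.pi * (x j - x i : ℤ) / L) : ℝ)) := by
    intro i j
    have : (2 * Complex.I) * ((Real.sin (Real.pi * (x j - x i : ℤ) / L) : ℝ) : ℂ)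
        = h j * (h i)⁻¹ - h i * (h j)⁻¹ := by
      rw [Complex.ofReal_sin, Complex.sin, hh]
      simp only [← Complex.exp_neg, ← Complex.exp_add]
      have hI : Complex.I * Complex.I = -1 := Complex.I_mul_I
      have a1 : (-((Real.pi * (x j - x i : ℤ) / L : ℝ) : ℂ) * Complex.I)
        = (Real.pi * Complex.I * (x i / L) + -(Real.pi * Complex.I * (x j / L))) := by
        push_cast; ring
      have a2 : (((Real.pi * (x j - x i : ℤ) / L : ℝ) : ℂ) * Complex.I)
        = (Real.pi * Complex.I * (x j / L) + -(Real.pi * Complex.I * (x i / L))) := by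
        push_cast; ring
      rw [a1, a2]
      linear_combination
        (Complex.exp (Real.pi * Complex.I * (x i / L) + -(Real.pi * Complex.I * (x j / L))) -
          Complex.exp (Real.pi * Complex.I * (x j / L) + -(Real.pi * Complex.I * (x i / L)))) * hI
    rw [this]
    have := h0 i
    have := h0 j
    field_simp
  have e3 : ∏ i, ∏ j ∈ Finset.Ioi i, h i * h j = ∏ i, h i ^ (2 * m) := by
    rw [Finset.prod_prod_Ioi_mul_eq_prod_prod_off_diag fun _ i => h i]
    refine Finset.prod_congr rfl fun i _ => ?_
    rw [Finset.prod_const, Finset.card_compl]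
    simp
  rw [e1, Matrix.det_mul_column, Matrix.det_vandermonde]
  have e4 : ∏ i, ∏ j ∈ Finset.Ioi i, (h j ^ 2 - h i ^ 2) = (∏ i, ∏ j ∈ Finset.Ioi i, h i * h j) *
      ((∏ i : Fin (2 * m + 1), ∏ j ∈ Finset.Ioi i, 2 * Complex.I) *
        ∏ i, ∏ j ∈ Finset.Ioi i, ((Real.sin (Real.pi * (x j - x i : ℤ) / L) : ℝ) : ℂ)) := by
    simp only [e2, ← Finset.prod_mul_distrib]
  have e5 : ∏ i : Fin (2 * m + 1), (h i ^ (2 * m))⁻¹ * h i ^ (2 * m) = 1 :=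
    Finset.prod_eq_one fun i _ => inv_mul_cancel₀ (pow_ne_zero _ (h0 i))
  rw [e4, e3, ← mul_assoc, ← Finset.prod_mul_distrib, e5, one_mul]
  unfold sineVandermonde
  push_cast
  rfl

/-- Reversing the order of the modes negates the angle, so cosines may be replaced by exponentials.
The result is a matrix product: Fourier matrix in x, positive diagonal, Fourier matrix in k. -/
theorem ofReal_circleM (T : ℝ) (k x : ℤ) : (circleM m a T k x : ℂ)
    = ∑ l : Fin (2 * m + 1),
      Complex.exp (2 * Real.pi * Complex.I *
        (((l : ℂ) - m) * x / (a * (2 * m + 1) : ℕ))) *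
      ((Real.exp (T * (1 - Real.cos (circleAngle m a l))) : ℂ) *
        (1 / (2 * m + 1) * Complex.exp (-(circleAngle m a l * (a * k) : ℝ) * Complex.I))) := by
  have hrev : ∀ l : Fin (2 * m + 1), circleAngle m a l.rev = -circleAngle m a l := fun l => by
    unfold circleAngle
    rw [Fin.val_rev, Nat.cast_sub (by omega)]
    push_cast
    ring
  have e : ∀ l : Fin (2 * m + 1), Complex.exp (2 * Real.pi * Complex.I *
        (((l : ℂ) - m) * x / (a * (2 * m + 1) : ℕ))) *
      ((Real.exp (T * (1 - Real.cos (circleAngle m a l))) : ℂ) *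
        (1 / (2 * m + 1) * Complex.exp (-(circleAngle m a l * (a * k) : ℝ) * Complex.I)))
      = 1 / (2 * m + 1) * (Real.exp (T * (1 - Real.cos (circleAngle m a l))) *
        Complex.exp ((circleAngle m a l * (x - a * k) : ℝ) * Complex.I)) := fun l => by
    have : Complex.exp ((circleAngle m a l * (x - a * k) : ℝ) * Complex.I)
        = Complex.exp (2 * Real.pi * Complex.I * (((l : ℂ) - m) * x / (a * (2 * m + 1) : ℕ))) *
          Complex.exp (-(circleAngle m a l * (a * k) : ℝ) * Complex.I) := by
      rw [← Complex.exp_add]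
      congr 1
      unfold circleAngle
      push_cast
      ring
    rw [this]
    ring
  simp_rw [e]
  rw [← Finset.mul_sum]
  unfold circleM
  push_cast
  congr 1
  set z : Fin (2 * m + 1) → ℂ := fun l => Complex.exp (T * (1 - Complex.cos (circleAngle m a l))) *
    Complex.exp (circleAngle m a l * (x - a * k) * Complex.I)
  have hz : ∑ l, z l = ∑ l, z (Fin.rev l) := (Equiv.sum_comp Fin.revPerm z).symm
  have hz2 : ∑ l, z l = ∑ l, (z l + z (Fin.rev l)) / 2 := by
    rw [← Finset.sum_div, Finset.sum_add_distrib, ← hz]; ring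
  change _ = ∑ l, z l
  rw [hz2]
  refine Finset.sum_congr rfl fun l _ => ?_
  simp only [z, hrev]
  push_cast
  rw [Complex.cos_neg, Complex.cos]
  ring_nf

/-- The determinants of the circle martingale functions are positive multiples of Vandermonde
products. -/
theorem det_circleM_mul [NeZero a] (T : ℝ) (x : Fin (2 * m + 1) → ℤ) :
    (Matrix.of fun j k : Fin (2 * m + 1) => circleM m a T ((k : ℤ) - m) (x j)).det *
      sineVandermonde (a * (2 * m + 1)) (fun j : Fin (2 * m + 1) => (a : ℤ) * ((j : ℤ) - m))
      = (∏ l, Real.exp (T * (1 - Real.cos (circleAngle m a l)))) *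
        sineVandermonde (a * (2 * m + 1)) x := by
  obtain ⟨κ, hκ⟩ := exists_det_fourier m (a * (2 * m + 1))
  let B : Matrix (Fin (2 * m + 1)) (Fin (2 * m + 1)) ℂ := Matrix.of fun l k =>
    1 / (2 * m + 1) * Complex.exp (-(circleAngle m a l * (a * ((k : ℤ) - m : ℤ)) : ℝ) * Complex.I)
  have hdet : ∀ T x, (((Matrix.of fun j k : Fin (2 * m + 1) =>
        circleM m a T ((k : ℤ) - m) (x j)).det : ℝ) : ℂ)
      = κ * sineVandermonde (a * (2 * m + 1)) x *
        ((∏ l, (Real.exp (T * (1 - Real.cos (circleAngle m a l))) : ℂ)) * B.det) := by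
    intro T x
    rw [← hκ x, ← Matrix.det_mul_column, ← Matrix.det_mul,
      show ∀ M : Matrix (Fin (2 * m + 1)) (Fin (2 * m + 1)) ℝ, ((M.det : ℝ) : ℂ)
        = (M.map Complex.ofReal).det from fun M => RingHom.map_det Complex.ofRealHom M]
    congr 1
    ext j k
    simp only [Matrix.map_apply, Matrix.of_apply, Matrix.mul_apply]
    rw [ofReal_circleM]
    rfl
  -- At time 0 and at the starting points the matrix is the identity; this evaluates the unknown
  -- constant κ det B.
  have h1 : (Matrix.of fun j k : Fin (2 * m + 1) => circleM m a 0 ((k : ℤ) - m)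
      ((a : ℤ) * ((j : ℤ) - m))) = 1 := by
    ext j k
    rw [Matrix.of_apply, circleM_zero, Matrix.one_apply]
    · congr 1
      simp [Fin.ext_iff]
    · rw [abs_lt]; omega
  have h2 := hdet 0 fun j => (a : ℤ) * ((j : ℤ) - m)
  rw [h1, Matrix.det_one] at h2
  simp only [zero_mul, Real.exp_zero, Complex.ofReal_one, Finset.prod_const_one, one_mul] at h2
  rw [← Complex.ofReal_inj]
  rw [Complex.ofReal_mul, hdet]
  push_cast
  linear_combination -(∏ l, Complex.exp (T * (1 - Complex.cos (circleAngle m a l)))) *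
        (sineVandermonde (a * (2 * m + 1)) x) * h2

end CircleMart

/-! ### Nonnegative occupation weights on the circle -/

section CirclePositivity

variable (m a : ℕ)

/-- The labels `-m, …, m`. -/
noncomputable def labels : Finset ℤ := Finset.Icc (-(m : ℤ)) m

/-- `circleM` as a function on the discrete circle. -/
noncomputable def circleFun (T : ℝ) (k : ℤ) (y : ZMod (a * (2 * m + 1))) : ℝ :=
  circleM m a T k (y.val : ℤ)

theorem circleFun_intCast [NeZero a] (T : ℝ) (k x : ℤ) :
    circleFun m a T k (x : ZMod (a * (2 * m + 1))) = circleM m a T k x := by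
  unfold circleFun
  rw [ZMod.val_intCast]
  conv_rhs => rw [← Int.emod_add_mul_ediv x (a * (2 * m + 1) : ℕ)]
  rw [circleM_add_period]

/-- The enumeration of the labels. -/
noncomputable def labelEquiv : Fin (2 * m + 1) ≃ labels m where
  toFun i := ⟨(i : ℤ) - m, by simp only [labels, Finset.mem_Icc]; omega⟩
  invFun j := ⟨((j : ℤ) + m).toNat, by
    have := Finset.mem_Icc.1 (show (j : ℤ) ∈ Finset.Icc (-(m : ℤ)) m from j.2)
    omega⟩
  left_inv i := by ext; simp
  right_inv j := by
    have := Finset.mem_Icc.1 (show (j : ℤ) ∈ Finset.Icc (-(m : ℤ)) m from j.2)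
    ext
    simp only
    omega

theorem det_circleFun_mul [NeZero a] (T : ℝ) (x : labels m → ℤ) :
    (Matrix.of fun j k : labels m =>
        circleFun m a T k (x j : ZMod (a * (2 * m + 1)))).det *
      sineVandermonde (a * (2 * m + 1)) (fun j : Fin (2 * m + 1) => (a : ℤ) * ((j : ℤ) - m))
      = (∏ l, Real.exp (T * (1 - Real.cos (circleAngle m a l)))) *
        sineVandermonde (a * (2 * m + 1)) (x ∘ labelEquiv m) := by
  rw [← det_circleM_mul, ← Matrix.det_submatrix_equiv_self (labelEquiv m)]
  congr 2
  ext j k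
  simp only [Matrix.submatrix_apply, Matrix.of_apply, circleFun_intCast]
  rfl

theorem sineVandermonde_start_ne_zero [NeZero a] : sineVandermonde (a * (2 * m + 1))
    (fun j : Fin (2 * m + 1) => (a : ℤ) * ((j : ℤ) - m)) ≠ 0 := by
  intro h
  obtain ⟨i, j, hij, hd⟩ := exists_dvd_of_sineVandermonde_eq_zero h
  have ha : (a : ℤ) ≠ 0 := by exact_mod_cast NeZero.ne a
  rw [← mul_sub] at hd
  push_cast at hd
  have hd2 := (mul_dvd_mul_iff_left ha).1 hd
  have := Int.eq_zero_of_abs_lt_dvd hd2 (by rw [abs_lt]; omega)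
  apply hij
  ext
  omega

theorem circleFun_start [NeZero a] {j k : ℤ} (hj : j ∈ labels m) (hk : k ∈ labels m) :
    circleFun m a 0 k ((a * j : ℤ) : ZMod (a * (2 * m + 1))) = if j = k then 1 else 0 := by
  rw [circleFun_intCast, circleM_zero]
  simp only [labels, Finset.mem_Icc] at hj hk
  rw [abs_lt]; omega

/-- The sign function on the discrete circle. -/
noncomputable def circleSign (x : labels m → ZMod (a * (2 * m + 1))) : ℝ :=
  (Matrix.of fun j k : labels m => circleFun m a 0 k (x j)).det

theorem exists_lift [NeZero a] (x : labels m → ZMod (a * (2 * m + 1))) :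
    ∃ x' : labels m → ℤ, (fun j => ((x' j : ℤ) : ZMod (a * (2 * m + 1)))) = x :=
  ⟨fun j => ((x j).val : ℤ), by funext j; simp⟩

/-- As a determinant of functions on the circle, the sign function is well defined and antisymmetric
at once; this link to the sine product supplies its zeros and its behaviour under unit steps. -/
theorem circleSign_mul [NeZero a] (x : labels m → ℤ) :
    circleSign m a (fun j => ((x j : ℤ) : ZMod (a * (2 * m + 1)))) *
      sineVandermonde (a * (2 * m + 1)) (fun j : Fin (2 * m + 1) => (a : ℤ) * ((j : ℤ) - m))
      = sineVandermonde (a * (2 * m + 1)) (x ∘ labelEquiv m) := by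
  simpa [circleSign] using det_circleFun_mul m a 0 x

theorem circleSign_mul_nonneg [NeZero a] {x x' : labels m → ℤ}
    (h : ∀ i j, |(x' j - x' i) - (x j - x i)| ≤ 1) :
    0 ≤ circleSign m a (fun j => ((x j : ℤ) : ZMod (a * (2 * m + 1)))) *
      circleSign m a (fun j => ((x' j : ℤ) : ZMod (a * (2 * m + 1)))) := by
  have h1 : 0 ≤ sineVandermonde (a * (2 * m + 1)) (x ∘ labelEquiv m) *
      sineVandermonde (a * (2 * m + 1)) (x' ∘ labelEquiv m) :=
    sineVandermonde_mul_nonneg fun i j => h _ _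
  rw [← circleSign_mul, ← circleSign_mul, mul_mul_mul_comm] at h1
  exact nonneg_of_mul_nonneg_left h1
    (mul_self_pos.2 (sineVandermonde_start_ne_zero m a))

theorem isChamberSign_circleSign [NeZero a] :
    IsChamberSign (Int.castAddHom (ZMod (a * (2 * m + 1)))) (circleSign m a) where
  swap x i j hij := by
    have := Matrix.det_permute (Equiv.swap i j)
      (Matrix.of fun j k : labels m => circleFun m a 0 k (x j))
    rw [Equiv.Perm.sign_swap hij] at this
    rw [Units.val_neg, Units.val_one, Int.cast_neg, Int.cast_one, neg_one_mul] at this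
    exact this
  eq_zero x hx hinj := by
    obtain ⟨x, rfl⟩ := exists_lift m a x
    have h := circleSign_mul m a x
    rw [hx, zero_mul] at h
    obtain ⟨i, j, hij, hd⟩ := exists_dvd_of_sineVandermonde_eq_zero h.symm
    rw [← ZMod.intCast_eq_intCast_iff_dvd_sub] at hd
    exact hij ((labelEquiv m).injective (hinj hd))
  add_single x i := by
    obtain ⟨x, rfl⟩ := exists_lift m a x
    have := circleSign_mul_nonneg m a (x := x) (x' := x + Pi.single i 1) fun k l => by
      simp only [Pi.add_apply, Pi.single_apply]
      split_ifs <;> simp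
    convert this using 3
    funext k
    simp only [Pi.add_apply, Pi.single_apply]
    split_ifs <;> simp
  sub_single x i := by
    obtain ⟨x, rfl⟩ := exists_lift m a x
    have := circleSign_mul_nonneg m a (x := x) (x' := x - Pi.single i 1) fun k l => by
      simp only [Pi.sub_apply, Pi.single_apply]
      split_ifs <;> simp
    convert this using 3
    funext k
    simp only [Pi.sub_apply, Pi.single_apply]
    split_ifs <;> simp

/-- The terminal time enters only through a positive scalar, so the determinantal weight has the
sign pattern of `circleSign` for every T and lies in the chamber cone. -/
theorem det_circleFun [NeZero a] (T : ℝ) (x : labels m → ZMod (a * (2 * m + 1))) :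
    (Matrix.of fun j k : labels m => circleFun m a T k (x j)).det
      = (∏ l, Real.exp (T * (1 - Real.cos (circleAngle m a l)))) * circleSign m a x := by
  obtain ⟨x, rfl⟩ := exists_lift m a x
  refine mul_right_cancel₀ (sineVandermonde_start_ne_zero m a) ?_
  rw [det_circleFun_mul, mul_assoc, circleSign_mul]

theorem walkOp_circleFun [NeZero a] (τ T : ℝ) (k x : ℤ) :
    walkOp (Int.castAddHom (ZMod (a * (2 * m + 1)))) τ (circleFun m a T k) (x : ZMod _)
      = circleM m a (T - τ) k x := by
  rw [← (hasSum_walkProb_mul_circleM m a τ T k x).tsum_eq]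
  unfold walkOp
  refine tsum_congr fun n => ?_
  rw [Int.coe_castAddHom, ← Int.cast_add, circleFun_intCast]

theorem IsIndepRandomWalks.circle_occupationWeight_nonneg [NeZero a] {Ω : Type*}
    [MeasurableSpace Ω] {Pr : Measure Ω} [IsProbabilityMeasure Pr] {V : ℤ → ℝ≥0 → Ω → ℤ}
    (hV : IsIndepRandomWalks Pr V fun j => (a : ℤ) * j) (T : ℝ≥0)
    {S A : Finset (ℝ≥0 × ZMod (a * (2 * m + 1)))} (hS : ∀ p ∈ S, p.1 ≤ T) (hA : A ⊆ S) :
    0 ≤ occupationWeight (principalMinor (walkKernel (Int.castAddHom (ZMod (a * (2 * m + 1))))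
      (fun j => (a : ℤ) * j) (circleFun m a T) T (labels m))) S A := by
  have hs := isChamberSign_circleSign m a
  refine hV.occupationWeight_nonneg (M := circleFun m a T)
    (fun k y => abs_circleM_le m a T.coe_nonneg k _) (labels m) T ?_ hs
    ?_ ?_ hS hA
  · intro j hj k hk
    rw [Int.coe_castAddHom, ← Int.coe_castAddHom, Int.coe_castAddHom]
    have := walkOp_circleFun m a T T k (a * j)
    rw [sub_self, ← circleFun_intCast, circleFun_start m a hj hk] at this
    exact this
  · unfold circleSign
    rw [show (Matrix.of fun j k : labels m => circleFun m a 0 k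
      (Int.castAddHom (ZMod (a * (2 * m + 1))) (a * (j : ℤ)))) = 1 from ?_]
    · rw [Matrix.det_one]; norm_num
    · ext j k
      rw [Matrix.of_apply, Int.coe_castAddHom, circleFun_start m a j.2 k.2, Matrix.one_apply]
      simp only [Subtype.ext_iff]
  · have e : (fun x : labels m → ZMod (a * (2 * m + 1)) =>
        (Matrix.of fun j k : labels m => circleFun m a T k (x j)).det)
        = fun x => (∏ l, Real.exp (T * (1 - Real.cos (circleAngle m a l)))) * circleSign m a x :=
      funext (det_circleFun m a T)
    rw [e]
    refine ⟨fun x i j hij => ?_, fun x => ?_⟩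
    · rw [hs.swap x i j hij, mul_neg]
    · rw [mul_assoc]
      exact mul_nonneg (Finset.prod_nonneg fun _ _ => (Real.exp_pos _).le) (mul_self_nonneg _)

end CirclePositivity

/-! ### The limit of the circle kernels -/

/-- The 2m+1 sample points are the midpoints of equal cells filling [-π, π], so uniform continuity
controls the error on each cell. -/
theorem tendsto_midpoint_sum {f : ℝ → ℝ} (hf : Continuous f) :
    Tendsto (fun m : ℕ => 1 / (2 * m + 1 : ℝ) *
      ∑ l : Fin (2 * m + 1), f (2 * Real.pi * ((l : ℝ) - m) / (2 * m + 1))) atTop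
      (𝓝 (1 / (2 * Real.pi) * ∫ x in (-Real.pi)..Real.pi, f x)) := by
  have hpi := Real.pi_pos
  rw [Metric.tendsto_atTop]
  intro ε hε
  have huc := (isCompact_Icc (a := -Real.pi) (b := Real.pi)).uniformContinuousOn_of_continuous
    hf.continuousOn
  rw [Metric.uniformContinuousOn_iff] at huc
  obtain ⟨δ, hδ, hfδ⟩ := huc (ε / 2) (by positivity)
  obtain ⟨M, hM⟩ := exists_nat_gt (2 * Real.pi / δ)
  refine ⟨M, fun m hm => ?_⟩
  have hN : (0 : ℝ) < 2 * m + 1 := by positivity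
  set h : ℝ := 2 * Real.pi / (2 * m + 1) with hh
  have hh0 : 0 < h := by positivity
  have hhδ : h < δ := by
    rw [hh, div_lt_iff₀ hN]
    rw [div_lt_iff₀ hδ] at hM
    have : (M : ℝ) ≤ m := by exact_mod_cast hm
    nlinarith
  set x : ℕ → ℝ := fun i => -Real.pi + i * h with hx
  set c : ℕ → ℝ := fun i => 2 * Real.pi * ((i : ℝ) - m) / (2 * m + 1) with hc
  have hcx : ∀ i, c i = x i + h / 2 := fun i => by
    simp only [hc, hx, hh]; field_simp; ring
  have hxs : ∀ i, x (i + 1) = x i + h := fun i => by simp only [hx]; push_cast; ring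
  have hx0 : x 0 = -Real.pi := by simp [hx]
  have hxN : x (2 * m + 1) = Real.pi := by
    simp only [hx, hh]; push_cast; field_simp; ring
  have hmem : ∀ i < 2 * m + 1, ∀ y, x i ≤ y → y ≤ x (i + 1) → y ∈ Set.Icc (-Real.pi) Real.pi := by
    intro i hi y h1 h2
    constructor
    · refine le_trans ?_ h1
      simp only [hx]
      have : 0 ≤ (i : ℝ) * h := by positivity
      linarith
    · refine h2.trans ?_
      rw [← hxN]
      simp only [hx]
      have : ((i + 1 : ℕ) : ℝ) ≤ ((2 * m + 1 : ℕ) : ℝ) := by exact_mod_cast hi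
      have := mul_le_mul_of_nonneg_right this hh0.le
      linarith
  have hint : ∫ y in (-Real.pi)..Real.pi, f y
      = ∑ i ∈ Finset.range (2 * m + 1), ∫ y in x i..x (i + 1), f y := by
    rw [intervalIntegral.sum_integral_adjacent_intervals fun i _ => hf.intervalIntegrable _ _,
      hx0, hxN]
  have hest : ∀ i ∈ Finset.range (2 * m + 1),
      ‖h * f (c i) - ∫ y in x i..x (i + 1), f y‖ ≤ ε / 2 * h := by
    intro i hi
    have hle : x i ≤ x (i + 1) := by rw [hxs]; linarith
    have e : h * f (c i) - ∫ y in x i..x (i + 1), f y = ∫ y in x i..x (i + 1), (f (c i) - f y) := by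
      rw [intervalIntegral.integral_sub intervalIntegrable_const (hf.intervalIntegrable _ _),
        intervalIntegral.integral_const, hxs, smul_eq_mul]
      ring
    rw [e]
    refine (intervalIntegral.norm_integral_le_of_norm_le_const fun y hy => ?_).trans_eq
      (show ε / 2 * |x (i + 1) - x i| = _ by rw [hxs, add_sub_cancel_left, abs_of_pos hh0])
    rw [Set.uIoc_of_le hle] at hy
    have hi' := Finset.mem_range.1 hi
    rw [hxs] at hy
    refine (hfδ (c i) (hmem i hi' _ (by rw [hcx]; linarith) (by rw [hcx, hxs]; linarith)) y
      (hmem i hi' _ hy.1.le (by rw [hxs]; exact hy.2)) ?_).le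
    rw [Real.dist_eq, hcx, abs_lt]
    constructor <;> linarith [hy.1, hy.2]
  have hsum : (1 / (2 * m + 1 : ℝ)) * ∑ l : Fin (2 * m + 1), f (2 * Real.pi * ((l : ℝ) - m) / (2 * m + 1))
      = 1 / (2 * Real.pi) * ∑ i ∈ Finset.range (2 * m + 1), h * f (c i) := by
    rw [Fin.sum_univ_eq_sum_range (fun i => f (c i)), ← Finset.mul_sum, ← mul_assoc]
    congr 1
    rw [hh]
    field_simp
  rw [Real.dist_eq, hsum, hint, ← mul_sub, ← Finset.sum_sub_distrib, abs_mul,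
    abs_of_pos (by positivity)]
  have h1 := (norm_sum_le _ _).trans (Finset.sum_le_sum hest)
  rw [Finset.sum_const, Finset.card_range, nsmul_eq_mul, Real.norm_eq_abs] at h1
  have h2 : ((2 * m + 1 : ℕ) : ℝ) * (ε / 2 * h) = (2 * Real.pi) * (ε / 2) := by
    rw [hh]; push_cast; field_simp
  rw [h2] at h1
  calc _ ≤ 1 / (2 * Real.pi) * ((2 * Real.pi) * (ε / 2)) :=
        mul_le_mul_of_nonneg_left h1 (by positivity)
    _ = ε / 2 := by field_simp
    _ < ε := by linarith

theorem tendsto_circleM (a : ℕ) [NeZero a] (T : ℝ) (k x : ℤ) :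
    Tendsto (fun m : ℕ => circleM m a T k x) atTop (𝓝 (martM a k T x)) := by
  have ha : (a : ℝ) ≠ 0 := NeZero.ne _
  have h := tendsto_midpoint_sum (f := fun l => Real.cos (l * ((x : ℝ) / a - k)) *
    Real.exp (T * (1 - Real.cos (l / a)))) (by fun_prop)
  rw [← martM_eq, ← mul_assoc, one_div, inv_mul_cancel₀ Real.two_pi_pos.ne', one_mul] at h
  refine h.congr fun m => ?_
  unfold circleM
  congr 1
  refine Finset.sum_congr rfl fun l _ => ?_
  have e1 : circleAngle m a l = 2 * Real.pi * ((l : ℝ) - m) / (2 * m + 1) / a := by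
    unfold circleAngle; field_simp
  have e2 : circleAngle m a l * (x - a * k)
      = 2 * Real.pi * ((l : ℝ) - m) / (2 * m + 1) * ((x : ℝ) / a - k) := by
    rw [e1]; field_simp
  rw [e2, e1]

section KernelLimit

variable (m a : ℕ)

-- Both terms are rewritten as sums over the integer displacement n, so that dominated convergence
-- can be applied as m → ∞. In the first, each endpoint y - n in aℤ comes from exactly one label
-- modulo 2m+1, and `circleM` is periodic in the label.
open Classical in
theorem circle_walkKernel [NeZero a] (T : ℝ≥0) (p q : ℝ≥0 × ℤ) :
    walkKernel (Int.castAddHom (ZMod (a * (2 * m + 1)))) (fun j => (a : ℤ) * j) (circleFun m a T) T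
        (labels m) (p.1, (p.2 : ZMod (a * (2 * m + 1)))) (q.1, (q.2 : ZMod (a * (2 * m + 1))))
      = (∑' n : ℤ, walkProb q.1 n *
          if (a : ℤ) ∣ q.2 - n then circleM m a p.1 ((q.2 - n) / a) p.2 else 0) -
        if p.1 < q.1 then ∑' n : ℤ, walkProb ((q.1 : ℝ) - p.1) n *
          (if ((a * (2 * m + 1) : ℕ) : ℤ) ∣ q.2 - (p.2 + n) then 1 else 0) else 0 := by
  have hind : ∀ x z n : ℤ, pointIndicator (x : ZMod (a * (2 * m + 1)))
      ((z : ZMod (a * (2 * m + 1))) + Int.castAddHom (ZMod (a * (2 * m + 1))) n)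
      = if ((a * (2 * m + 1) : ℕ) : ℤ) ∣ x - (z + n) then 1 else 0 := fun x z n => by
    unfold pointIndicator
    rw [Int.coe_castAddHom, ← Int.cast_add]
    simp only [ZMod.intCast_eq_intCast_iff_dvd_sub]
  unfold walkKernel
  congr 1
  · have hs : ∀ k : ℤ, HasSum (fun n => walkProb q.1 n *
        (circleM m a p.1 k p.2 * if ((a * (2 * m + 1) : ℕ) : ℤ) ∣ q.2 - (a * k + n) then 1 else 0))
        (circleM m a p.1 k p.2 * walkOp (Int.castAddHom (ZMod (a * (2 * m + 1)))) q.1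
          (pointIndicator (q.2 : ZMod (a * (2 * m + 1))))
          (Int.castAddHom (ZMod (a * (2 * m + 1))) (a * k))) := fun k => by
      have := (summable_walkProb_mul (τ := q.1) q.1.coe_nonneg (C := 1)
        (g := fun n => pointIndicator (q.2 : ZMod (a * (2 * m + 1)))
          (((a * k : ℤ) : ZMod (a * (2 * m + 1))) + Int.castAddHom (ZMod (a * (2 * m + 1))) n))
        fun n => abs_pointIndicator_le _ _).hasSum.mul_left (circleM m a p.1 k p.2)
      simp only [hind] at this
      refine Eq.mp ?_ this
      congr 1
      · funext n; ring
      · congr 1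
        unfold walkOp
        refine tsum_congr fun n => ?_
        rw [← hind, Int.coe_castAddHom]
    have e : ∀ k ∈ labels m, walkOp (Int.castAddHom (ZMod (a * (2 * m + 1)))) ((T : ℝ) - p.1)
        (circleFun m a T k) (p.2 : ZMod (a * (2 * m + 1))) = circleM m a p.1 k p.2 := fun k _ => by
      rw [walkOp_circleFun, sub_sub_cancel]
    rw [Finset.sum_congr rfl fun k hk => by rw [e k hk]]
    rw [← (hasSum_sum fun k (_ : k ∈ labels m) => hs k).tsum_eq]
    refine tsum_congr fun n => ?_
    rw [← Finset.mul_sum]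
    congr 1
    have ha : (0 : ℤ) < a := by exact_mod_cast NeZero.pos a
    split_ifs with hd
    · obtain ⟨d, hd⟩ := hd
      rw [hd, Int.mul_ediv_cancel_left _ ha.ne']
      have hN : (0 : ℤ) < 2 * m + 1 := by positivity
      have h1 := Int.emod_nonneg (d + m) hN.ne'
      have h2 := Int.emod_lt_of_pos (d + m) hN
      have h3 := Int.emod_add_mul_ediv (d + m) (2 * m + 1)
      have hiff : ∀ k : ℤ, ((a * (2 * m + 1) : ℕ) : ℤ) ∣ q.2 - (a * k + n) ↔
          (2 * m + 1 : ℤ) ∣ d - k := fun k => by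
        have : q.2 - (a * k + n) = a * (d - k) := by linear_combination hd
        rw [this]
        push_cast
        exact mul_dvd_mul_iff_left ha.ne'
      -- The representative of d modulo 2m+1 that lies in [-m, m].
      rw [Finset.sum_eq_single ((d + m) % (2 * m + 1) - m)]
      · have hdd : d = ((d + m) % (2 * m + 1) - m) + (2 * m + 1) * ((d + m) / (2 * m + 1)) := by
          linarith
        rw [if_pos, mul_one]
        · conv_rhs => rw [hdd, circleM_index_add]
        · rw [hiff]
          exact ⟨(d + m) / (2 * m + 1), by linarith⟩
      · intro k hk hne
        rw [if_neg, mul_zero]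
        rw [hiff]
        intro hdv
        apply hne
        simp only [labels, Finset.mem_Icc] at hk
        have hdv2 : (2 * m + 1 : ℤ) ∣ ((d + m) % (2 * m + 1) - m) - k := by
          obtain ⟨e, he⟩ := hdv
          exact ⟨e - (d + m) / (2 * m + 1), by linarith⟩
        have := Int.eq_zero_of_abs_lt_dvd hdv2 (by rw [abs_lt]; constructor <;> linarith)
        linarith
      · intro hk
        exfalso
        apply hk
        simp only [labels, Finset.mem_Icc]
        constructor <;> linarith
    · refine Finset.sum_eq_zero fun k _ => ?_
      rw [if_neg, mul_zero]
      intro h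
      apply hd
      obtain ⟨e, he⟩ := h
      exact ⟨k + (2 * m + 1) * e, by push_cast at he; linarith⟩
  · simp only
    congr 1
    unfold walkOp
    exact tsum_congr fun n => by rw [hind]

end KernelLimit

/-! ### The kernel on ℤ and its nonnegative weights -/

section LatticeKernel

variable (a : ℕ)

theorem abs_martM_le [NeZero a] {t : ℝ} (ht : 0 ≤ t) (k y : ℤ) :
    |martM a k t y| ≤ Real.exp (t * 2) :=
  le_of_tendsto ((tendsto_circleM a t k y).abs) (Eventually.of_forall fun m => abs_circleM_le m a ht k y)

theorem integral_eq_martM (k : ℤ) (t : ℝ) (y : ℤ) :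
    1 / (2 * Real.pi) * ∫ l in (-Real.pi)..Real.pi,
      Real.cos (l * ((y : ℝ) / a - k)) * Real.exp (-t * Real.cos (l / a))
      = Real.exp (-t) * martM a k t y := by
  have h := martM_eq a k t y
  have e : ∀ l : ℝ, Real.cos (l * ((y : ℝ) / a - k)) * Real.exp (t * (1 - Real.cos (l / a)))
      = Real.exp t * (Real.cos (l * ((y : ℝ) / a - k)) * Real.exp (-t * Real.cos (l / a))) := by
    intro l
    rw [show t * (1 - Real.cos (l / a)) = t + -t * Real.cos (l / a) by ring, Real.exp_add]
    ring
  simp_rw [e] at h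
  rw [intervalIntegral.integral_const_mul] at h
  have hp := Real.two_pi_pos
  rw [Real.exp_neg, eq_inv_mul_iff_mul_eq₀ (Real.exp_ne_zero t)]
  rw [mul_left_comm, ← h]
  field_simp

/-- The correlation kernel of the walks weighted by `martM`, obtained from `equidistantKernel` by
transposition and a gauge transformation. -/
noncomputable def latticeKernel (p q : ℝ≥0 × ℤ) : ℝ :=
  Real.exp p.1 * equidistantKernel a q p * (Real.exp q.1)⁻¹

theorem principalMinor_latticeKernel (A : Finset (ℝ≥0 × ℤ)) :
    principalMinor (latticeKernel a) A = principalMinor (equidistantKernel a) A := by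
  rw [← principalMinor_swap (equidistantKernel a)]
  exact principalMinor_gauge (fun p q => equidistantKernel a q p)
    (fun p : ℝ≥0 × ℤ => Real.exp p.1) (fun _ => Real.exp_ne_zero _) A

theorem latticeKernel_eq_tsum (p q : ℝ≥0 × ℤ) :
    latticeKernel a p q = (∑' j : ℤ, martM a j p.1 p.2 * walkProb q.1 (q.2 - a * j)) -
      if p.1 < q.1 then walkProb ((q.1 : ℝ) - p.1) (q.2 - p.2) else 0 := by
  unfold latticeKernel equidistantKernel
  simp_rw [integral_eq_martM]
  rw [mul_sub, sub_mul, ← tsum_mul_left, ← tsum_mul_right]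
  congr 1
  · refine tsum_congr fun j => ?_
    unfold walkProb
    rw [Real.exp_neg, Real.exp_neg]
    have := Real.exp_ne_zero (p.1 : ℝ)
    have := Real.exp_ne_zero (q.1 : ℝ)
    field_simp
  · split_ifs
    · unfold walkProb
      rw [neg_sub, Real.exp_sub]
      field_simp
    · ring

open Classical in
theorem tsum_martM_mul_walkProb [NeZero a] (p q : ℝ≥0 × ℤ) :
    ∑' j : ℤ, martM a j p.1 p.2 * walkProb q.1 (q.2 - a * j)
      = ∑' n : ℤ, walkProb q.1 n *
          if (a : ℤ) ∣ q.2 - n then martM a ((q.2 - n) / a) p.1 p.2 else 0 := by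
  have ha : (a : ℤ) ≠ 0 := by exact_mod_cast NeZero.ne a
  have hinj : Function.Injective fun j : ℤ => q.2 - a * j := fun i j h => by
    exact mul_left_cancel₀ ha (sub_right_injective h)
  rw [← hinj.tsum_eq (f := fun n => walkProb q.1 n *
    if (a : ℤ) ∣ q.2 - n then martM a ((q.2 - n) / a) p.1 p.2 else 0)]
  · refine tsum_congr fun j => ?_
    simp only [sub_sub_cancel, dvd_mul_right, if_true]
    rw [Int.mul_ediv_cancel_left _ ha, mul_comm]
  · intro n hn
    rw [Function.mem_support] at hn
    by_cases hd : (a : ℤ) ∣ q.2 - n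
    · obtain ⟨d, hd⟩ := hd
      exact ⟨d, by simp only; linarith⟩
    · simp [hd] at hn

/-- Dominated convergence against the step distribution: `circleM` is bounded uniformly in m and
converges pointwise, and for each fixed displacement wrapping around the circle becomes impossible
once m is large. -/
theorem tendsto_circle_walkKernel [NeZero a] (T : ℝ≥0) (p q : ℝ≥0 × ℤ) :
    Tendsto (fun m : ℕ => walkKernel (Int.castAddHom (ZMod (a * (2 * m + 1))))
      (fun j => (a : ℤ) * j) (circleFun m a T) T (labels m)
        (p.1, (p.2 : ZMod (a * (2 * m + 1)))) (q.1, (q.2 : ZMod (a * (2 * m + 1))))) atTop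
      (𝓝 (latticeKernel a p q)) := by
  classical
  simp_rw [circle_walkKernel]
  rw [latticeKernel_eq_tsum, tsum_martM_mul_walkProb]
  refine Tendsto.sub ?_ ?_
  · refine tendsto_tsum_of_dominated_convergence
      (bound := fun n => walkProb q.1 n * Real.exp (p.1 * 2))
      ((hasSum_walkProb _).summable.mul_right _) (fun n => Tendsto.const_mul _ ?_)
      (Eventually.of_forall fun m n => ?_)
    · split_ifs
      · exact tendsto_circleM _ _ _ _
      · exact tendsto_const_nhds
    · rw [Real.norm_eq_abs, abs_mul, abs_of_nonneg (walkProb_nonneg q.1.coe_nonneg _)]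
      refine mul_le_mul_of_nonneg_left ?_ (walkProb_nonneg q.1.coe_nonneg _)
      split_ifs
      · exact abs_circleM_le _ _ p.1.coe_nonneg _ _
      · simp [(Real.exp_pos _).le]
  · split_ifs with hpq
    · have hτ : 0 ≤ (q.1 : ℝ) - p.1 := sub_nonneg.2 (NNReal.coe_le_coe.2 hpq.le)
      have e : walkProb ((q.1 : ℝ) - p.1) (q.2 - p.2)
          = ∑' n : ℤ, walkProb ((q.1 : ℝ) - p.1) n * if n = q.2 - p.2 then 1 else 0 := by
        simp
      rw [e]
      refine tendsto_tsum_of_dominated_convergence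
        (bound := fun n => walkProb ((q.1 : ℝ) - p.1) n * 1)
        ((hasSum_walkProb _).summable.mul_right _) (fun n => Tendsto.const_mul _ ?_)
        (Eventually.of_forall fun m n => ?_)
      · refine tendsto_const_nhds.congr' ?_
        filter_upwards [eventually_ge_atTop (q.2 - (p.2 + n)).natAbs] with m hm
        have hiff : n = q.2 - p.2 ↔ ((a * (2 * m + 1) : ℕ) : ℤ) ∣ q.2 - (p.2 + n) := by
          constructor
          · rintro rfl; simp
          · intro h
            have ha : 1 ≤ a := NeZero.one_le
            have hle : m < a * (2 * m + 1) := by nlinarith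
            have := Int.eq_zero_of_abs_lt_dvd h (by
              rw [Int.abs_eq_natAbs]
              exact_mod_cast hm.trans_lt hle)
            linarith
        simp only [hiff]
      · rw [Real.norm_eq_abs, abs_mul, abs_of_nonneg (walkProb_nonneg hτ _)]
        refine mul_le_mul_of_nonneg_left ?_ (walkProb_nonneg hτ _)
        split_ifs <;> simp
    · exact tendsto_const_nhds

/-- For large m the finite set `S` embeds in space-time over the circle, where the weights are
nonnegative; the convergence of kernels carries this to ℤ, and transposition and gauge leave the
minors unchanged. -/
theorem IsIndepRandomWalks.lattice_occupationWeight_nonneg [NeZero a] {Ω : Type*}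
    [MeasurableSpace Ω] {Pr : Measure Ω} [IsProbabilityMeasure Pr] {V : ℤ → ℝ≥0 → Ω → ℤ}
    (hV : IsIndepRandomWalks Pr V fun j => (a : ℤ) * j)
    {S A : Finset (ℝ≥0 × ℤ)} (hA : A ⊆ S) :
    0 ≤ occupationWeight (principalMinor (equidistantKernel a)) S A := by
  classical
  obtain ⟨T, hT⟩ : ∃ T : ℝ≥0, ∀ p ∈ S, p.1 ≤ T :=
    ⟨S.sup fun p => p.1, fun p hp => Finset.le_sup (f := fun p : ℝ≥0 × ℤ => p.1) hp⟩
  have hlim : Tendsto (fun m : ℕ => occupationWeight (principalMinor fun p q : ℝ≥0 × ℤ =>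
      walkKernel (Int.castAddHom (ZMod (a * (2 * m + 1))))
      (fun j => (a : ℤ) * j) (circleFun m a T) T (labels m)
        (p.1, (p.2 : ZMod (a * (2 * m + 1)))) (q.1, (q.2 : ZMod (a * (2 * m + 1))))) S A) atTop
      (𝓝 (occupationWeight (principalMinor (latticeKernel a)) S A)) :=
    tendsto_occupationWeight (fun B => tendsto_principalMinor
      (fun p q => tendsto_circle_walkKernel a T p q) B) S A
  rw [show principalMinor (equidistantKernel a) = principalMinor (latticeKernel a) from
    funext fun B => (principalMinor_latticeKernel a B).symm]
  refine ge_of_tendsto hlim ?_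
  obtain ⟨M, hM⟩ : ∃ M : ℕ, ∀ p ∈ S, ∀ q ∈ S, (q.2 - p.2).natAbs ≤ M :=
    ⟨(S ×ˢ S).sup fun r => (r.2.2 - r.1.2).natAbs, fun p hp q hq =>
      Finset.le_sup (f := fun r : (ℝ≥0 × ℤ) × (ℝ≥0 × ℤ) => (r.2.2 - r.1.2).natAbs)
        (Finset.mk_mem_product hp hq)⟩
  filter_upwards [eventually_ge_atTop M] with m hm
  let e : S ↪ ℝ≥0 × ZMod (a * (2 * m + 1)) :=
    ⟨fun p => (p.1.1, (p.1.2 : ZMod (a * (2 * m + 1)))), fun p q h => by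
      simp only [Prod.mk.injEq] at h
      have h2 := (ZMod.intCast_eq_intCast_iff_dvd_sub _ _ _).1 h.2
      have ha : 1 ≤ a := NeZero.one_le
      have hle : m < a * (2 * m + 1) := by nlinarith
      have := Int.eq_zero_of_abs_lt_dvd h2 (by
        rw [Int.abs_eq_natAbs]
        exact_mod_cast ((hM _ p.2 _ q.2).trans hm).trans_lt hle)
      exact Subtype.ext (Prod.ext h.1 (by linarith))⟩
  have h1 : S = (Finset.univ : Finset S).map (Function.Embedding.subtype _) := by
    ext x; simp
  have h2 : A = (A.subtype (· ∈ S)).map (Function.Embedding.subtype _) := by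
    rw [Finset.subtype_map, Finset.filter_true_of_mem fun x hx => hA hx]
  have h3 := hV.circle_occupationWeight_nonneg m a T (S := (Finset.univ : Finset S).map e)
    (A := (A.subtype (· ∈ S)).map e) (fun p hp => by
      obtain ⟨s, -, rfl⟩ := Finset.mem_map.1 hp
      exact hT _ s.2) (Finset.map_subset_map.2 (Finset.subset_univ _))
  rw [occupationWeight_map] at h3
  refine h3.trans_eq ?_
  conv_rhs => rw [h1, h2, occupationWeight_map]
  simp only [principalMinor_map]
  rfl

theorem IsIndepRandomWalks.exists_hasCorrelations_equidistantKernel [NeZero a] {Ω : Type*}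
    [MeasurableSpace Ω] {Pr : Measure Ω} [IsProbabilityMeasure Pr] {V : ℤ → ℝ≥0 → Ω → ℤ}
    (hV : IsIndepRandomWalks Pr V fun j => (a : ℤ) * j) :
    ∃ P : Measure ConfigPath,
      HasCorrelations P (fun p ω => ω p.1 p.2) (principalMinor (equidistantKernel a)) :=
  exists_process_hasCorrelations _ (principalMinor_empty _)
    fun _ _ h => hV.lattice_occupationWeight_nonneg a h

end LatticeKernel

/-! ### The determinantal martingale representation -/

section MartingaleFunctions

variable (a : ℕ)

/-- The martingale identity on the circle passes to the limit m → ∞. -/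
theorem hasSum_walkProb_mul_martM [NeZero a] {τ T : ℝ} (hτ : 0 ≤ τ) (hT : 0 ≤ T) (k x : ℤ) :
    HasSum (fun n : ℤ => walkProb τ n * martM a k T (x + n)) (martM a k (T - τ) x) := by
  have hs := (summable_walkProb_mul hτ (g := fun n => martM a k T (x + n)) fun n =>
    abs_martM_le a hT k _).hasSum
  have h : Tendsto (fun m : ℕ => ∑' n : ℤ, walkProb τ n * circleM m a T k (x + n)) atTop
      (𝓝 (∑' n : ℤ, walkProb τ n * martM a k T (x + n))) := by
    refine tendsto_tsum_of_dominated_convergence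
      (bound := fun n => walkProb τ n * Real.exp (T * 2))
      ((hasSum_walkProb _).summable.mul_right _)
      (fun n => (tendsto_circleM _ _ _ _).const_mul _) (Eventually.of_forall fun m n => ?_)
    rw [Real.norm_eq_abs, abs_mul, abs_of_nonneg (walkProb_nonneg hτ _)]
    exact mul_le_mul_of_nonneg_left (abs_circleM_le _ _ hT _ _) (walkProb_nonneg hτ _)
  simp_rw [(hasSum_walkProb_mul_circleM _ a τ T k x).tsum_eq] at h
  rw [tendsto_nhds_unique (tendsto_circleM a (T - τ) k x) h]
  exact hs

theorem martM_zero [NeZero a] (k j : ℤ) : martM a k 0 (a * j) = if j = k then 1 else 0 := by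
  refine tendsto_nhds_unique (tendsto_circleM a 0 k (a * j)) (tendsto_const_nhds.congr' ?_)
  filter_upwards [eventually_ge_atTop (j - k).natAbs] with m hm
  rw [circleM_zero]
  rw [Int.abs_eq_natAbs]
  omega

theorem walkOp_id_martM [NeZero a] {τ T : ℝ} (hτ : 0 ≤ τ) (hT : 0 ≤ T) (k x : ℤ) :
    walkOp (AddMonoidHom.id ℤ) τ (martM a k T) x = martM a k (T - τ) x :=
  (hasSum_walkProb_mul_martM a hτ hT k x).tsum_eq

theorem walkOp_id_pointIndicator (τ : ℝ) (x z : ℤ) :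
    walkOp (AddMonoidHom.id ℤ) τ (pointIndicator x) z = walkProb τ (x - z) := by
  unfold walkOp pointIndicator
  rw [tsum_eq_single (x - z)]
  · simp
  · intro n hn
    rw [if_neg, mul_zero]
    intro h
    apply hn
    rw [AddMonoidHom.id_apply] at h
    linarith

theorem sum_walkProb_le_one [NeZero a] {τ : ℝ} (hτ : 0 ≤ τ) (x : ℤ) (s : Finset ℤ) :
    ∑ k ∈ s, walkProb τ (x - a * k) ≤ 1 := by
  have ha : (a : ℤ) ≠ 0 := by exact_mod_cast NeZero.ne a
  have hinj : Function.Injective fun k : ℤ => x - a * k := fun i j h =>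
    mul_left_cancel₀ ha (sub_right_injective h)
  have := sum_le_hasSum (s.map ⟨_, hinj⟩) (fun n _ => walkProb_nonneg hτ n) (hasSum_walkProb τ)
  rwa [Finset.sum_map] at this

theorem summable_martM_mul_walkProb [NeZero a] (p q : ℝ≥0 × ℤ) :
    Summable fun j : ℤ => martM a j p.1 p.2 * walkProb q.1 (q.2 - a * j) := by
  refine Summable.of_norm_bounded (g := fun j : ℤ => Real.exp (p.1 * 2) * walkProb q.1 (q.2 - a * j))
    (Summable.mul_left _ (summable_of_sum_le (fun j => walkProb_nonneg q.1.coe_nonneg _)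
      fun s => sum_walkProb_le_one a q.1.coe_nonneg q.2 s)) fun j => ?_
  rw [Real.norm_eq_abs, abs_mul, abs_of_nonneg (walkProb_nonneg q.1.coe_nonneg _)]
  exact mul_le_mul_of_nonneg_right (abs_martM_le a p.1.coe_nonneg _ _)
    (walkProb_nonneg q.1.coe_nonneg _)

theorem tendsto_labels : Tendsto labels atTop atTop := Finset.tendsto_Icc_neg

theorem tendsto_lattice_walkKernel [NeZero a] (T : ℝ≥0) {p q : ℝ≥0 × ℤ} (hp : p.1 ≤ T) :
    Tendsto (fun m : ℕ => walkKernel (AddMonoidHom.id ℤ) (fun j => (a : ℤ) * j)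
      (fun k => martM a k T) T (labels m) p q) atTop (𝓝 (latticeKernel a p q)) := by
  have h := (summable_martM_mul_walkProb a p q).hasSum.comp tendsto_labels
  rw [latticeKernel_eq_tsum]
  unfold walkKernel
  simp only [walkOp_id_pointIndicator,
    walkOp_id_martM a (sub_nonneg.2 (NNReal.coe_le_coe.2 hp)) T.coe_nonneg, sub_sub_cancel]
  exact h.sub_const _

theorem principalMinor_eq_of_subset {M : ℤ → ℤ → ℝ} {J Λ : Finset ℤ} (h : J ⊆ Λ)
    (hM : ∀ j ∈ Λ, j ∉ J → ∀ k ∈ Λ, M j k = if j = k then 1 else 0) :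
    principalMinor M Λ = principalMinor M J := by
  classical
  have h2 : J = (J.subtype (· ∈ Λ)).map (Function.Embedding.subtype _) := by
    rw [Finset.subtype_map, Finset.filter_true_of_mem fun x hx => h hx]
  rw [h2, principalMinor_map]
  have h3 := Matrix.det_piecewise_one_eq_submatrix_det
    (Matrix.of fun j k : Λ => M j k) (J.subtype (· ∈ Λ))
  have h4 : (Matrix.of <| (J.subtype (· ∈ Λ)).piecewise (Matrix.of fun j k : Λ => M j k).row
      (1 : Matrix Λ Λ ℝ).row) = Matrix.of fun j k : Λ => M j k := by
    ext j k
    by_cases hj : (j : ℤ) ∈ J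
    · simp [Finset.piecewise, hj, Matrix.row]
    · have : (J.subtype (· ∈ Λ)).piecewise (Matrix.of fun j k : Λ => M j k).row
          (1 : Matrix Λ Λ ℝ).row j = (1 : Matrix Λ Λ ℝ).row j :=
        Finset.piecewise_eq_of_notMem _ _ _ (by simpa using hj)
      rw [Matrix.of_apply, this, Matrix.of_apply, hM j j.2 hj k k.2, Matrix.row, Matrix.one_apply]
      exact if_congr Subtype.ext_iff rfl rfl
  rw [h4] at h3
  unfold principalMinor
  convert h3 using 1 <;> congr!

end MartingaleFunctions

/-! ### Sums over labels: consistency and summability -/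

section Representation

set_option linter.unusedSectionVars false

variable {a : ℕ} {Ω : Type*} [MeasurableSpace Ω] {Pr : Measure Ω} {V : ℤ → ℝ≥0 → Ω → ℤ}

theorem IsIndepRandomWalks.integral_prod_mul_detMart [NeZero a] [IsProbabilityMeasure Pr]
    (hV : IsIndepRandomWalks Pr V fun j => (a : ℤ) * j) (Λ : Finset ℤ) (T : ℝ≥0)
    {h : ℤ → (ℝ≥0 → ℤ) → ℝ} (hh : ∀ k, Measurable (h k)) (hb : ∀ k x, |h k x| ≤ 1) :
    Integrable (fun v => (∏ k ∈ Λ, h k fun s => V k s v) * detMart a Λ T fun k => V k T v) Pr ∧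
    ∫ v, (∏ k ∈ Λ, h k fun s => V k s v) * detMart a Λ T (fun k => V k T v) ∂Pr
      = principalMinor (fun j k => ∫ v, (h j fun s => V j s v) * martM a k T (V j T v) ∂Pr) Λ := by
  classical
  have hX : iIndepFun (fun (i : Λ) (v : Ω) (s : ℝ≥0) => V i s v) Pr :=
    hV.indep.precomp Subtype.val_injective
  have := integral_det_of_iIndepFun hX (fun i => measurable_pi_lambda _ fun s => hV.measurable _ s)
    (φ := fun j k x => h j x * martM a k T (x T)) (C := 1 * Real.exp (T * 2))
    (fun j k => (hh _).mul ((Measurable.of_discrete (f := fun x : ℤ => martM a k T x)).comp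
      (measurable_pi_apply T)))
    (fun j k x => by
      rw [abs_mul]
      exact mul_le_mul (hb _ _) (abs_martM_le a T.coe_nonneg _ _) (abs_nonneg _) zero_le_one)
  have e : ∀ v, (∏ k ∈ Λ, h k fun s => V k s v) * detMart a Λ T (fun k => V k T v)
      = (Matrix.of fun j k : Λ => (h j fun s => V j s v) * martM a k T (V j T v)).det := fun v => by
    have := Matrix.det_mul_column (fun j : Λ => h j fun s => V j s v)
      (Matrix.of fun j k : Λ => martM a k T (V j T v))
    simp only [Matrix.of_apply] at this
    rw [this, Finset.prod_coe_sort Λ fun k => h k fun s => V k s v]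
    unfold detMart
    congr!
  simp_rw [e]
  refine ⟨this.1, this.2.trans ?_⟩
  unfold principalMinor
  congr!

/-- A label outside J carries no test function, so its row is E[M^k(T, V_j(T))] = M^k(0, aj) = δ_jk,
a row of the identity. Hence all terms may use the determinant of one large label set Λ. -/
theorem IsIndepRandomWalks.integral_prod_mul_detMart_subset [NeZero a] [IsProbabilityMeasure Pr]
    (hV : IsIndepRandomWalks Pr V fun j => (a : ℤ) * j) {J Λ : Finset ℤ} (hJ : J ⊆ Λ) (T : ℝ≥0)
    {h : ℤ → (ℝ≥0 → ℤ) → ℝ} (hh : ∀ k, Measurable (h k)) (hb : ∀ k x, |h k x| ≤ 1)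
    (h1 : ∀ k, k ∉ J → ∀ x, h k x = 1) :
    ∫ v, (∏ k ∈ J, h k fun s => V k s v) * detMart a J T (fun k => V k T v) ∂Pr
      = ∫ v, (∏ k ∈ J, h k fun s => V k s v) * detMart a Λ T (fun k => V k T v) ∂Pr := by
  have e : ∀ v, (∏ k ∈ J, h k fun s => V k s v) = ∏ k ∈ Λ, h k fun s => V k s v := fun v =>
    Finset.prod_subset hJ fun k _ hk => h1 k hk _
  rw [(hV.integral_prod_mul_detMart J T hh hb).2]
  simp_rw [e]
  rw [(hV.integral_prod_mul_detMart Λ T hh hb).2]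
  refine (principalMinor_eq_of_subset hJ fun j _ hj k _ => ?_).symm
  simp only [h1 j hj, one_mul]
  have := hV.integral_comp j T (AddMonoidHom.id ℤ) (martM a k T) _
    (fun y => abs_martM_le a T.coe_nonneg k y)
  simp only [AddMonoidHom.id_apply] at this
  rw [this, walkOp_id_martM a T.coe_nonneg T.coe_nonneg, sub_self, martM_zero]

/-- The indicator that the walk `j i` is at `x i` at time `t i`, for all `i`. -/
noncomputable def visitInd (V : ℤ → ℝ≥0 → Ω → ℤ) {n : ℕ} (t : Fin n → ℝ≥0) (x j : Fin n → ℤ)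
    (v : Ω) : ℝ :=
  ∏ i, pointIndicator (x i) (V (j i) (t i) v)

theorem visitInd_nonneg {n : ℕ} (t : Fin n → ℝ≥0) (x j : Fin n → ℤ) (v : Ω) :
    0 ≤ visitInd V t x j v :=
  Finset.prod_nonneg fun _ _ => by unfold pointIndicator; split_ifs <;> norm_num

theorem visitInd_le_one {n : ℕ} (t : Fin n → ℝ≥0) (x j : Fin n → ℤ) (v : Ω) :
    visitInd V t x j v ≤ 1 :=
  Finset.prod_le_one (fun _ _ => by unfold pointIndicator; split_ifs <;> norm_num)
    fun _ _ => by unfold pointIndicator; split_ifs <;> norm_num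

theorem IsIndepRandomWalks.measurable_pointIndicator {u : ℤ → ℤ} (hV : IsIndepRandomWalks Pr V u)
    (x j : ℤ) (s : ℝ≥0) : Measurable fun v => pointIndicator x (V j s v) :=
  (Measurable.of_discrete (f := fun y : ℤ => pointIndicator x y)).comp (hV.measurable j s)

theorem IsIndepRandomWalks.integrable_visitInd {u : ℤ → ℤ} [IsProbabilityMeasure Pr]
    (hV : IsIndepRandomWalks Pr V u) {n : ℕ} (t : Fin n → ℝ≥0) (x j : Fin n → ℤ) :
    Integrable (visitInd V t x j) Pr := by
  refine Integrable.of_bound (Finset.measurable_fun_prod _ fun i _ =>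
    hV.measurable_pointIndicator _ _ _).aestronglyMeasurable 1 (Eventually.of_forall fun v => ?_)
  rw [Real.norm_eq_abs, abs_of_nonneg (visitInd_nonneg t x j v)]
  exact visitInd_le_one t x j v

theorem visitInd_eq_prod {n : ℕ} (t : Fin n → ℝ≥0) (x j : Fin n → ℤ) (v : Ω) :
    visitInd V t x j v = ∏ k ∈ Finset.univ.image j, ∏ i with j i = k,
      pointIndicator (x i) (V k (t i) v) := by
  unfold visitInd
  rw [← Finset.prod_fiberwise_of_maps_to (g := j) (t := Finset.univ.image j)
    fun i _ => Finset.mem_image_of_mem j (Finset.mem_univ i)]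
  refine Finset.prod_congr rfl fun k _ => Finset.prod_congr rfl fun i hi => ?_
  rw [(Finset.mem_filter.1 hi).2]

theorem IsIndepRandomWalks.integral_visitInd_mul_detMart [NeZero a] [IsProbabilityMeasure Pr]
    (hV : IsIndepRandomWalks Pr V fun j => (a : ℤ) * j) {n : ℕ} (t : Fin n → ℝ≥0)
    (x j : Fin n → ℤ) (T : ℝ≥0) {Λ : Finset ℤ} (hΛ : Finset.univ.image j ⊆ Λ) :
    ∫ v, visitInd V t x j v * detMart a (Finset.univ.image j) T (fun k => V k T v) ∂Pr
      = ∫ v, visitInd V t x j v * detMart a Λ T (fun k => V k T v) ∂Pr := by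
  simp_rw [visitInd_eq_prod t x j]
  refine hV.integral_prod_mul_detMart_subset hΛ T
    (h := fun k p => ∏ i with j i = k, pointIndicator (x i) (p (t i))) (fun k => ?_) (fun k p => ?_)
    fun k hk p => ?_
  · exact Finset.measurable_fun_prod _ fun i _ =>
      (Measurable.of_discrete (f := fun y : ℤ => pointIndicator (x i) y)).comp
        (measurable_pi_apply (t i))
  · rw [Finset.abs_prod]
    exact Finset.prod_le_one (fun _ _ => abs_nonneg _) fun _ _ => abs_pointIndicator_le _ _
  · refine Finset.prod_eq_one fun i hi => ?_
    exact absurd (Finset.mem_image.2 ⟨i, Finset.mem_univ i, (Finset.mem_filter.1 hi).2⟩) hk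

theorem walkOcc_eq_sum (J : Finset ℤ) (p : ℝ≥0 × ℤ) (v : Ω) :
    (walkOcc (AddMonoidHom.id ℤ) V J p v : ℝ) = ∑ j ∈ J, pointIndicator p.2 (V j p.1 v) := by
  unfold walkOcc pointIndicator
  rw [Finset.card_filter]
  push_cast
  refine Finset.sum_congr rfl fun j _ => ?_
  by_cases h : V j p.1 v = p.2 <;> simp [h]

theorem sum_visitInd {n : ℕ} (t : Fin n → ℝ≥0) (x : Fin n → ℤ) (Λ : Finset ℤ) (v : Ω) :
    ∑ j ∈ Fintype.piFinset fun _ : Fin n => Λ, visitInd V t x j v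
      = ∏ i, (walkOcc (AddMonoidHom.id ℤ) V Λ (t i, x i) v : ℝ) := by
  simp_rw [walkOcc_eq_sum]
  rw [Finset.prod_univ_sum]
  rfl

/-- Bound the product by the n-th power of the sum, one term of n! times the exponential series; the
exponential then factorises over independent walks. -/
theorem prod_le_factorial_mul_exp {n : ℕ} (N : Fin n → ℕ) :
    ∏ i, (N i : ℝ) ≤ (n.factorial : ℝ) * Real.exp (∑ i, (N i : ℝ)) := by
  have h0 : (0 : ℝ) ≤ ∑ i, (N i : ℝ) := Finset.sum_nonneg fun _ _ => Nat.cast_nonneg _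
  have h1 : ∏ i, (N i : ℝ) ≤ (∑ i, (N i : ℝ)) ^ n := by
    refine (Finset.prod_le_prod (fun _ _ => Nat.cast_nonneg _) fun i _ =>
      Finset.single_le_sum (f := fun i => (N i : ℝ)) (fun _ _ => Nat.cast_nonneg _)
        (Finset.mem_univ i)).trans_eq ?_
    simp
  have h2 := Real.pow_div_factorial_le_exp _ h0 n
  rw [div_le_iff₀ (by positivity)] at h2
  linarith

/-- The bound must not depend on Λ. Each walk contributes at most exp(e^n · expected number of its
visits), and the visits to a point sum to at most 1 over all walks, since their starts are distinct.
-/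
theorem IsIndepRandomWalks.sum_integral_visitInd_le [NeZero a] [IsProbabilityMeasure Pr]
    (hV : IsIndepRandomWalks Pr V fun j => (a : ℤ) * j) {n : ℕ} (t : Fin n → ℝ≥0)
    (x : Fin n → ℤ) (Λ : Finset ℤ) :
    ∑ j ∈ Fintype.piFinset fun _ : Fin n => Λ, ∫ v, visitInd V t x j v ∂Pr
      ≤ (n.factorial : ℝ) * Real.exp (Real.exp n * n) := by
  classical
  rw [← integral_finsetSum _ fun j _ => hV.integrable_visitInd t x j]
  simp_rw [sum_visitInd]
  have hX : iIndepFun (fun (i : Λ) (v : Ω) (s : ℝ≥0) => V i s v) Pr :=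
    hV.indep.precomp Subtype.val_injective
  let φ : (ℝ≥0 → ℤ) → ℝ := fun p => Real.exp (∑ i, pointIndicator (x i) (p (t i)))
  have hφ : Measurable φ := Real.measurable_exp.comp (Finset.measurable_fun_sum _ fun i _ =>
      (Measurable.of_discrete (f := fun y : ℤ => pointIndicator (x i) y)).comp
        (measurable_pi_apply (t i)))
  have hφm : ∀ k, Measurable fun v => φ fun s => V k s v := fun k =>
    hφ.comp (measurable_pi_lambda _ fun s => hV.measurable k s)
  have hsum : ∀ p : ℝ≥0 → ℤ, 0 ≤ ∑ i, pointIndicator (x i) (p (t i)) ∧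
      ∑ i, pointIndicator (x i) (p (t i)) ≤ n := fun p => by
    have h : ∀ i, 0 ≤ pointIndicator (x i) (p (t i)) ∧ pointIndicator (x i) (p (t i)) ≤ 1 :=
      fun i => by unfold pointIndicator; split_ifs <;> norm_num
    refine ⟨Finset.sum_nonneg fun i _ => (h i).1, (Finset.sum_le_sum fun i _ => (h i).2).trans_eq ?_⟩
    simp
  have hφb : ∀ p, |φ p| ≤ Real.exp n := fun p => by
    simp only [φ]
    rw [Real.abs_exp]
    exact Real.exp_le_exp.2 (hsum p).2
  -- Without a visit φ = 1; with at least one visit the sum is at least 1 and φ ≤ e^n.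
  have hφ1 : ∀ p, φ p ≤ 1 + Real.exp n * ∑ i, pointIndicator (x i) (p (t i)) := fun p => by
    by_cases h : ∃ i, p (t i) = x i
    · obtain ⟨i, hi⟩ := h
      have h1 : 1 ≤ ∑ i, pointIndicator (x i) (p (t i)) := by
        refine le_trans ?_ (Finset.single_le_sum (f := fun i => pointIndicator (x i) (p (t i)))
          (fun i _ => by unfold pointIndicator; split_ifs <;> norm_num) (Finset.mem_univ i))
        simp [pointIndicator, hi]
      have h2 := (le_abs_self _).trans (hφb p)
      have := mul_le_mul_of_nonneg_left h1 (Real.exp_pos n).le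
      linarith
    · push Not at h
      have : ∑ i, pointIndicator (x i) (p (t i)) = 0 :=
        Finset.sum_eq_zero fun i _ => by simp [pointIndicator, h i]
      simp [φ, this]
  have hφi : ∀ k, Integrable (fun v => φ fun s => V k s v) Pr := fun k =>
    Integrable.of_bound (hφm k).aestronglyMeasurable (Real.exp n)
      (Eventually.of_forall fun v => hφb fun s => V k s v)
  have hint : ∀ k i, Integrable (fun v => pointIndicator (x i) (V k (t i) v)) Pr := fun k i =>
    Integrable.of_bound (hV.measurable_pointIndicator _ _ _).aestronglyMeasurable 1
      (Eventually.of_forall fun v => abs_pointIndicator_le _ _)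
  have hq : ∀ k i, ∫ v, pointIndicator (x i) (V k (t i) v) ∂Pr = walkProb (t i) (x i - a * k) := by
    intro k i
    have := hV.integral_comp k (t i) (AddMonoidHom.id ℤ) (pointIndicator (x i)) 1
      (abs_pointIndicator_le _)
    rw [walkOp_id_pointIndicator] at this
    exact this
  have hone : ∀ k, ∫ v, φ (fun s => V k s v) ∂Pr
      ≤ Real.exp (Real.exp n * ∑ i, walkProb (t i) (x i - a * k)) := fun k => by
    refine (integral_mono (hφi k) ((integrable_const 1).add
      ((integrable_finsetSum Finset.univ fun i _ => hint k i).const_mul (Real.exp n)))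
        fun v => hφ1 fun s => V k s v).trans ?_
    simp only [Pi.add_apply]
    rw [integral_add (integrable_const 1) ((integrable_finsetSum _ fun i _ => hint k i).const_mul _),
      integral_const_mul, integral_finsetSum _ fun i _ => hint k i]
    simp_rw [hq]
    rw [integral_const, probReal_univ, one_smul, add_comm]
    exact Real.add_one_le_exp _
  have hexp : ∀ v, Real.exp (∑ i, (walkOcc (AddMonoidHom.id ℤ) V Λ (t i, x i) v : ℝ))
      = ∏ k : Λ, φ fun s => V k s v := fun v => by
    simp_rw [walkOcc_eq_sum]
    rw [Finset.sum_comm, Real.exp_sum, ← Finset.prod_coe_sort]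
  have hprodi : Integrable (fun v => ∏ k : Λ, φ fun s => V k s v) Pr := by
    refine Integrable.of_bound (Finset.measurable_fun_prod Finset.univ
      fun (k : Λ) _ => hφm k).aestronglyMeasurable
      (∏ _k : Λ, Real.exp n) (Eventually.of_forall fun v => ?_)
    rw [Real.norm_eq_abs, Finset.abs_prod]
    exact Finset.prod_le_prod (fun _ _ => abs_nonneg _) fun i _ => hφb fun s => V i s v
  calc ∫ v, ∏ i, (walkOcc (AddMonoidHom.id ℤ) V Λ (t i, x i) v : ℝ) ∂Pr
      ≤ ∫ v, (n.factorial : ℝ) * ∏ k : Λ, φ (fun s => V k s v) ∂Pr := by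
        refine integral_mono_of_nonneg (Eventually.of_forall fun v =>
          Finset.prod_nonneg fun _ _ => Nat.cast_nonneg _) (hprodi.const_mul _)
          (Eventually.of_forall fun v => ?_)
        simp only
        rw [← hexp]
        exact prod_le_factorial_mul_exp _
    _ = (n.factorial : ℝ) * ∏ k : Λ, ∫ v, φ (fun s => V k s v) ∂Pr := by
        rw [integral_const_mul]
        congr 1
        exact hX.integral_fun_prod_comp (f := fun _ => φ)
          (fun i => (measurable_pi_lambda _ fun s => hV.measurable _ s).aemeasurable)
          fun i => hφ.aestronglyMeasurable
    _ ≤ (n.factorial : ℝ) *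
        ∏ k : Λ, Real.exp (Real.exp n * ∑ i, walkProb (t i) (x i - a * k)) :=
        mul_le_mul_of_nonneg_left (Finset.prod_le_prod
          (fun k _ => integral_nonneg fun v => (Real.exp_pos _).le) fun k _ => hone k)
          (Nat.cast_nonneg _)
    _ ≤ _ := by
        refine mul_le_mul_of_nonneg_left ?_ (Nat.cast_nonneg _)
        rw [← Real.exp_sum, ← Finset.mul_sum]
        refine Real.exp_le_exp.2 (mul_le_mul_of_nonneg_left ?_ (Real.exp_pos _).le)
        rw [Finset.sum_comm]
        refine (Finset.sum_le_sum fun i _ => ?_).trans_eq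
          (show ∑ _i : Fin n, (1 : ℝ) = n by simp)
        rw [Finset.sum_coe_sort Λ fun k => walkProb (t i) (x i - a * k)]
        exact sum_walkProb_le_one a (t i).coe_nonneg (x i) Λ

theorem abs_detMart_le [NeZero a] (T : ℝ≥0) (J : Finset ℤ) {n : ℕ} (hJ : J.card ≤ n) (x : ℤ → ℤ) :
    |detMart a J T x| ≤ (n.factorial : ℝ) * Real.exp (T * 2) ^ n := by
  classical
  have h1 : 1 ≤ Real.exp ((T : ℝ) * 2) := Real.one_le_exp (by positivity)
  have := Matrix.det_le (abv := IsAbsoluteValue.toAbsoluteValue (abs : ℝ → ℝ))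
    (A := Matrix.of fun j k : J => martM a k T (x j)) (x := Real.exp (T * 2))
    (fun j k => abs_martM_le a T.coe_nonneg _ _)
  rw [Fintype.card_coe, nsmul_eq_mul] at this
  unfold detMart
  refine (le_trans (le_of_eq ?_) this).trans (mul_le_mul ?_ (pow_le_pow_right₀ h1 hJ)
    (by positivity) (by positivity))
  · congr!
  · exact_mod_cast Nat.factorial_le hJ

theorem IsIndepRandomWalks.integrable_visitInd_mul_detMart [NeZero a] [IsProbabilityMeasure Pr]
    (hV : IsIndepRandomWalks Pr V fun j => (a : ℤ) * j) {n : ℕ} (t : Fin n → ℝ≥0)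
    (x j : Fin n → ℤ) (T : ℝ≥0) (Λ : Finset ℤ) :
    Integrable (fun v => visitInd V t x j v * detMart a Λ T fun k => V k T v) Pr := by
  have h := (hV.integral_prod_mul_detMart Λ T (h := fun _ _ => 1) (fun _ => measurable_const)
    fun _ _ => by simp).1
  simp only [Finset.prod_const_one, one_mul] at h
  refine h.bdd_mul (c := 1) (hV.integrable_visitInd t x j).aestronglyMeasurable
    (Eventually.of_forall fun v => ?_)
  rw [Real.norm_eq_abs, abs_of_nonneg (visitInd_nonneg t x j v)]
  exact visitInd_le_one t x j v

/-- A term involves at most n labels, so its determinant is bounded independently of which labels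
occur; the visit probabilities are summable by the bound uniform in Λ. -/
theorem IsIndepRandomWalks.summable_integral_visitInd_mul_detMart [NeZero a]
    [IsProbabilityMeasure Pr]
    (hV : IsIndepRandomWalks Pr V fun j => (a : ℤ) * j) {n : ℕ} (t : Fin n → ℝ≥0)
    (x : Fin n → ℤ) (T : ℝ≥0) :
    Summable fun j : Fin n → ℤ => ∫ v, visitInd V t x j v *
      detMart a (Finset.univ.image j) T (fun k => V k T v) ∂Pr := by
  classical
  have hs : Summable fun j : Fin n → ℤ => ∫ v, visitInd V t x j v ∂Pr := by
    refine summable_of_sum_le (fun j => integral_nonneg fun v => visitInd_nonneg t x j v) fun s =>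
      (Finset.sum_le_sum_of_subset_of_nonneg ?_ fun j _ _ =>
        integral_nonneg fun v => visitInd_nonneg t x j v).trans
      (hV.sum_integral_visitInd_le t x (s.biUnion fun j => Finset.univ.image j))
    intro j hj
    rw [Fintype.mem_piFinset]
    exact fun i => Finset.mem_biUnion.2 ⟨j, hj, Finset.mem_image_of_mem j (Finset.mem_univ i)⟩
  refine Summable.of_norm_bounded (hs.mul_left ((n.factorial : ℝ) * Real.exp (T * 2) ^ n))
    fun j => (norm_integral_le_integral_norm _).trans ?_
  rw [← integral_const_mul]
  refine integral_mono (hV.integrable_visitInd_mul_detMart t x j T _).norm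
    ((hV.integrable_visitInd t x j).const_mul _) fun v => ?_
  simp only [norm_mul, Real.norm_eq_abs]
  rw [abs_of_nonneg (visitInd_nonneg t x j v), mul_comm]
  exact mul_le_mul_of_nonneg_right
    (abs_detMart_le T _ (Finset.card_image_le.trans_eq (by simp)) _) (visitInd_nonneg t x j v)

end Representation

/-! ### Equivalence of the martingale representation with the correlation functions -/

section RepresentationTheorem

variable {a : ℕ} {Ω : Type*} [MeasurableSpace Ω] {Pr : Measure Ω} {V : ℤ → ℝ≥0 → Ω → ℤ}

theorem occupationWeight_self {X : Type*} (c : Finset X → ℝ) (S : Finset X) :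
    occupationWeight c S S = c S := by
  classical
  unfold occupationWeight
  rw [Finset.sum_eq_single ∅]
  · simp
  · intro D hD hne
    exfalso
    apply hne
    rw [Finset.mem_powerset] at hD
    refine Finset.subset_empty.1 (hD.trans ?_)
    intro x hx
    simp at hx
  · intro h
    exact absurd (Finset.empty_mem_powerset _) h

theorem IsIndepRandomWalks.integral_prod_walkOcc_mul_detMart [NeZero a] [IsProbabilityMeasure Pr]
    (hV : IsIndepRandomWalks Pr V fun j => (a : ℤ) * j) {n : ℕ} (t : Fin n → ℝ≥0)
    (x : Fin n → ℤ) {T : ℝ≥0} (hT : ∀ i, t i ≤ T) (Λ : Finset ℤ) :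
    ∫ v, (∏ i, (walkOcc (AddMonoidHom.id ℤ) V Λ (t i, x i) v : ℝ)) *
      detMart a Λ T (fun k => V k T v) ∂Pr
      = principalMinor (walkKernel (AddMonoidHom.id ℤ) (fun j => (a : ℤ) * j)
        (fun k => martM a k T) T Λ) (Finset.univ.image fun i => (t i, x i)) := by
  classical
  have h := hV.integral_walkOcc_mul_det (AddMonoidHom.id ℤ) (M := fun k => martM a k T)
    (fun k y => abs_martM_le a T.coe_nonneg k y) Λ T (fun j _ k _ => by
      simp only [AddMonoidHom.id_apply]
      rw [walkOp_id_martM a T.coe_nonneg T.coe_nonneg, sub_self, martM_zero])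
    (Finset.univ.image fun i => (t i, x i)) (fun p hp => by
      obtain ⟨i, -, rfl⟩ := Finset.mem_image.1 hp
      exact hT i) (fun ω => ∏ i, (ω (t i, x i) : ℝ))
  have e : ∀ v, ∏ i, (truncConfig (Finset.univ.image fun i => (t i, x i))
      (fun p => walkOcc (AddMonoidHom.id ℤ) V Λ p v) (t i, x i) : ℝ)
      = ∏ i, (walkOcc (AddMonoidHom.id ℤ) V Λ (t i, x i) v : ℝ) := fun v =>
    Finset.prod_congr rfl fun i _ => by
      unfold truncConfig
      rw [if_pos (Finset.mem_image_of_mem (fun i => (t i, x i)) (Finset.mem_univ i))]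
  simp only [e] at h
  -- The product of occupation numbers vanishes unless all listed points are occupied, so only the
  -- full set survives; repeated points do no harm, as the surviving occupation numbers are 1.
  rw [Finset.sum_eq_single (Finset.univ.image fun i => (t i, x i))] at h
  · rw [occupationWeight_self, Finset.prod_eq_one, mul_one] at h
    · rw [← h]
      congr 1
    · intro i _
      unfold finsetConfig
      rw [if_pos (Finset.mem_image_of_mem (fun i => (t i, x i)) (Finset.mem_univ i)), Nat.cast_one]
  · intro A hA hne
    rw [Finset.mem_powerset] at hA
    obtain ⟨p, hp, hpA⟩ := Finset.exists_of_ssubset (hA.ssubset_of_ne hne)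
    obtain ⟨i, -, rfl⟩ := Finset.mem_image.1 hp
    refine mul_eq_zero_of_right _ (Finset.prod_eq_zero (Finset.mem_univ i) ?_)
    simp [finsetConfig, hpA]
  · intro h
    exact absurd (Finset.mem_powerset_self _) h

-- Summability is known, so the sum may be computed along the boxes of labels in [-m, m]. There all
-- terms share one determinant, the label sum becomes a product of occupation numbers, and its
-- expectation is a principal minor converging with the kernel.
open Classical in
theorem IsIndepRandomWalks.hasSum_integral_visitInd [NeZero a] [IsProbabilityMeasure Pr]
    (hV : IsIndepRandomWalks Pr V fun j => (a : ℤ) * j) {n : ℕ} (t : Fin n → ℝ≥0)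
    (x : Fin n → ℤ) {T : ℝ≥0} (hT : ∀ i, t i ≤ T) :
    HasSum (fun j : Fin n → ℤ => ∫ v, visitInd V t x j v *
      detMart a (Finset.univ.image j) T (fun k => V k T v) ∂Pr)
      (principalMinor (equidistantKernel a) (Finset.univ.image fun i => (t i, x i))) := by
  have h := (hV.summable_integral_visitInd_mul_detMart t x T).hasSum
  have hmono : Monotone labels := fun m m' hmm' => Finset.Icc_subset_Icc (by omega) (by omega)
  have hlim : Tendsto (fun m => Fintype.piFinset fun _ : Fin n => labels m) atTop atTop := by
    refine tendsto_atTop_finset_of_monotone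
      (fun m m' hmm' => Fintype.piFinset_subset _ _ fun _ => hmono hmm') fun j => ?_
    refine ⟨Finset.univ.sup fun i => (j i).natAbs, ?_⟩
    rw [Fintype.mem_piFinset]
    intro i
    have := Finset.le_sup (f := fun i => (j i).natAbs) (Finset.mem_univ i)
    simp only [labels, Finset.mem_Icc]
    omega
  have h1 := h.comp hlim
  have h2 : Tendsto (fun m : ℕ => principalMinor (walkKernel (AddMonoidHom.id ℤ)
      (fun j => (a : ℤ) * j) (fun k => martM a k T) T (labels m))
      (Finset.univ.image fun i => (t i, x i))) atTop
      (𝓝 (principalMinor (latticeKernel a) (Finset.univ.image fun i => (t i, x i)))) := by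
    unfold principalMinor
    simp_rw [Matrix.det_apply]
    refine tendsto_finsetSum _ fun σ _ => (tendsto_finsetProd _ fun p _ => ?_).const_smul _
    obtain ⟨i, -, hi⟩ := Finset.mem_image.1 (σ p).2
    exact tendsto_lattice_walkKernel a T (by rw [← hi]; exact hT i)
  rw [principalMinor_latticeKernel] at h2
  have e : ∀ m, ∑ j ∈ Fintype.piFinset fun _ : Fin n => labels m, ∫ v, visitInd V t x j v *
      detMart a (Finset.univ.image j) T (fun k => V k T v) ∂Pr
      = principalMinor (walkKernel (AddMonoidHom.id ℤ)
      (fun j => (a : ℤ) * j) (fun k => martM a k T) T (labels m))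
      (Finset.univ.image fun i => (t i, x i)) := fun m => by
    rw [← hV.integral_prod_walkOcc_mul_detMart t x hT]
    simp_rw [← sum_visitInd, Finset.sum_mul]
    rw [integral_finsetSum _ fun j _ => hV.integrable_visitInd_mul_detMart t x j T _]
    refine Finset.sum_congr rfl fun j hj => ?_
    rw [Fintype.mem_piFinset] at hj
    convert hV.integral_visitInd_mul_detMart t x j T (Λ := labels m) _ using 5
    intro k hk
    obtain ⟨i, -, rfl⟩ := Finset.mem_image.1 hk
    exact hj i
  have h3 : Tendsto (fun m : ℕ => ∑ j ∈ Fintype.piFinset fun _ : Fin n => labels m,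
      ∫ v, visitInd V t x j v *
      detMart a (Finset.univ.image j) T (fun k => V k T v) ∂Pr) atTop
      (𝓝 (principalMinor (equidistantKernel a) (Finset.univ.image fun i => (t i, x i)))) := by
    simp_rw [e]
    exact h2
  have h4 := tendsto_nhds_unique h3 (by
    refine h1.congr fun m => ?_
    simp only [Function.comp_apply])
  rw [h4]
  convert h using 1

theorem eq_sum_mul_prod_pointIndicator {n : ℕ} (F : (Fin n → ℤ) →₀ ℝ) (y : Fin n → ℤ) :
    F y = ∑ x ∈ F.support, F x * ∏ i, pointIndicator (x i) (y i) := by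
  classical
  simp_rw [prod_pointIndicator]
  simp

open Classical in
theorem HasCorrelations.integral_prod_fin {Ω X : Type*} [MeasurableSpace Ω] {μ : Measure Ω}
    {ν : X → Ω → ℕ} {c : Finset X → ℝ} (h : HasCorrelations μ ν c) {n : ℕ} (p : Fin n → X) :
    Integrable (fun ω => ∏ i, (ν (p i) ω : ℝ)) μ ∧
    ∫ ω, ∏ i, (ν (p i) ω : ℝ) ∂μ = c (Finset.univ.image p) := by
  have hae : (fun ω => ∏ i, (ν (p i) ω : ℝ))
      =ᵐ[μ] fun ω => ∏ q ∈ Finset.univ.image p, (ν q ω : ℝ) := by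
    filter_upwards [h.ae_le_one (Finset.univ.image p)] with ω hω
    rw [← Finset.prod_fiberwise_of_maps_to (g := p) (t := Finset.univ.image p)
      fun i _ => Finset.mem_image_of_mem p (Finset.mem_univ i)]
    refine Finset.prod_congr rfl fun q hq => ?_
    rw [Finset.prod_congr rfl fun i hi => by rw [(Finset.mem_filter.1 hi).2], Finset.prod_const]
    obtain ⟨i, -, hi⟩ := Finset.mem_image.1 hq
    have hcard : (Finset.univ.filter fun i => p i = q).card ≠ 0 :=
      Finset.card_ne_zero_of_mem (Finset.mem_filter.2 ⟨Finset.mem_univ i, hi⟩)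
    have := hω q hq
    obtain h0 | h0 : ν q ω = 0 ∨ ν q ω = 1 := by omega
    · simp [h0, hcard]
    · simp [h0]
  exact ⟨(h.integrable_prod _).congr hae.symm, (integral_congr_ae hae).trans (h.integral_prod _)⟩

theorem IsIndepRandomWalks.isNoncollidingRW [NeZero a] [IsProbabilityMeasure Pr]
    (hV : IsIndepRandomWalks Pr V fun j => (a : ℤ) * j) {P : Measure ConfigPath}
    (hP : HasCorrelations P (fun p ω => ω p.1 p.2) (principalMinor (equidistantKernel a))) :
    IsNoncollidingRW a Pr V P where
  isProbabilityMeasure := hP.isProbabilityMeasure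
  integrable n t F := by
    unfold Finsupp.sum
    exact integrable_finsetSum _ fun x _ =>
      (hP.integral_prod_fin fun i => (t i, x i)).1.const_mul _
  representation n t F T hT := by
    classical
    have e1 : ∫ ω : ConfigPath, F.sum (fun x c => c * ∏ i, (ω (t i) (x i) : ℝ)) ∂P
        = ∑ x ∈ F.support, F x *
          principalMinor (equidistantKernel a) (Finset.univ.image fun i => (t i, x i)) := by
      unfold Finsupp.sum
      rw [integral_finsetSum _ fun x _ =>
        (hP.integral_prod_fin fun i => (t i, x i)).1.const_mul _]
      refine Finset.sum_congr rfl fun x _ => ?_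
      rw [integral_const_mul]
      have := (hP.integral_prod_fin fun i => (t i, x i)).2
      simp only at this
      rw [this]
      congr!
    have e2 : ∀ j : Fin n → ℤ, ∫ v, F (fun i => V (j i) (t i) v)
          * detMart a (Finset.univ.image j) T (fun k => V k T v) ∂Pr
        = ∑ x ∈ F.support, F x * ∫ v, visitInd V t x j v *
          detMart a (Finset.univ.image j) T (fun k => V k T v) ∂Pr := fun j => by
      have e : ∀ v, F (fun i => V (j i) (t i) v) *
          detMart a (Finset.univ.image j) T (fun k => V k T v)
          = ∑ x ∈ F.support, F x * (visitInd V t x j v *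
            detMart a (Finset.univ.image j) T (fun k => V k T v)) := fun v => by
        rw [eq_sum_mul_prod_pointIndicator F, Finset.sum_mul]
        exact Finset.sum_congr rfl fun x _ => mul_assoc _ _ _
      simp_rw [e]
      rw [integral_finsetSum _ fun x _ =>
        (hV.integrable_visitInd_mul_detMart t x j T _).const_mul _]
      exact Finset.sum_congr rfl fun x _ => integral_const_mul _ _
    rw [e1]
    simp_rw [e2]
    refine hasSum_sum fun x _ => HasSum.mul_left _ ?_
    convert hV.hasSum_integral_visitInd t x hT using 1

theorem IsNoncollidingRW.integral_prod [NeZero a] [IsProbabilityMeasure Pr]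
    (hV : IsIndepRandomWalks Pr V fun j => (a : ℤ) * j) {P : Measure ConfigPath}
    (hP : IsNoncollidingRW a Pr V P) {n : ℕ} (p : Fin n → ℝ≥0 × ℤ) :
    Integrable (fun ω : ConfigPath => ∏ i, (ω (p i).1 (p i).2 : ℝ)) P ∧
    ∀ A : Finset (ℝ≥0 × ℤ), (∀ q, q ∈ A ↔ ∃ i, p i = q) →
      ∫ ω : ConfigPath, ∏ i, (ω (p i).1 (p i).2 : ℝ) ∂P = principalMinor (equidistantKernel a) A := by
  classical
  set F : (Fin n → ℤ) →₀ ℝ := Finsupp.single (fun i => (p i).2) 1 with hF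
  have e : (fun ω : ConfigPath => F.sum fun x c => c * ∏ i, (ω (p i).1 (x i) : ℝ))
      = fun ω => ∏ i, (ω (p i).1 (p i).2 : ℝ) := by
    funext ω
    rw [hF, Finsupp.sum_single_index] <;> simp
  have h1 := hP.integrable n (fun i => (p i).1) F
  rw [e] at h1
  refine ⟨h1, fun A hA => ?_⟩
  have hT : ∀ i, (p i).1 ≤ Finset.univ.sup fun i => (p i).1 := fun i =>
    Finset.le_sup (f := fun i => (p i).1) (Finset.mem_univ i)
  have h2 := hP.representation n (fun i => (p i).1) F _ hT
  rw [e] at h2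
  refine h2.unique ?_
  have h3 := hV.hasSum_integral_visitInd (fun i => (p i).1) (fun i => (p i).2) hT
  have hAe : A = Finset.univ.image fun i => ((p i).1, (p i).2) := by
    ext q; simp [hA]
  rw [hAe]
  have e3 : ∀ (j : Fin n → ℤ) v, F (fun i => V (j i) (p i).1 v)
      = visitInd V (fun i => (p i).1) (fun i => (p i).2) j v := fun j v => by
    unfold visitInd
    rw [prod_pointIndicator, hF, Finsupp.single_apply]
    simp only [eq_comm]
  simp_rw [e3]
  convert h3 using 1

/-- The representation with n = 1 and with n = 2 at a repeated point gives the same minor, so E[N² -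
N] = 0 while N² - N ≥ 0 for integers; hence N is 0 or 1. Distinct points then give all correlations.
-/
theorem IsNoncollidingRW.hasCorrelations [NeZero a] [IsProbabilityMeasure Pr]
    (hV : IsIndepRandomWalks Pr V fun j => (a : ℤ) * j) {P : Measure ConfigPath}
    (hP : IsNoncollidingRW a Pr V P) :
    HasCorrelations P (fun p ω => ω p.1 p.2) (principalMinor (equidistantKernel a)) where
  isProbabilityMeasure := hP.isProbabilityMeasure
  measurable p := (measurable_pi_apply p.2).comp (measurable_pi_apply p.1)
  le_one p := by
    have h1 := IsNoncollidingRW.integral_prod hV hP (n := 1) fun _ => p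
    have h2 := IsNoncollidingRW.integral_prod hV hP (n := 2) fun _ => p
    have h3 := h1.2 {p} (by simp [eq_comm])
    have h4 := h2.2 {p} (by simp [eq_comm])
    have i1 := h1.1
    have i2 := h2.1
    simp only [Fin.prod_univ_one, Fin.prod_univ_two] at h3 h4 i1 i2
    have h5 : ∫ ω : ConfigPath, ((ω p.1 p.2 : ℝ) * ω p.1 p.2 - ω p.1 p.2) ∂P = 0 := by
      rw [integral_sub i2 i1, h3, h4, sub_self]
    have hnn : ∀ k : ℕ, (0 : ℝ) ≤ (k : ℝ) * k - k := fun k => by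
      rcases Nat.eq_zero_or_pos k with rfl | hk
      · simp
      · have : (1 : ℝ) ≤ k := by exact_mod_cast hk
        nlinarith
    rw [integral_eq_zero_iff_of_nonneg (fun ω => hnn _) (i2.sub i1)] at h5
    filter_upwards [h5] with ω hω
    simp only [Pi.zero_apply] at hω
    by_contra hcon
    have : (2 : ℝ) ≤ (ω p.1 p.2 : ℝ) := by exact_mod_cast (by omega : 2 ≤ ω p.1 p.2)
    nlinarith
  integral_prod A := by
    have h := (IsNoncollidingRW.integral_prod hV hP fun i => (A.equivFin.symm i : ℝ≥0 × ℤ)).2 A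
      fun q => ⟨fun hq => ⟨A.equivFin ⟨q, hq⟩, by simp⟩, by
        rintro ⟨i, rfl⟩
        exact (A.equivFin.symm i).2⟩
    rw [← h]
    congr 1
    funext ω
    rw [Equiv.prod_comp A.equivFin.symm fun q : A => (ω q.1.1 q.1.2 : ℝ),
      Finset.prod_coe_sort A fun q => (ω q.1 q.2 : ℝ)]

theorem equidistantKernel_zero [NeZero a] (x : ℤ) :
    equidistantKernel a (0, x) (0, x) = if (a : ℤ) ∣ x then 1 else 0 := by
  classical
  have h : latticeKernel a (0, x) (0, x) = equidistantKernel a (0, x) (0, x) := by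
    simp [latticeKernel]
  have ha : (a : ℤ) ≠ 0 := by exact_mod_cast NeZero.ne a
  rw [← h, latticeKernel_eq_tsum, tsum_martM_mul_walkProb]
  simp only [lt_irrefl, if_false, sub_zero, NNReal.coe_zero]
  rw [tsum_eq_single 0 fun n hn => by rw [walkProb_zero, if_neg hn, zero_mul], walkProb_zero,
    if_pos rfl, one_mul, sub_zero]
  split_ifs with hd
  · obtain ⟨d, rfl⟩ := hd
    rw [Int.mul_ediv_cancel_left _ ha, martM_zero, if_pos rfl]
  · rfl

/-- At time 0 the one-point density is 1 on aℤ and 0 elsewhere, and a variable with values in {0,1}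
and mean 0 or 1 is almost surely constant. -/
theorem HasCorrelations.ae_start [NeZero a] {P : Measure ConfigPath}
    (hP : HasCorrelations P (fun p ω => ω p.1 p.2) (principalMinor (equidistantKernel a))) :
    ∀ᵐ ω ∂P, ω 0 = equidistantConfig a := by
  have := hP.isProbabilityMeasure
  have key : ∀ x : ℤ, ∀ᵐ ω ∂P, ω 0 x = equidistantConfig a x := fun x => by
    have h1 := hP.integral_prod {((0 : ℝ≥0), x)}
    have hi := hP.integrable_prod {((0 : ℝ≥0), x)}
    rw [principalMinor_singleton, equidistantKernel_zero] at h1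
    simp only [Finset.prod_singleton] at h1 hi
    unfold equidistantConfig
    split_ifs at h1 ⊢ with hd
    · have h2 : ∫ ω : ConfigPath, (1 - (ω 0 x : ℝ)) ∂P = 0 := by
        rw [integral_sub (integrable_const _) hi, h1]
        simp
      have hnn : 0 ≤ᵐ[P] fun ω : ConfigPath => 1 - (ω 0 x : ℝ) := by
        filter_upwards [hP.le_one (0, x)] with ω hω
        have : (ω 0 x : ℝ) ≤ 1 := by exact_mod_cast hω
        simpa using this
      rw [integral_eq_zero_iff_of_nonneg_ae hnn ((integrable_const _).sub hi)] at h2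
      filter_upwards [h2] with ω hω
      simp only [Pi.zero_apply] at hω
      have : (ω 0 x : ℝ) = 1 := by linarith
      exact_mod_cast this
    · rw [integral_eq_zero_iff_of_nonneg (fun ω => Nat.cast_nonneg _) hi] at h1
      filter_upwards [h1] with ω hω
      simpa using hω
  filter_upwards [ae_all_iff.2 key] with ω hω
  exact funext hω

end RepresentationTheorem

/-! ### Long-time limit of the correlation kernel -/

section Relaxation

variable {a : ℕ}

theorem sum_cos_add_mul [NeZero a] (φ : ℝ) (k : ℤ) :
    ∑ r ∈ Finset.range a, Real.cos (φ + 2 * Real.pi * r * k / a)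
      = if (a : ℤ) ∣ k then a * Real.cos φ else 0 := by
  have ha : (a : ℂ) ≠ 0 := NeZero.ne _
  have ha' : (a : ℝ) ≠ 0 := NeZero.ne _
  set z : ℂ := Complex.exp (2 * Real.pi * Complex.I * (k / a)) with hz
  have hza : z ^ a = 1 := by
    rw [hz, ← Complex.exp_nat_mul, Complex.exp_eq_one_iff]
    exact ⟨k, by field_simp⟩
  split_ifs with hd
  · obtain ⟨d, rfl⟩ := hd
    rw [Finset.sum_congr rfl fun (r : ℕ) _ => show Real.cos (φ + 2 * Real.pi * r * ((a * d : ℤ)) / a)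
      = Real.cos φ from ?_]
    · simp
    · rw [← Real.cos_add_int_mul_two_pi φ (r * d)]
      congr 1
      push_cast
      field_simp
  · have hz1 : z ≠ 1 := by
      rw [hz, Ne, Complex.exp_eq_one_iff]
      rintro ⟨n, hn⟩
      rw [mul_comm (n : ℂ)] at hn
      have h3 := mul_left_cancel₀ Complex.two_pi_I_ne_zero hn
      rw [div_eq_iff ha] at h3
      exact hd ⟨n, by rw [mul_comm]; exact_mod_cast h3⟩
    have hg : ∑ r ∈ Finset.range a, Complex.exp (φ * Complex.I) * z ^ r = 0 := by
      rw [← Finset.mul_sum, geom_sum_eq hz1, hza, sub_self, zero_div, mul_zero]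
    have := congrArg Complex.re hg
    rw [Complex.re_sum, Complex.zero_re] at this
    rw [← this]
    refine Finset.sum_congr rfl fun r _ => ?_
    have e : Complex.exp (φ * Complex.I) * z ^ r
        = Complex.exp ((φ + 2 * Real.pi * r * k / a : ℝ) * Complex.I) := by
      rw [hz, ← Complex.exp_nat_mul, ← Complex.exp_add]
      congr 1
      push_cast
      ring
    rw [e, Complex.exp_ofReal_mul_I_re]

/-- Averaging over the a-th roots of unity selects the indices congruent to x modulo a from the full
Bessel series; root r shifts the angle by 2πr/a. -/
theorem hasSum_besselI_mul_cos_dvd [NeZero a] (s : ℝ) (x y : ℤ) (l : ℝ) :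
    HasSum (fun j : ℤ => besselI (x - a * j).natAbs s * Real.cos (l * ((y : ℝ) / a - j)))
      (1 / a * ∑ r ∈ Finset.range a,
        Real.cos (l / a * (y - x) - 2 * Real.pi * r * x / a) *
          Real.exp (s * Real.cos ((l + 2 * Real.pi * r) / a))) := by
  classical
  have ha : (a : ℤ) ≠ 0 := by exact_mod_cast NeZero.ne a
  have ha' : (a : ℝ) ≠ 0 := NeZero.ne _
  have hinj : Function.Injective fun j : ℤ => x - a * j := fun i j h =>
    mul_left_cancel₀ ha (sub_right_injective h)
  have h := (hasSum_sum fun (r : ℕ) (_ : r ∈ Finset.range a) =>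
    hasSum_besselI_mul_cos s ((l + 2 * Real.pi * r) / a)
      (l / a * (y - x) - 2 * Real.pi * r * x / a)).mul_left (1 / a : ℝ)
  have e : ∀ n : ℤ, 1 / (a : ℝ) * ∑ r ∈ Finset.range a, besselI n.natAbs s *
      Real.cos (n * ((l + 2 * Real.pi * r) / a) + (l / a * (y - x) - 2 * Real.pi * r * x / a))
      = if (a : ℤ) ∣ n - x then besselI n.natAbs s * Real.cos (l / a * (y - x + n)) else 0 := by
    intro n
    have := sum_cos_add_mul (a := a) (l / a * (y - x + n)) (n - x)
    rw [← Finset.mul_sum, Finset.sum_congr rfl fun (r : ℕ) _ => show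
      Real.cos (n * ((l + 2 * Real.pi * r) / a) + (l / a * (y - x) - 2 * Real.pi * r * x / a))
      = Real.cos (l / a * (y - x + n) + 2 * Real.pi * r * ((n - x : ℤ)) / a) by
        congr 1; push_cast; ring, this]
    split_ifs
    · field_simp
    · simp
  simp_rw [e] at h
  rw [← hinj.hasSum_iff] at h
  · refine Eq.mp (congrArg (HasSum · _) (funext fun j => ?_)) h
    simp only [Function.comp_apply]
    rw [if_pos ⟨-j, by ring⟩]
    congr 2
    push_cast
    field_simp
    ring
  · intro n hn
    rw [if_neg]
    rintro ⟨d, hd⟩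
    exact hn ⟨-d, by simp only; linarith⟩

/-- The Fourier components of the correlation kernel. -/
noncomputable def fourierPart (a r : ℕ) (s t : ℝ) (x y : ℤ) : ℝ :=
  1 / (2 * Real.pi * a) * ∫ l in (-Real.pi)..Real.pi,
    Real.cos (l / a * (y - x) - 2 * Real.pi * r * x / a) *
      Real.exp (s * Real.cos ((l + 2 * Real.pi * r) / a) - t * Real.cos (l / a))

theorem equidistantKernel_eq_sum [NeZero a] (p q : ℝ≥0 × ℤ) :
    equidistantKernel a p q = (∑ r ∈ Finset.range a, fourierPart a r p.1 q.1 p.2 q.2)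
      - if q.1 < p.1 then besselI (p.2 - q.2).natAbs ((p.1 : ℝ) - q.1) else 0 := by
  have ha : (a : ℤ) ≠ 0 := by exact_mod_cast NeZero.ne a
  have ha' : (a : ℝ) ≠ 0 := NeZero.ne _
  have hinj : Function.Injective fun j : ℤ => p.2 - a * j := fun i j h =>
    mul_left_cancel₀ ha (sub_right_injective h)
  unfold equidistantKernel
  congr 1
  have hb : Summable fun j : ℤ => |besselI (p.2 - a * j).natAbs p.1| :=
    (summable_abs_besselI p.1).comp_injective hinj
  have hq := q.1.coe_nonneg
  -- The extra factor e^{-t}, with t = q.1, bounds the integrands by 1 as dominated convergence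
  -- requires; it is undone by multiplying with e^t afterwards.
  have h := hasSum_integral_of_summable_abs hb
    (f := fun j l => Real.cos (l * ((q.2 : ℝ) / a - j)) *
      Real.exp (-(q.1 : ℝ) * Real.cos (l / a) - q.1)) (fun j => by fun_prop)
    (fun j l => by
      rw [abs_mul, Real.abs_exp]
      refine mul_le_one₀ (Real.abs_cos_le_one _) (Real.exp_pos _).le (Real.exp_le_one_iff.2 ?_)
      nlinarith [Real.neg_one_le_cos (l / a)])
    (fun l => by
      have := (hasSum_besselI_mul_cos_dvd (a := a) p.1 p.2 q.2 l).mul_right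
        (Real.exp (-(q.1 : ℝ) * Real.cos (l / a) - q.1))
      simp_rw [mul_assoc] at this
      exact this) (-Real.pi) Real.pi
  have e1 : ∀ j : ℤ, ∫ l in (-Real.pi)..Real.pi, Real.cos (l * ((q.2 : ℝ) / a - j)) *
      Real.exp (-(q.1 : ℝ) * Real.cos (l / a) - q.1)
      = (∫ l in (-Real.pi)..Real.pi, Real.cos (l * ((q.2 : ℝ) / a - j)) *
        Real.exp (-(q.1 : ℝ) * Real.cos (l / a))) * Real.exp (-q.1) := fun j => by
    rw [← intervalIntegral.integral_mul_const]
    congr 1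
    funext l
    rw [mul_assoc, ← Real.exp_add, ← sub_eq_add_neg]
  simp_rw [e1] at h
  have h2 := h.mul_left (1 / (2 * Real.pi) * Real.exp q.1)
  have e2 : ∀ j : ℤ, 1 / (2 * Real.pi) * Real.exp q.1 * (besselI (p.2 - a * j).natAbs p.1 *
      ((∫ l in (-Real.pi)..Real.pi, Real.cos (l * ((q.2 : ℝ) / a - j)) *
        Real.exp (-(q.1 : ℝ) * Real.cos (l / a))) * Real.exp (-q.1)))
      = besselI (p.2 - a * j).natAbs p.1 * (1 / (2 * Real.pi) *
        ∫ l in (-Real.pi)..Real.pi, Real.cos (l * ((q.2 : ℝ) / a - j)) *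
        Real.exp (-(q.1 : ℝ) * Real.cos (l / a))) := fun j => by
    generalize ∫ l in (-Real.pi)..Real.pi, Real.cos (l * ((q.2 : ℝ) / a - j)) *
      Real.exp (-(q.1 : ℝ) * Real.cos (l / a)) = I
    rw [Real.exp_neg]
    have := Real.exp_ne_zero (q.1 : ℝ)
    field_simp
  simp_rw [e2] at h2
  rw [h2.tsum_eq]
  unfold fourierPart
  rw [← Finset.mul_sum, ← intervalIntegral.integral_finsetSum fun r _ =>
    Continuous.intervalIntegrable (by fun_prop) _ _, mul_assoc,
    ← intervalIntegral.integral_const_mul, ← intervalIntegral.integral_const_mul,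
    ← intervalIntegral.integral_const_mul]
  congr 1
  funext l
  simp_rw [Finset.mul_sum, Finset.sum_mul, Finset.mul_sum]
  refine Finset.sum_congr rfl fun r _ => ?_
  rw [sub_eq_add_neg (p.1 * _ : ℝ), sub_eq_add_neg (-(q.1 : ℝ) * _), Real.exp_add, Real.exp_add,
    Real.exp_neg (q.1 : ℝ), neg_mul]
  have := Real.exp_ne_zero (q.1 : ℝ)
  field_simp

theorem integral_comp_div_of_even {H : ℝ → ℝ} (hH : Continuous H) (heven : ∀ x, H (-x) = H x)
    {c : ℝ} (hc : 0 < c) :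
    1 / (2 * Real.pi * c) * ∫ l in (-Real.pi)..Real.pi, H (l / c)
      = ∫ u in (0 : ℝ)..1 / c, H (u * Real.pi) := by
  have hpi := Real.pi_pos
  have h1 : ∫ l in (-Real.pi)..0, H (l / c) = ∫ l in (0 : ℝ)..Real.pi, H (l / c) := by
    have := intervalIntegral.integral_comp_neg (a := 0) (b := Real.pi) fun l => H (l / c)
    rw [neg_zero] at this
    rw [← this]
    simp_rw [neg_div, heven]
  have hi : ∀ u v, IntervalIntegrable (fun l => H (l / c)) volume u v := fun u v =>
    Continuous.intervalIntegrable (by fun_prop) _ _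
  rw [← intervalIntegral.integral_add_adjacent_intervals (hi _ 0) (hi 0 _), h1,
    intervalIntegral.integral_comp_div _ hc.ne', intervalIntegral.integral_comp_mul_right _ hpi.ne']
  simp only [zero_div, zero_mul, smul_eq_mul]
  rw [one_div_mul_eq_div, one_div_mul_eq_div]
  field_simp
  ring

theorem fourierPart_zero [NeZero a] (s t : ℝ) (x y : ℤ) :
    fourierPart a 0 s t x y = ∫ u in (0 : ℝ)..1 / a,
      Real.cos (u * Real.pi * (y - x : ℤ)) * Real.exp (-(t - s) * Real.cos (u * Real.pi)) := by
  have ha : (0 : ℝ) < a := Nat.cast_pos.2 (NeZero.pos a)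
  have h := integral_comp_div_of_even (H := fun v => Real.cos (v * (y - x : ℤ)) *
    Real.exp (-(t - s) * Real.cos v)) (by fun_prop) (fun v => by
      rw [neg_mul, Real.cos_neg, Real.cos_neg]) ha
  rw [← h]
  unfold fourierPart
  congr 2
  funext l
  simp only [Nat.cast_zero, mul_zero, zero_mul, zero_div, sub_zero, add_zero]
  push_cast
  congr 2
  ring

theorem integral_cos_eq_sineKernel (ρ : ℝ) (n : ℤ) :
    ∫ u in (0 : ℝ)..ρ, Real.cos (u * Real.pi * n) = sineKernel ρ n := by
  unfold sineKernel
  split_ifs with hn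
  · subst hn; simp
  · have hn' : (n : ℝ) ≠ 0 := by exact_mod_cast hn
    have hp : Real.pi * n ≠ 0 := mul_ne_zero Real.pi_ne_zero hn'
    simp_rw [mul_assoc _ Real.pi]
    rw [intervalIntegral.integral_comp_mul_right (fun v => Real.cos v) hp, integral_cos]
    simp only [zero_mul, Real.sin_zero, sub_zero, smul_eq_mul]
    rw [inv_mul_eq_div]

theorem besselI_eq_integral_zero_one (n : ℤ) (z : ℝ) :
    besselI n.natAbs z
      = ∫ u in (0 : ℝ)..1, Real.cos (u * Real.pi * n) * Real.exp (z * Real.cos (u * Real.pi)) := by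
  have h := integral_comp_div_of_even (H := fun v => Real.cos (v * n) *
    Real.exp (z * Real.cos v)) (by fun_prop) (fun v => by
      rw [neg_mul, Real.cos_neg, Real.cos_neg]) one_pos
  have h2 := besselI_eq_integral n z
  simp only [div_one, mul_one, mul_comm _ (n : ℝ)] at h
  rw [← h2] at h
  simp only [mul_comm _ (n : ℝ)]
  rw [← h]
  have := Real.pi_ne_zero
  field_simp

/-- Mode 0 is the integral over [0, 1/a] and the Bessel term is the same integrand over [0, 1]; for
s > t the difference is minus the integral over the complementary interval. -/
theorem fourierPart_zero_sub [NeZero a] (s t : ℝ) (x y : ℤ) :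
    (fourierPart a 0 s t x y - if t < s then besselI (x - y).natAbs (s - t) else 0)
      = extSineKernel (1 / a) (t - s) (y - x) := by
  rw [fourierPart_zero]
  unfold extSineKernel
  rcases lt_trichotomy s t with h | h | h
  · rw [if_neg h.not_gt, if_pos (sub_pos.2 h), sub_zero]
  · subst h
    rw [if_neg (lt_irrefl _), sub_self, if_neg (lt_irrefl _), if_pos rfl, sub_zero,
      ← integral_cos_eq_sineKernel]
    simp
  · rw [if_pos h, if_neg (by linarith), if_neg (by linarith)]
    have hn : (x - y).natAbs = (y - x).natAbs := by omega
    rw [hn, besselI_eq_integral_zero_one]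
    have hi : ∀ u v : ℝ, IntervalIntegrable (fun u : ℝ => Real.cos (u * Real.pi * (y - x : ℤ)) *
        Real.exp (-(t - s) * Real.cos (u * Real.pi))) volume u v := fun u v =>
      Continuous.intervalIntegrable (by fun_prop) _ _
    rw [neg_sub] at hi ⊢
    rw [← intervalIntegral.integral_add_adjacent_intervals (hi 0 (1 / a)) (hi (1 / a) 1)]
    ring

/-- The difference is 2 sin((l + πr)/a) sin(πr/a), and both angles lie strictly between 0 and π. -/
theorem cos_lt_cos_of_mode [NeZero a] {r : ℕ} (hr : 1 ≤ r) (hra : r < a) {l : ℝ}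
    (h1 : -Real.pi < l) (h2 : l < Real.pi) :
    Real.cos ((l + 2 * Real.pi * r) / a) < Real.cos (l / a) := by
  have ha : (0 : ℝ) < a := Nat.cast_pos.2 (NeZero.pos a)
  have hpi := Real.pi_pos
  have hr' : (1 : ℝ) ≤ r := by exact_mod_cast hr
  have hra' : (r : ℝ) + 1 ≤ a := by exact_mod_cast hra
  have e : Real.cos (l / a) - Real.cos ((l + 2 * Real.pi * r) / a)
      = 2 * Real.sin ((l + Real.pi * r) / a) * Real.sin (Real.pi * r / a) := by
    rw [show l / a = (l + Real.pi * r) / a - Real.pi * r / a by ring,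
      show (l + 2 * Real.pi * r) / a = (l + Real.pi * r) / a + Real.pi * r / a by ring,
      Real.cos_sub, Real.cos_add]
    ring
  have s1 : 0 < Real.sin ((l + Real.pi * r) / a) := by
    refine Real.sin_pos_of_pos_of_lt_pi (div_pos (by nlinarith) ha) ?_
    rw [div_lt_iff₀ ha]
    nlinarith
  have s2 : 0 < Real.sin (Real.pi * r / a) := by
    refine Real.sin_pos_of_pos_of_lt_pi (by positivity) ?_
    rw [div_lt_iff₀ ha]
    nlinarith
  have := mul_pos (mul_pos two_pos s1) s2
  linarith

theorem tendsto_fourierPart_bound [NeZero a] {r : ℕ} (hr : 1 ≤ r) (hra : r < a) (s t : ℝ≥0) :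
    Tendsto (fun τ : ℝ≥0 => 1 / (2 * Real.pi * a) * ∫ l in (-Real.pi)..Real.pi,
      Real.exp (((s : ℝ) + τ) * Real.cos ((l + 2 * Real.pi * r) / a)
        - ((t : ℝ) + τ) * Real.cos (l / a))) atTop (𝓝 0) := by
  have hpi := Real.pi_pos
  rw [show (0 : ℝ) = 1 / (2 * Real.pi * a) * ∫ l in (-Real.pi)..Real.pi, (0 : ℝ) by simp]
  refine Tendsto.const_mul _ ?_
  -- At l = π the mode r = a - 1 ties with mode 0, so this endpoint is discarded; -π is already
  -- outside the half-open interval.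
  have hae : ∀ᵐ l : ℝ, l ≠ Real.pi := compl_mem_ae_iff.2 (measure_singleton _)
  have hs := s.coe_nonneg
  have ht := t.coe_nonneg
  refine intervalIntegral.tendsto_integral_filter_of_dominated_convergence
    (fun _ => Real.exp (s + t)) (Eventually.of_forall fun τ => ?_) (Eventually.of_forall fun τ => ?_)
    intervalIntegrable_const ?_
  · exact (Continuous.aestronglyMeasurable (by fun_prop))
  · filter_upwards [hae] with l hl hl2
    rw [Set.uIoc_of_le (by linarith)] at hl2
    have hc := cos_lt_cos_of_mode hr hra hl2.1 (lt_of_le_of_ne hl2.2 hl)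
    rw [Real.norm_eq_abs, Real.abs_exp]
    refine Real.exp_le_exp.2 ?_
    have := τ.coe_nonneg
    nlinarith [Real.cos_le_one ((l + 2 * Real.pi * r) / a), Real.neg_one_le_cos (l / a),
      mul_nonneg this (sub_nonneg.2 hc.le)]
  · filter_upwards [hae] with l hl hl2
    rw [Set.uIoc_of_le (by linarith)] at hl2
    have hc := cos_lt_cos_of_mode hr hra hl2.1 (lt_of_le_of_ne hl2.2 hl)
    have hτ : Tendsto (fun τ : ℝ≥0 => (τ : ℝ)) atTop atTop := NNReal.tendsto_coe_atTop.2 tendsto_id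
    refine Real.tendsto_exp_atBot.comp ?_
    have h := tendsto_atBot_add_const_left atTop
      ((s : ℝ) * Real.cos ((l + 2 * Real.pi * r) / a) - t * Real.cos (l / a))
      (hτ.atTop_mul_const_of_neg (sub_neg.2 hc))
    refine h.congr fun τ => ?_
    ring

theorem abs_fourierPart_le (r : ℕ) (s t : ℝ) (x y : ℤ) :
    |fourierPart a r s t x y| ≤ 1 / (2 * Real.pi * a) * ∫ l in (-Real.pi)..Real.pi,
      Real.exp (s * Real.cos ((l + 2 * Real.pi * r) / a) - t * Real.cos (l / a)) := by
  have hpi := Real.pi_pos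
  unfold fourierPart
  rw [abs_mul, abs_of_nonneg (by positivity)]
  refine mul_le_mul_of_nonneg_left ?_ (by positivity)
  refine (intervalIntegral.abs_integral_le_integral_abs (by linarith)).trans ?_
  refine intervalIntegral.integral_mono_on (by linarith)
    (Continuous.intervalIntegrable (by fun_prop) _ _)
    (Continuous.intervalIntegrable (by fun_prop) _ _) fun l _ => ?_
  rw [abs_mul, Real.abs_exp]
  exact mul_le_of_le_one_left (Real.exp_pos _).le (Real.abs_cos_le_one _)

/-- A common time shift leaves mode 0 and the Bessel term unchanged, so the error is the sum of the
modes r ≥ 1; their bound discards the oscillating cosine and with it the dependence on x and y. -/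
theorem tendstoUniformly_equidistantKernel [NeZero a] (s t : ℝ≥0) :
    TendstoUniformly
      (fun (τ : ℝ≥0) (z : ℤ × ℤ) => equidistantKernel a (s + τ, z.1) (t + τ, z.2))
      (fun z : ℤ × ℤ => extSineKernel (1 / (a : ℝ)) ((t : ℝ) - s) (z.2 - z.1)) atTop := by
  have hlim := tendsto_finsetSum (Finset.Ico 1 a) fun r hr =>
    tendsto_fourierPart_bound (Finset.mem_Ico.1 hr).1 (Finset.mem_Ico.1 hr).2 s t
  rw [Finset.sum_const_zero] at hlim
  rw [Metric.tendstoUniformly_iff]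
  intro ε hε
  filter_upwards [hlim.eventually (gt_mem_nhds hε)] with τ hτ z
  refine lt_of_le_of_lt ?_ hτ
  have ha : 0 < a := NeZero.pos a
  rw [dist_comm, Real.dist_eq, equidistantKernel_eq_sum, ← fourierPart_zero_sub,
    Finset.range_eq_Ico, Finset.sum_eq_sum_Ico_succ_bot ha]
  have e0 : fourierPart a 0 ((s + τ : ℝ≥0) : ℝ) ((t + τ : ℝ≥0) : ℝ) z.1 z.2
      = fourierPart a 0 s t z.1 z.2 := by
    rw [fourierPart_zero, fourierPart_zero]
    push_cast
    rw [add_sub_add_right_eq_sub]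
  have e1 : (if t + τ < s + τ then
      besselI (z.1 - z.2).natAbs (((s + τ : ℝ≥0) : ℝ) - ((t + τ : ℝ≥0) : ℝ)) else 0)
      = if (t : ℝ) < s then besselI (z.1 - z.2).natAbs ((s : ℝ) - t) else 0 := by
    push_cast
    rw [add_sub_add_right_eq_sub]
    simp only [add_lt_add_iff_right, NNReal.coe_lt_coe]
  simp only
  rw [e0, e1, add_sub_right_comm, add_sub_cancel_left]
  refine (Finset.abs_sum_le_sum_abs _ _).trans (Finset.sum_le_sum fun r _ => ?_)
  have := abs_fourierPart_le (a := a) r ((s + τ : ℝ≥0) : ℝ) ((t + τ : ℝ≥0) : ℝ) z.1 z.2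
  push_cast at this ⊢
  exact this

end Relaxation

/-! ### The stationary process -/

section Stationary

theorem HasCorrelations.comp_embedding {Ω X Y : Type*} [MeasurableSpace Ω] {μ : Measure Ω}
    {n : X → Ω → ℕ} {c : Finset X → ℝ} (h : HasCorrelations μ n c) (e : Y ↪ X) :
    HasCorrelations μ (fun y => n (e y)) fun A => c (A.map e) where
  isProbabilityMeasure := h.isProbabilityMeasure
  measurable y := h.measurable _
  le_one y := h.le_one _
  integral_prod A := by
    rw [← h.integral_prod (A.map e)]
    simp only [Finset.prod_map]

theorem HasCorrelations.comp_injective_minor {Ω X Y : Type*} [MeasurableSpace Ω] {μ : Measure Ω}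
    {n : X → Ω → ℕ} {K : X → X → ℝ} (h : HasCorrelations μ n (principalMinor K)) {e : Y → X}
    (he : Function.Injective e) :
    HasCorrelations μ (fun y => n (e y)) (principalMinor fun p q => K (e p) (e q)) := by
  have := h.comp_embedding ⟨e, he⟩
  simp only [principalMinor_map] at this
  exact this

/-- The extended sine kernel as a kernel on space-time. -/
noncomputable def sineSpaceTime (ρ : ℝ) (p q : ℝ≥0 × ℤ) : ℝ :=
  extSineKernel ρ ((q.1 : ℝ) - p.1) (q.2 - p.2)

theorem extSineKernel_neg (ρ τ : ℝ) (n : ℤ) : extSineKernel ρ τ (-n) = extSineKernel ρ τ n := by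
  have h : ∀ u : ℝ, Real.cos (u * Real.pi * ((-n : ℤ) : ℝ)) = Real.cos (u * Real.pi * n) := fun u => by
    rw [Int.cast_neg, mul_neg, Real.cos_neg]
  unfold extSineKernel
  simp_rw [h, ← integral_cos_eq_sineKernel, h]

theorem extSineKernel_zero (ρ : ℝ) (n : ℤ) : extSineKernel ρ 0 n = sineKernel ρ n := by
  simp [extSineKernel]

theorem measurable_configProcess {S : Type*} (p : S × ℤ) :
    Measurable fun ω : S → Config => ω p.1 p.2 :=
  (measurable_pi_apply p.2).comp (measurable_pi_apply p.1)

theorem HasCorrelations.timeShift {K : ℝ≥0 × ℤ → ℝ≥0 × ℤ → ℝ} {P : Measure ConfigPath}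
    (h : HasCorrelations P (fun p ω => ω p.1 p.2) (principalMinor K)) (τ : ℝ≥0) :
    HasCorrelations P (fun (p : ℝ≥0 × ℤ) ω => ω (p.1 + τ) p.2)
      (principalMinor fun p q : ℝ≥0 × ℤ => K (p.1 + τ, p.2) (q.1 + τ, q.2)) :=
  h.comp_injective_minor (e := fun p : ℝ≥0 × ℤ => (p.1 + τ, p.2)) fun p q h => by
    simp only [Prod.mk.injEq, add_left_inj] at h
    exact Prod.ext h.1 h.2

/-! ### From convergence of kernels to existence and convergence of processes -/

section Limit

variable {P Q : Measure ConfigPath} {K K' : ℝ≥0 × ℤ → ℝ≥0 × ℤ → ℝ}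

theorem exists_limit_process
    (hP : HasCorrelations P (fun p ω => ω p.1 p.2) (principalMinor K))
    (hK : ∀ p q, Tendsto (fun τ : ℝ≥0 => K (p.1 + τ, p.2) (q.1 + τ, q.2)) atTop (𝓝 (K' p q))) :
    ∃ Q : Measure ConfigPath, HasCorrelations Q (fun p ω => ω p.1 p.2) (principalMinor K') :=
  exists_process_hasCorrelations _ (principalMinor_empty _) fun S A _ =>
    ge_of_tendsto' (tendsto_occupationWeight (fun B => tendsto_principalMinor hK B) S A)
      fun τ => (hP.timeShift τ).occupationWeight_nonneg S A

theorem relaxesTo_of_tendsto_kernel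
    (hP : HasCorrelations P (fun p ω => ω p.1 p.2) (principalMinor K))
    (hQ : HasCorrelations Q (fun p ω => ω p.1 p.2) (principalMinor K'))
    (hK : ∀ p q, Tendsto (fun τ : ℝ≥0 => K (p.1 + τ, p.2) (q.1 + τ, q.2)) atTop (𝓝 (K' p q))) :
    RelaxesTo P Q := by
  classical
  intro m t F
  -- Restricting to the finitely many times involved makes the index set countable, as needed to
  -- have all occupation numbers at most 1 simultaneously almost surely.
  let I : Finset ℝ≥0 := Finset.univ.image t
  have hI : ∀ i, t i ∈ I := fun i => Finset.mem_image_of_mem t (Finset.mem_univ i)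
  let e : I × ℤ → ℝ≥0 × ℤ := fun p => (p.1, p.2)
  have he : Function.Injective e := fun p q h => by
    simp only [e, Prod.mk.injEq] at h
    exact Prod.ext (Subtype.ext h.1) h.2
  have hFm : Measurable F := F.continuous.measurable
  have hG : Continuous fun ξ : I × ℤ → ℕ => F fun i x => ξ (⟨t i, hI i⟩, x) := by fun_prop
  exact HasCorrelations.tendsto_integral (fun τ => (hP.timeShift τ).comp_injective_minor he)
    (hQ.comp_injective_minor he)
    (fun A => tendsto_principalMinor (fun p q => hK (e p) (e q)) A) hG
    (fun ξ => F.norm_coe_le_norm _)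
    (fun τ => (hFm.comp (measurable_pi_lambda (fun (ω : ConfigPath) i => ω (t i + τ))
      fun i => measurable_pi_apply _)).aestronglyMeasurable)
    (hFm.comp (measurable_pi_lambda (fun (ω : ConfigPath) i => ω (t i))
      fun i => measurable_pi_apply _)).aestronglyMeasurable
    inferInstance

end Limit

variable {Q : Measure ConfigPath} {ρ : ℝ}

theorem HasCorrelations.map_eval (hQ : HasCorrelations Q (fun p ω => ω p.1 p.2)
    (principalMinor (sineSpaceTime ρ))) (t : ℝ≥0) :
    HasCorrelations (Q.map fun ω => ω t) (fun x ξ => ξ x)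
      (principalMinor fun x y : ℤ => sineKernel ρ (y - x)) := by
  rw [HasCorrelations.map (measurable_pi_apply t) fun x => measurable_pi_apply x]
  have h := hQ.comp_injective_minor (e := fun x : ℤ => (t, x)) fun x y h => (Prod.mk.inj h).2
  simp only [sineSpaceTime, sub_self, extSineKernel_zero] at h
  exact h

theorem HasCorrelations.isStationaryProcess (hQ : HasCorrelations Q (fun p ω => ω p.1 p.2)
    (principalMinor (sineSpaceTime ρ))) : IsStationaryProcess Q := by
  intro τ
  have hm : Measurable fun (ω : ConfigPath) (t : ℝ≥0) => ω (t + τ) :=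
    measurable_pi_lambda _ fun t => measurable_pi_apply _
  refine HasCorrelations.process_eq (c := principalMinor (sineSpaceTime ρ)) ?_ hQ
  rw [HasCorrelations.map hm measurable_configProcess]
  have h := hQ.timeShift τ
  simp only [sineSpaceTime, NNReal.coe_add, add_sub_add_right_eq_sub] at h
  exact h

theorem HasCorrelations.integral_eq_density (hQ : HasCorrelations Q (fun p ω => ω p.1 p.2)
    (principalMinor (sineSpaceTime ρ))) (t : ℝ≥0) (x : ℤ) : ∫ ω, (ω t x : ℝ) ∂Q = ρ := by
  have h := hQ.integral_prod {(t, x)}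
  rw [principalMinor_singleton] at h
  simpa [sineSpaceTime, extSineKernel_zero, sineKernel] using h

theorem HasCorrelations.map_reverse_eq (hQ : HasCorrelations Q (fun p ω => ω p.1 p.2)
    (principalMinor (sineSpaceTime ρ))) (T : ℝ≥0) :
    Q.map (fun ω (t : Set.Iic T) => ω (T - t)) = Q.map (fun ω (t : Set.Iic T) => ω t) := by
  have hm1 : Measurable fun (ω : ConfigPath) (t : Set.Iic T) => ω (T - t) :=
    measurable_pi_lambda _ fun t => measurable_pi_apply _
  have hm2 : Measurable fun (ω : ConfigPath) (t : Set.Iic T) => ω t :=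
    measurable_pi_lambda _ fun t => measurable_pi_apply _
  -- Truncated subtraction in `ℝ≥0` makes t ↦ T - t injective only on [0, T].
  have h1 : Function.Injective fun p : Set.Iic T × ℤ => (T - (p.1 : ℝ≥0), p.2) := fun p q h => by
    simp only [Prod.mk.injEq] at h
    exact Prod.ext (Subtype.ext ((tsub_right_inj (Set.mem_Iic.1 p.1.2) (Set.mem_Iic.1 q.1.2)).1
      h.1)) h.2
  have h2 : Function.Injective fun p : Set.Iic T × ℤ => ((p.1 : ℝ≥0), p.2) := fun p q h => by
    simp only [Prod.mk.injEq] at h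
    exact Prod.ext (Subtype.ext h.1) h.2
  refine HasCorrelations.process_eq
    (c := principalMinor fun p q : Set.Iic T × ℤ => sineSpaceTime ρ (p.1, p.2) (q.1, q.2)) ?_ ?_
  · rw [HasCorrelations.map hm1 measurable_configProcess]
    have h := hQ.comp_injective_minor h1
    have e : (principalMinor fun p q : Set.Iic T × ℤ =>
          sineSpaceTime ρ (T - (p.1 : ℝ≥0), p.2) (T - (q.1 : ℝ≥0), q.2))
        = principalMinor fun p q : Set.Iic T × ℤ => sineSpaceTime ρ (p.1, p.2) (q.1, q.2) := by
      funext A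
      -- Reversal changes the sign of the time difference. Transposing the kernel changes it back at
      -- the cost of the sign of the space difference, in which the kernel is even.
      rw [← principalMinor_swap]
      congr 1
      funext p q
      simp only [sineSpaceTime]
      rw [NNReal.coe_sub (Set.mem_Iic.1 p.1.2), NNReal.coe_sub (Set.mem_Iic.1 q.1.2),
        sub_sub_sub_cancel_left, ← extSineKernel_neg, neg_sub]
    rw [e] at h
    exact h
  · rw [HasCorrelations.map hm2 measurable_configProcess]
    exact hQ.comp_injective_minor h2

end Stationary
-- Assembly of the theorem
theorem mainTheorem4 (a : ℕ) (ha : 2 ≤ a)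
    {Ω : Type*} [MeasurableSpace Ω] (Pr : Measure Ω) [IsProbabilityMeasure Pr]
    (V : ℤ → ℝ≥0 → Ω → ℤ) (hV : IsIndepRandomWalks Pr V (fun j => (a : ℤ) * j)) :
    ∃ (P Q : Measure ConfigPath) (μ : Measure Config),
      -- `P` is the law of the noncolliding random walk started at `∑_k δ_{a k}`
      IsNoncollidingRW a Pr V P ∧
      (∀ P' : Measure ConfigPath, IsNoncollidingRW a Pr V P' → P' = P) ∧
      (∀ᵐ ω ∂P, ω 0 = equidistantConfig a) ∧
      -- `Q` is the law of the determinantal process with the extended sine kernel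
      IsDeterminantalProcess Q
        (fun p q => extSineKernel (1 / (a : ℝ)) ((q.1 : ℝ) - p.1) (q.2 - p.2)) ∧
      (∀ Q' : Measure ConfigPath, IsDeterminantalProcess Q'
        (fun p q => extSineKernel (1 / (a : ℝ)) ((q.1 : ℝ) - p.1) (q.2 - p.2)) → Q' = Q) ∧
      -- `μ` is the determinantal point process with the sine kernel
      IsDeterminantal μ (fun x y => sineKernel (1 / (a : ℝ)) (y - x)) ∧
      (∀ μ' : Measure Config,
        IsDeterminantal μ' (fun x y => sineKernel (1 / (a : ℝ)) (y - x)) → μ' = μ) ∧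
      -- relaxation, with convergence of the correlation kernel
      RelaxesTo P Q ∧
      IsDeterminantalProcess P (equidistantKernel a) ∧
      (∀ s t : ℝ≥0, TendstoUniformly
        (fun (τ : ℝ≥0) (z : ℤ × ℤ) => equidistantKernel a (s + τ, z.1) (t + τ, z.2))
        (fun z : ℤ × ℤ => extSineKernel (1 / (a : ℝ)) ((t : ℝ) - s) (z.2 - z.1)) atTop) ∧
      -- the limit is stationary, of density `1 / a`, and reversible with respect to `μ`
      IsStationaryProcess Q ∧
      (∀ (t : ℝ≥0) (x : ℤ), ∫ ω, (ω t x : ℝ) ∂Q = 1 / (a : ℝ)) ∧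
      IsReversibleWith Q μ := by
  have : NeZero a := ⟨by omega⟩
  obtain ⟨P, hP⟩ := hV.exists_hasCorrelations_equidistantKernel
  have hlim : ∀ p q : ℝ≥0 × ℤ, Tendsto
      (fun τ : ℝ≥0 => equidistantKernel a (p.1 + τ, p.2) (q.1 + τ, q.2)) atTop
      (𝓝 (sineSpaceTime (1 / (a : ℝ)) p q)) := fun p q =>
    (tendstoUniformly_equidistantKernel (a := a) p.1 q.1).tendsto_at (p.2, q.2)
  obtain ⟨Q, hQ⟩ := exists_limit_process hP hlim
  have hμ := hQ.map_eval 0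
  refine ⟨P, Q, Q.map fun ω => ω 0, hV.isNoncollidingRW hP, fun P' hP' => ?_, hP.ae_start,
    isDeterminantalProcess_iff.2 hQ, fun Q' hQ' => ?_, isDeterminantal_iff.2 hμ, fun μ' hμ' => ?_,
    relaxesTo_of_tendsto_kernel hP hQ hlim, isDeterminantalProcess_iff.2 hP,
    tendstoUniformly_equidistantKernel, hQ.isStationaryProcess, hQ.integral_eq_density,
    fun t => (hQ.map_eval t).measure_eq hμ, hQ.map_reverse_eq⟩
  · exact (IsNoncollidingRW.hasCorrelations hV hP').process_eq hP
  · exact (isDeterminantalProcess_iff.1 hQ').process_eq hQ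
  · exact (isDeterminantal_iff.1 hμ').measure_eq hμ
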